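/- Let $\mathbb T^3=\mathbb R^3/\mathbb Z^3$, let $1<\gamma<\tfrac73$, let $q\in(1,4)$ satisfy $\gamma<1+\frac{4}{q+2}$, and let $0<T^*<\infty$. Let $(\varrho,u)$ be a density and a velocity on $\mathbb T^3\times[0,T^*)$, and let $v=u+\nabla\log\varrho$ be the effective velocity. Suppose that $(\varrho,v)$ is a strong solution on $\mathbb T^3\times[0,T^*)$ of the compressible Navier–Stokes–Korteweg system (viscosities $\mu(\varrho)=\varrho$, $\lambda=0$, capillarity $\kappa(\varrho)=1/\varrho$, pressure $P=\varrho^\gamma$) written in the effective velocity, $$\varrho_t+\operatorname{div}(\varrho v)-\Delta\varrho=0,\qquad \varrho v_t+\varrho(v-\nabla\log\varrho)\cdot\nabla v+\nabla\varrho^\gamma=\operatorname{div}(\varrho\nabla v).$$ Here a strong solution means that, for every $0<T<T^*$, the density is bounded below by a positive constant on $\mathbb T^3\times[0,T]$, $$\varrho\in C([0,T];H^3)\cap L^2(0,T;H^4),\quad \varrho_t\in C([0,T];H^1)\cap L^2(0,T;H^2),$$ $$v\in C([0,T];H^2)\cap L^2(0,T;H^3),\quad v_t\in L^\infty(0,T;L^2)\cap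 L^2(0,T;H^1),$$ and the equations hold almost everywhere. Put $\varrho_0=\varrho(0)$, $u_0=u(0)$, $v_0=v(0)$, $$E_0=\int_{\mathbb T^3}\Big(\tfrac12\varrho_0|u_0|^2+\tfrac1{\gamma-1}\varrho_0^\gamma+2|\nabla\sqrt{\varrho_0}|^2\Big)dx,\qquad \Theta_T=\sup_{0\le t\le T}\|\varrho^{-1}(t)\|_{L^\infty}+e^{25/9}.$$ Then there is a constant $C_v\ge1$, depending only on $T^*$, $q$, $\gamma$, $E_0$, $\|\varrho_0^{1/(q+2)}v_0\|_{L^{q+2}}$, $\|\varrho_0\|_{L^\infty}$ and $\|v_0\|_{L^\infty}$, such that for every $0<T<T^*$ $$\sup_{0\le t\le T}\|v(t)\|_{L^\infty}\le C_v\sqrt{\log\Theta_T}.$$ -/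

import Mathlib

open MeasureTheory Filter Topology
open scoped ENNReal ContDiff

noncomputable section

namespace NSK

/-- The flat torus `ℝ³ / ℤ³`, carrying its Lebesgue (probability) measure `volume`. -/
abbrev T3 : Type := UnitAddTorus (Fin 3)

/-- Euclidean three-space, in which velocities take their values. -/
abbrev E3 : Type := EuclideanSpace ℝ (Fin 3)

/-- The quotient map `ℝ³ → ℝ³ / ℤ³`. -/
def toT3 (y : Fin 3 → ℝ) : T3 := fun i => (y i : UnitAddCircle)

/-! ### Sobolev spaces on the torus through weak derivatives -/

/-- Smooth functions on the torus: the periodic lift to `ℝ³` is `C^∞`. -/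
def IsSmooth (φ : T3 → ℝ) : Prop := ContDiff ℝ ∞ (fun y : Fin 3 → ℝ => φ (toT3 y))

/-- The classical partial derivative `∂_i φ` on the torus. -/
def partialD (i : Fin 3) (φ : T3 → ℝ) (x : T3) : ℝ :=
  deriv (fun s : ℝ => φ (x + Pi.single i (s : UnitAddCircle))) 0

/-- `g` is the weak derivative `∂_i f` on the torus. -/
def HasWeakPartial (i : Fin 3) (f g : T3 → ℝ) : Prop :=
  Integrable f ∧ Integrable g ∧
    ∀ φ : T3 → ℝ, IsSmooth φ → ∫ x, f x * partialD i φ x = - ∫ x, g x * φ x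

open Classical in
/-- A representative of the weak derivative `∂_i f` (which is unique up to null sets);
it is `0` if `f` has no weak derivative in direction `i`. -/
def weakPartial (i : Fin 3) (f : T3 → ℝ) : T3 → ℝ :=
  if h : ∃ g, HasWeakPartial i f g then h.choose else 0

/-- Membership in the Sobolev space `H^k = W^{k,2}` of the torus. -/
def MemH : ℕ → (T3 → ℝ) → Prop
  | 0, f => MemLp f 2 volume
  | k + 1, f => MemLp f 2 volume ∧
      ∀ i : Fin 3, (∃ g, HasWeakPartial i f g) ∧ MemH k (weakPartial i f)

/-- The square of the `H^k` norm: the sum of `‖∂_{i_1} ⋯ ∂_{i_j} f‖²_{L²}` over all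
`j ≤ k` and all `i_1, …, i_j`. It is meaningful for `f` with `MemH k f`. -/
def sobolevSq : ℕ → (T3 → ℝ) → ℝ≥0∞
  | 0, f => eLpNorm f 2 volume ^ 2
  | k + 1, f => eLpNorm f 2 volume ^ 2 + ∑ i : Fin 3, sobolevSq k (weakPartial i f)

/-- The weak gradient. -/
def weakGrad (f : T3 → ℝ) (x : T3) : E3 := WithLp.toLp 2 (fun i => weakPartial i f x)

/-! ### Functions of time and space, on `T3 × [0, Tstar)` -/

/-- Measurability on `(0, Tstar) × T3`. -/
def SpaceTimeMeasurable (Tstar : ℝ) (f : ℝ → T3 → ℝ) : Prop :=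
  AEStronglyMeasurable (fun p : ℝ × T3 => f p.1 p.2)
    ((volume.restrict (Set.Ioo 0 Tstar)).prod volume)

/-- `f ∈ C([0,T]; H^k)` for every `T < Tstar`. -/
def MemCH (Tstar : ℝ) (k : ℕ) (f : ℝ → T3 → ℝ) : Prop :=
  (∀ t ∈ Set.Ico 0 Tstar, MemH k (f t)) ∧
    ∀ s ∈ Set.Ico 0 Tstar,
      Tendsto (fun t => sobolevSq k (fun x => f t x - f s x)) (𝓝[Set.Ico 0 Tstar] s) (𝓝 0)

/-- `f ∈ L²(0,T; H^k)` for every `T < Tstar`. -/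
def MemL2H (Tstar : ℝ) (k : ℕ) (f : ℝ → T3 → ℝ) : Prop :=
  (∀ᵐ t ∂(volume.restrict (Set.Ioo 0 Tstar)), MemH k (f t)) ∧
    ∀ T : ℝ, 0 < T → T < Tstar → ∫⁻ t in Set.Ioo 0 T, sobolevSq k (f t) < ⊤

/-- `f ∈ L^∞(0,T; L²)` for every `T < Tstar`. -/
def MemLinftyL2 (Tstar : ℝ) (f : ℝ → T3 → ℝ) : Prop :=
  ∀ T : ℝ, 0 < T → T < Tstar →
    ∃ M : ℝ, ∀ᵐ t ∂(volume.restrict (Set.Ioo 0 T)),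
      MemLp (f t) 2 volume ∧ eLpNorm (f t) 2 volume ≤ ENNReal.ofReal M

/-- Test functions in `C_c^∞((0, Tstar) × T3)`. -/
def IsSpaceTimeTest (Tstar : ℝ) (φ : ℝ → T3 → ℝ) : Prop :=
  ContDiff ℝ ∞ (fun p : ℝ × (Fin 3 → ℝ) => φ p.1 (toT3 p.2)) ∧
    ∃ a b : ℝ, 0 < a ∧ b < Tstar ∧ ∀ t, t ∉ Set.Icc a b → ∀ x, φ t x = 0

/-- `g` is the weak time derivative of `f` on `(0, Tstar) × T3`. -/
def HasWeakTimeDeriv (Tstar : ℝ) (f g : ℝ → T3 → ℝ) : Prop :=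
  ∀ φ : ℝ → T3 → ℝ, IsSpaceTimeTest Tstar φ →
    ∫ t in Set.Ioo 0 Tstar, ∫ x, f t x * deriv (fun s => φ s x) t =
      - ∫ t in Set.Ioo 0 Tstar, ∫ x, g t x * φ t x

/-! ### The system -/

/-- `(ρ, v)`, with time derivatives `(ρt, vt)`, is a strong solution on `T3 × [0, Tstar)` of
`ρ_t + div (ρ v) - Δ ρ = 0`,
`ρ v_t + ρ (v - ∇ log ρ) · ∇ v + ∇ ρ^γ = div (ρ ∇ v)`,
with density bounded away from vacuum on every `[0, T]`, `T < Tstar`. -/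
structure IsStrongSolutionWith (γ Tstar : ℝ) (ρ ρt : ℝ → T3 → ℝ) (v vt : ℝ → T3 → E3) :
    Prop where
  meas_ρ : SpaceTimeMeasurable Tstar ρ
  meas_ρt : SpaceTimeMeasurable Tstar ρt
  meas_v : ∀ i, SpaceTimeMeasurable Tstar (fun t x => v t x i)
  meas_vt : ∀ i, SpaceTimeMeasurable Tstar (fun t x => vt t x i)
  positive : ∀ T, 0 < T → T < Tstar → ∃ c > 0, ∀ t ∈ Set.Icc 0 T, ∀ᵐ x : T3, c ≤ ρ t x
  ρ_cont : MemCH Tstar 3 ρ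
  ρ_L2 : MemL2H Tstar 4 ρ
  ρt_cont : MemCH Tstar 1 ρt
  ρt_L2 : MemL2H Tstar 2 ρt
  v_cont : ∀ i, MemCH Tstar 2 (fun t x => v t x i)
  v_L2 : ∀ i, MemL2H Tstar 3 (fun t x => v t x i)
  vt_Linfty : ∀ i, MemLinftyL2 Tstar (fun t x => vt t x i)
  vt_L2 : ∀ i, MemL2H Tstar 1 (fun t x => vt t x i)
  ρ_deriv : HasWeakTimeDeriv Tstar ρ ρt
  v_deriv : ∀ i, HasWeakTimeDeriv Tstar (fun t x => v t x i) (fun t x => vt t x i)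
  mass : ∀ᵐ t ∂(volume.restrict (Set.Ioo 0 Tstar)), ∀ᵐ x : T3,
    ρt t x + ∑ j, weakPartial j (fun y => ρ t y * v t y j) x
      - ∑ j, weakPartial j (weakPartial j (ρ t)) x = 0
  momentum : ∀ᵐ t ∂(volume.restrict (Set.Ioo 0 Tstar)), ∀ᵐ x : T3, ∀ i,
    ρ t x * vt t x i
      + ρ t x * ∑ j, (v t x j - weakPartial j (fun y => Real.log (ρ t y)) x)
          * weakPartial j (fun y => v t y i) x
      + weakPartial i (fun y => ρ t y ^ γ) x
      = ∑ j, weakPartial j (fun y => ρ t y * weakPartial j (fun z => v t z i) y) x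

/-- `(ρ, v)` is a strong solution on `T3 × [0, Tstar)`. -/
def IsStrongSolution (γ Tstar : ℝ) (ρ : ℝ → T3 → ℝ) (v : ℝ → T3 → E3) : Prop :=
  ∃ (ρt : ℝ → T3 → ℝ) (vt : ℝ → T3 → E3), IsStrongSolutionWith γ Tstar ρ ρt v vt

/-- `v = u + ∇ log ρ` on `T3 × [0, Tstar)`. -/
def IsEffectiveVelocity (Tstar : ℝ) (ρ : ℝ → T3 → ℝ) (u v : ℝ → T3 → E3) : Prop :=
  ∀ t ∈ Set.Ico 0 Tstar, ∀ᵐ x : T3, v t x = u t x + weakGrad (fun y => Real.log (ρ t y)) x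

/-- The energy `∫ (ρ₀ |u₀|² / 2 + ρ₀^γ / (γ - 1) + 2 |∇ √ρ₀|²) dx`. -/
def energy (γ : ℝ) (ρ₀ : T3 → ℝ) (u₀ : T3 → E3) : ℝ :=
  ∫ x, (1 / 2 * ρ₀ x * ‖u₀ x‖ ^ 2 + 1 / (γ - 1) * ρ₀ x ^ γ
    + 2 * ‖weakGrad (fun y => Real.sqrt (ρ₀ y)) x‖ ^ 2)

/-- `‖ρ₀^{1/(q+2)} v₀‖_{L^{q+2}}`. -/
def weightedNorm (q : ℝ) (ρ₀ : T3 → ℝ) (v₀ : T3 → E3) : ℝ :=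
  (eLpNorm (fun x => ρ₀ x ^ (1 / (q + 2)) • v₀ x) (ENNReal.ofReal (q + 2)) volume).toReal

/-- `Θ_T = sup_{0 ≤ t ≤ T} ‖ρ(t)⁻¹‖_{L^∞} + e^{25/9}`. -/
def Theta (ρ : ℝ → T3 → ℝ) (T : ℝ) : ℝ :=
  (⨆ t ∈ Set.Icc 0 T, eLpNorm (fun x => (ρ t x)⁻¹) ⊤ volume).toReal + Real.exp (25 / 9)

end NSK

end

/-!
The bound is obtained for each component `v_i` of the effective velocity separately. Along a strong
solution, for all regular `F` and `G`,
`d/dt ∫ ρ F(v_i) = -∫ ρ F''(v_i) |∇v_i|² + ∫ ρ^γ F''(v_i) ∂_i v_i`,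
`d/dt ∫ G(ρ) = -∫ G''(ρ) |∇ρ|² + ∫ G''(ρ) ρ v·∇ρ`
(`NSK.Evolution.velocity`, `NSK.Evolution.density`). Young's inequality turns the pressure into half
of the dissipation and `½ ∫ ρ^{2γ-1} F''(v_i)` (`NSK.Slice.velocity_le`).

*Energy.* The energy of `u = v - ∇ log ρ` decreases (`NSK.Slice.integral_energy_nonpos`,
`NSK.Evolution.antitone_energy`), which bounds `∇√ρ` in `L²` and, by the Sobolev inequality, `ρ` in
`L³` (`NSK.Evolution.energy_bounds`). The energy formed with `v` in place of `u` decreases as well,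
and its dissipation bounds `ρ^γ` in `L¹(0,T; L³)` (`NSK.Evolution.effEnergy_deriv`).

*Higher integrability.* For `F(x) = (1 + x²)^{p/2}` with `p = 4/(γ-1)` if `γ ≥ 5/3` and
`p = 2/(γ-1)` otherwise, interpolation between these two bounds on `ρ` and Gronwall's inequality
bound `∫ ρ |v|^p` (`NSK.exists_velocity_Lp_bound`). The condition `γ < 7/3` says that `p > 3`.

*Density.* As `p` exceeds the space dimension, De Giorgi's iteration (`NSK.deGiorgi`), applied to
`∫ (ρ - k)_+^4`, improves a sufficiently large bound `N` of the density to `N/2`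
(`NSK.Evolution.density_half`). A strong solution has some bound at the outset, so that halving
leads to one that depends only on the data (`NSK.exists_density_bound`).

*Velocity.* Now `ρ ≤ N`. Let `Θ⁻¹` be a lower bound of the density. De Giorgi's iteration for
`∫ ρ (±v_i - k)_+^4` between the levels `M` and `2M` costs a fixed power of `Θ` and gains a power
of `∫∫ (±v_i - M)_+²` (`NSK.Evolution.velocity_le_two_mul`). The choice `F(x) = e^{±λx}` yields
`∫ ρ e^{±λ v_i} ≤ C e^{C(λ + λ²)}` (`NSK.Evolution.exp_moment_le`), whence
`∫ (±v_i - M)_+² ≤ C Θ e^{C(λ + λ²) - λM}`. For `λ = √(log Θ)` and `M = Cλ` with large `C` this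
factor beats every fixed power of `Θ = e^{λ²}`, and `|v_i| ≤ 2M`
(`NSK.exists_velocity_bound`).

The weak formulation is brought to bear as follows. Functions on the torus are approximated by
their Fourier sums, which commute with weak derivatives; this gives integration by parts, the chain
rule, the embeddings `H¹ ⊂ L⁶` and `H² ⊂ L^∞`. In time, `ρ`, `v_i` and `∂_i ρ` are Lipschitz curves in
`L²` (`NSK.IsCurve`), along which integral functionals are Lipschitz and have the formal derivative
at almost every time (`NSK.chain_rule_curve`). All identities are verified at a fixed time, for
the structure `NSK.Slice`; differential inequalities are integrated only after the space integral
has been taken, so that weak derivatives need not be jointly measurable in time and space.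
-/

noncomputable section

namespace NSK

instance : IsProbabilityMeasure (volume : Measure UnitAddCircle) :=
  ⟨by rw [UnitAddCircle.measure_univ]⟩

instance : IsProbabilityMeasure (volume : Measure T3) := by
  rw [volume_pi]; infer_instance

/-! ### Smooth functions on the torus -/

lemma continuous_toT3 : Continuous toT3 :=
  continuous_pi fun i => (AddCircle.continuous_mk' 1).comp (continuous_apply i)

lemma toT3_surjective (x : T3) : ∃ y, toT3 y = x := by
  choose y hy using fun i => QuotientAddGroup.mk_surjective (x i)
  exact ⟨y, funext hy⟩

lemma isQuotientMap_toT3 : IsQuotientMap toT3 := by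
  refine IsOpenMap.isQuotientMap ?_ continuous_toT3 toT3_surjective
  exact IsOpenMap.piMap (fun i => QuotientAddGroup.isOpenMap_coe)
    (Eventually.of_forall fun i => QuotientAddGroup.mk_surjective)

lemma toT3_add_single (y : Fin 3 → ℝ) (i : Fin 3) (s : ℝ) :
    toT3 y + Pi.single i (s : UnitAddCircle) = toT3 (y + Pi.single i s) := by
  funext j
  by_cases h : j = i
  · subst h; simp [toT3]
  · simp [toT3, h]

lemma IsSmooth.continuous {φ : T3 → ℝ} (h : IsSmooth φ) : Continuous φ :=
  isQuotientMap_toT3.continuous_iff.2 (ContDiff.continuous h)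

lemma exists_bound_of_continuous {φ : T3 → ℝ} (h : Continuous φ) : ∃ C, ∀ x, ‖φ x‖ ≤ C := by
  obtain ⟨C, hC⟩ := (isCompact_univ (X := T3)).exists_bound_of_continuousOn h.continuousOn
  exact ⟨C, fun x => hC x (Set.mem_univ x)⟩

lemma memLp_of_continuous {φ : T3 → ℝ} (h : Continuous φ) (p : ℝ≥0∞) : MemLp φ p volume := by
  obtain ⟨C, hC⟩ := exists_bound_of_continuous h
  exact MemLp.of_bound h.aestronglyMeasurable C (Eventually.of_forall hC)

lemma integrable_of_continuous {φ : T3 → ℝ} (h : Continuous φ) : Integrable φ :=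
  memLp_one_iff_integrable.1 (memLp_of_continuous h 1)

lemma IsSmooth.hasDerivAt {φ : T3 → ℝ} (h : IsSmooth φ) (i : Fin 3) (x : T3) (s : ℝ) :
    HasDerivAt (fun s : ℝ => φ (x + Pi.single i (s : UnitAddCircle)))
      (partialD i φ (x + Pi.single i (s : UnitAddCircle))) s := by
  obtain ⟨y, rfl⟩ := toT3_surjective x
  have hd : Differentiable ℝ (fun s : ℝ => φ (toT3 y + Pi.single i (s : UnitAddCircle))) := by
    simp only [toT3_add_single]
    refine (h.differentiable (by simp)).comp ?_
    refine (differentiable_const y).add (differentiable_pi.2 fun j => ?_)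
    by_cases hj : j = i
    · subst hj; simp
    · simp [hj]
  have h1 := (hd s).hasDerivAt
  refine h1.congr_deriv ?_
  symm
  unfold NSK.partialD
  have h2 : (fun r : ℝ => φ (toT3 y + Pi.single i (s : UnitAddCircle)
      + Pi.single i (r : UnitAddCircle)))
      = fun r : ℝ => (fun s : ℝ => φ (toT3 y + Pi.single i (s : UnitAddCircle))) (s + r) := by
    funext r
    simp [add_assoc, ← Pi.single_add]
  rw [h2]
  exact (deriv_comp_const_add (f := fun s : ℝ => φ (toT3 y + Pi.single i (s : UnitAddCircle)))
    s 0).trans (by rw [add_zero])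

lemma IsSmooth.partialD_lift {φ : T3 → ℝ} (h : IsSmooth φ) (i : Fin 3) (y : Fin 3 → ℝ) :
    partialD i φ (toT3 y) = fderiv ℝ (fun y => φ (toT3 y)) y (Pi.single i 1) := by
  have h0 := h.hasDerivAt i (toT3 y) 0
  simp only [toT3_add_single, Pi.single_zero, add_zero] at h0
  have h1 : HasDerivAt (fun s : ℝ => y + (Pi.single i s : Fin 3 → ℝ)) (Pi.single i 1) 0 := by
    refine HasDerivAt.const_add y (hasDerivAt_pi.2 fun j => ?_)
    by_cases hj : j = i
    · subst hj; simpa using hasDerivAt_id' (0 : ℝ)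
    · simpa [hj] using hasDerivAt_const (0 : ℝ) (0 : ℝ)
  have h2 : HasFDerivAt (fun y => φ (toT3 y)) (fderiv ℝ (fun y => φ (toT3 y)) y)
      (y + (Pi.single i (0:ℝ) : Fin 3 → ℝ)) := by
    simpa using (h.differentiable (by simp) y).hasFDerivAt
  exact h0.unique (h2.comp_hasDerivAt (0:ℝ) h1 :)

lemma IsSmooth.partialD {φ : T3 → ℝ} (h : IsSmooth φ) (i : Fin 3) : IsSmooth (partialD i φ) := by
  have h1 : (fun y : Fin 3 → ℝ => NSK.partialD i φ (toT3 y))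
      = fun y => fderiv ℝ (fun y => φ (toT3 y)) y (Pi.single i 1) :=
    funext fun y => h.partialD_lift i y
  unfold IsSmooth
  rw [h1]
  exact (ContDiff.fderiv_right (m := ∞) h (by simp)).clm_apply contDiff_const

lemma IsSmooth.mul {φ ψ : T3 → ℝ} (h : IsSmooth φ) (h' : IsSmooth ψ) :
    IsSmooth (fun x => φ x * ψ x) := ContDiff.mul h h'

lemma IsSmooth.add {φ ψ : T3 → ℝ} (h : IsSmooth φ) (h' : IsSmooth ψ) :
    IsSmooth (fun x => φ x + ψ x) := ContDiff.add h h'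

lemma isSmooth_const (c : ℝ) : IsSmooth (fun _ => c) := contDiff_const

lemma IsSmooth.sum {ι : Type*} {S : Finset ι} {φ : ι → T3 → ℝ} (h : ∀ k ∈ S, IsSmooth (φ k)) :
    IsSmooth (fun x => ∑ k ∈ S, φ k x) := ContDiff.sum fun k hk => h k hk

lemma hasDerivAt_partialD {φ : T3 → ℝ} (h : IsSmooth φ) (i : Fin 3) (x : T3) :
    HasDerivAt (fun s : ℝ => φ (x + Pi.single i (s : UnitAddCircle))) (partialD i φ x) 0 := by
  simpa using h.hasDerivAt i x 0

lemma partialD_mul {φ ψ : T3 → ℝ} (h : IsSmooth φ) (h' : IsSmooth ψ) (i : Fin 3) (x : T3) :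
    partialD i (fun x => φ x * ψ x) x = φ x * partialD i ψ x + partialD i φ x * ψ x := by
  have := ((hasDerivAt_partialD h i x).mul (hasDerivAt_partialD h' i x)).deriv
  simp only [QuotientAddGroup.mk_zero, Pi.single_zero, add_zero] at this
  rw [partialD]
  refine this.trans (by ring)

lemma partialD_sum {ι : Type*} {S : Finset ι} {φ : ι → T3 → ℝ} (h : ∀ k ∈ S, IsSmooth (φ k))
    (i : Fin 3) (x : T3) :
    partialD i (fun x => ∑ k ∈ S, φ k x) x = ∑ k ∈ S, partialD i (φ k) x :=
  (HasDerivAt.fun_sum fun k hk => hasDerivAt_partialD (h k hk) i x).deriv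

lemma partialD_const_mul {φ : T3 → ℝ} (h : IsSmooth φ) (c : ℝ) (i : Fin 3) (x : T3) :
    partialD i (fun x => c * φ x) x = c * partialD i φ x :=
  ((hasDerivAt_partialD h i x).const_mul c).deriv

/-- The integral of a continuous directional derivative over the torus vanishes, because the
integral is invariant under translations. -/
lemma integral_dirDeriv_eq_zero (i : Fin 3) {h h' : T3 → ℝ} (hc : Continuous h)
    (hc' : Continuous h')
    (hd : ∀ (x : T3) (s : ℝ), HasDerivAt (fun s : ℝ => h (x + Pi.single i (s : UnitAddCircle)))
      (h' (x + Pi.single i (s : UnitAddCircle))) s) :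
    ∫ x, h' x = 0 := by
  obtain ⟨C, hC⟩ := exists_bound_of_continuous hc'
  have hs : ∀ s : ℝ, Continuous fun x : T3 => h (x + Pi.single i (s : UnitAddCircle)) :=
    fun s => hc.comp (continuous_id.add continuous_const)
  have hs' : ∀ s : ℝ, Continuous fun x : T3 => h' (x + Pi.single i (s : UnitAddCircle)) :=
    fun s => hc'.comp (continuous_id.add continuous_const)
  have h1 := hasDerivAt_integral_of_dominated_loc_of_deriv_le (μ := (volume : Measure T3))
    (F := fun (s : ℝ) x => h (x + Pi.single i (s : UnitAddCircle)))
    (F' := fun (s : ℝ) x => h' (x + Pi.single i (s : UnitAddCircle))) (x₀ := 0)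
    (s := Set.univ) (bound := fun _ => C) univ_mem
    (Eventually.of_forall fun s => (hs s).aestronglyMeasurable)
    (integrable_of_continuous (hs 0)) (hs' 0).aestronglyMeasurable
    (Eventually.of_forall fun x s _ => hC _)
    (integrable_const C)
    (Eventually.of_forall fun x s _ => hd x s)
  have h2 : (fun s : ℝ => ∫ x : T3, h (x + Pi.single i (s : UnitAddCircle)))
      = fun _ => ∫ x, h x := by
    funext s
    exact integral_add_right_eq_self h _
  have h3 := h1.2
  rw [h2] at h3
  have h4 := h3.unique (hasDerivAt_const (0:ℝ) (∫ x, h x))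
  simpa using h4

lemma integral_partialD_mul {φ ψ : T3 → ℝ} (h : IsSmooth φ) (h' : IsSmooth ψ) (i : Fin 3) :
    ∫ x, φ x * partialD i ψ x = - ∫ x, partialD i φ x * ψ x := by
  have h0 := integral_dirDeriv_eq_zero i (h.mul h').continuous ((h.mul h').partialD i).continuous
    (fun x s => (h.mul h').hasDerivAt i x s)
  simp only [partialD_mul h h'] at h0
  have i1 : Integrable fun x => φ x * partialD i ψ x :=
    integrable_of_continuous (h.continuous.mul (h'.partialD i).continuous)
  have i2 : Integrable fun x => partialD i φ x * ψ x :=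
    integrable_of_continuous ((h.partialD i).continuous.mul h'.continuous)
  rw [integral_add i1 i2] at h0
  linarith

lemma hasWeakPartial_of_isSmooth {φ : T3 → ℝ} (h : IsSmooth φ) (i : Fin 3) :
    HasWeakPartial i φ (partialD i φ) :=
  ⟨integrable_of_continuous h.continuous, integrable_of_continuous (h.partialD i).continuous,
    fun _ h' => integral_partialD_mul h h' i⟩

/-! ### Trigonometric approximation -/

/-- The real part of the character `x ↦ exp (2πi k·x)`. -/
def trigC (k : Fin 3 → ℤ) (x : T3) : ℝ := (UnitAddTorus.mFourier k x).re

/-- The imaginary part of the character `x ↦ exp (2πi k·x)`. -/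
def trigS (k : Fin 3 → ℤ) (x : T3) : ℝ := (UnitAddTorus.mFourier k x).im

lemma mFourier_toT3 (k : Fin 3 → ℤ) (y : Fin 3 → ℝ) :
    UnitAddTorus.mFourier k (toT3 y)
      = Complex.exp (((2 * Real.pi * ∑ j, k j * y j : ℝ) : ℂ) * Complex.I) := by
  simp only [UnitAddTorus.mFourier, ContinuousMap.coe_mk, toT3, fourier_coe_apply]
  rw [← Complex.exp_sum]
  congr 1
  push_cast
  rw [Finset.mul_sum, Finset.sum_mul]
  refine Finset.sum_congr rfl fun j _ => ?_
  simp; ring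

lemma trigC_toT3 (k : Fin 3 → ℤ) (y : Fin 3 → ℝ) :
    trigC k (toT3 y) = Real.cos (2 * Real.pi * ∑ j, k j * y j) := by
  rw [trigC, mFourier_toT3, Complex.exp_ofReal_mul_I_re]

lemma trigS_toT3 (k : Fin 3 → ℤ) (y : Fin 3 → ℝ) :
    trigS k (toT3 y) = Real.sin (2 * Real.pi * ∑ j, k j * y j) := by
  rw [trigS, mFourier_toT3, Complex.exp_ofReal_mul_I_im]

lemma isSmooth_trigC (k : Fin 3 → ℤ) : IsSmooth (trigC k) := by
  unfold IsSmooth; simp only [trigC_toT3]; fun_prop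

lemma isSmooth_trigS (k : Fin 3 → ℤ) : IsSmooth (trigS k) := by
  unfold IsSmooth; simp only [trigS_toT3]; fun_prop

lemma hasDerivAt_phase (k : Fin 3 → ℤ) (y : Fin 3 → ℝ) (i : Fin 3) :
    HasDerivAt (fun s : ℝ => 2 * Real.pi * ∑ j, (k j : ℝ) * (y + Pi.single i s : Fin 3 → ℝ) j)
      (2 * Real.pi * k i) 0 := by
  have h1 : (fun s : ℝ => 2 * Real.pi * ∑ j, (k j : ℝ) * (y + Pi.single i s : Fin 3 → ℝ) j)
      = fun s => 2 * Real.pi * ∑ j, (k j : ℝ) * y j + 2 * Real.pi * k i * s := by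
    funext s
    simp only [Pi.add_apply, mul_add, Finset.sum_add_distrib]
    rw [Finset.sum_eq_single i (f := fun j => (k j : ℝ) * (Pi.single i s : Fin 3 → ℝ) j)]
    · simp; ring
    · intro j _ hj; simp [hj]
    · simp
  rw [h1]
  simpa using ((hasDerivAt_id (0:ℝ)).const_mul (2 * Real.pi * k i)).const_add
    (2 * Real.pi * ∑ j, (k j : ℝ) * y j)

lemma partialD_trigC (k : Fin 3 → ℤ) (i : Fin 3) (x : T3) :
    partialD i (trigC k) x = - (2 * Real.pi * k i) * trigS k x := by
  obtain ⟨y, rfl⟩ := toT3_surjective x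
  have h := (hasDerivAt_phase k y i).cos.deriv
  simp only [Pi.single_zero, add_zero] at h
  simp only [partialD, toT3_add_single, trigC_toT3, trigS_toT3, h]
  ring

lemma partialD_trigS (k : Fin 3 → ℤ) (i : Fin 3) (x : T3) :
    partialD i (trigS k) x = (2 * Real.pi * k i) * trigC k x := by
  obtain ⟨y, rfl⟩ := toT3_surjective x
  have h := (hasDerivAt_phase k y i).sin.deriv
  simp only [Pi.single_zero, add_zero] at h
  simp only [partialD, toT3_add_single, trigC_toT3, trigS_toT3, h]
  ring

/-- The partial sum over the frequencies in `S` of the Fourier series of `f`, in real form. -/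
def trigSum (S : Finset (Fin 3 → ℤ)) (f : T3 → ℝ) (x : T3) : ℝ :=
  ∑ k ∈ S, ((∫ y, f y * trigC k y) * trigC k x + (∫ y, f y * trigS k y) * trigS k x)

lemma isSmooth_trigSum (S : Finset (Fin 3 → ℤ)) (f : T3 → ℝ) : IsSmooth (trigSum S f) :=
  IsSmooth.sum fun k _ => ((isSmooth_const _).mul (isSmooth_trigC k)).add
    ((isSmooth_const _).mul (isSmooth_trigS k))

/-- Fourier sums commute with weak derivatives. -/
lemma partialD_trigSum (S : Finset (Fin 3 → ℤ)) {f g : T3 → ℝ} {i : Fin 3}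
    (h : HasWeakPartial i f g) (x : T3) : partialD i (trigSum S f) x = trigSum S g x := by
  unfold trigSum
  rw [partialD_sum fun k _ => ((isSmooth_const _).mul (isSmooth_trigC k)).add
    ((isSmooth_const _).mul (isSmooth_trigS k))]
  refine Finset.sum_congr rfl fun k _ => ?_
  have hc := h.2.2 _ (isSmooth_trigC k)
  have hs := h.2.2 _ (isSmooth_trigS k)
  simp only [partialD_trigC, partialD_trigS] at hc hs
  have e1 : ∫ x, g x * trigC k x = (2 * Real.pi * k i) * ∫ x, f x * trigS k x := by
    rw [← integral_const_mul, eq_comm, ← neg_eq_iff_eq_neg.2 hc, ← integral_neg]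
    congr 1; funext x; ring
  have e2 : ∫ x, g x * trigS k x = -((2 * Real.pi * k i) * ∫ x, f x * trigC k x) := by
    rw [← integral_const_mul, ← neg_eq_iff_eq_neg.2 hs]
    congr 2; funext x; ring
  have hd := ((hasDerivAt_partialD (isSmooth_trigC k) i x).const_mul
    (∫ y, f y * trigC k y)).add ((hasDerivAt_partialD (isSmooth_trigS k) i x).const_mul
    (∫ y, f y * trigS k y))
  have := hd.deriv
  rw [partialD]
  refine this.trans ?_
  rw [e1, e2, partialD_trigC, partialD_trigS]
  ring

/-- Mathlib's Fourier series on tori uses the product of the normalised Haar measures. -/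
lemma volume_T3_eq : (volume : Measure T3) = Measure.pi fun _ => AddCircle.haarAddCircle := by
  rw [volume_pi]
  congr 1
  funext i
  rw [AddCircle.volume_eq_smul_haarAddCircle]; simp

lemma mFourierCoeff_re_mul {f : T3 → ℝ} (hf : Integrable f) (k : Fin 3 → ℤ) (x : T3) :
    (UnitAddTorus.mFourierCoeff (fun x => (f x : ℂ)) k * UnitAddTorus.mFourier k x).re
      = (∫ y, f y * trigC k y) * trigC k x + (∫ y, f y * trigS k y) * trigS k x := by
  have h0 : UnitAddTorus.mFourierCoeff (fun x => (f x : ℂ)) k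
      = ∫ y : T3, UnitAddTorus.mFourier (-k) y • (f y : ℂ) := by
    rw [volume_T3_eq]; rfl
  have hi : Integrable (fun y : T3 => UnitAddTorus.mFourier (-k) y • (f y : ℂ)) := by
    refine hf.ofReal.bdd_mul (c := 1)
      (UnitAddTorus.mFourier (-k)).continuous.aestronglyMeasurable
      (Eventually.of_forall fun y => ?_)
    exact ((UnitAddTorus.mFourier (-k)).norm_coe_le_norm y).trans UnitAddTorus.mFourier_norm.le
  have hre : (UnitAddTorus.mFourierCoeff (fun x => (f x : ℂ)) k).re = ∫ y, f y * trigC k y := by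
    rw [h0]
    refine (integral_re hi).symm.trans (integral_congr_ae (Eventually.of_forall fun y => ?_))
    simp [UnitAddTorus.mFourier_neg, trigC, mul_comm]
  have him : (UnitAddTorus.mFourierCoeff (fun x => (f x : ℂ)) k).im
      = - ∫ y, f y * trigS k y := by
    rw [h0, ← integral_neg]
    refine (integral_im hi).symm.trans (integral_congr_ae (Eventually.of_forall fun y => ?_))
    simp [UnitAddTorus.mFourier_neg, trigS, mul_comm]
  rw [Complex.mul_re, hre, him]
  simp only [trigC, trigS]; ring

/-- Fourier series converge in `L²`. -/
lemma tendsto_trigSum {f : T3 → ℝ} (hf : MemLp f 2 volume) :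
    Tendsto (fun S => eLpNorm (fun x => f x - trigSum S f x) 2 volume) atTop (𝓝 0) := by
  have hfi : Integrable f := hf.integrable (by norm_num)
  have hfc : MemLp (fun x => (f x : ℂ)) 2 (Measure.pi fun _ : Fin 3 => AddCircle.haarAddCircle) := by
    rw [← volume_T3_eq]; exact hf.ofReal
  have h1 := UnitAddTorus.hasSum_mFourier_series_L2 (d := Fin 3) hfc.toLp
  have h1 := tendsto_iff_edist_tendsto_0.1 h1
  refine tendsto_of_tendsto_of_tendsto_of_le_of_le tendsto_const_nhds h1 (fun _ => zero_le)
    fun S => ?_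
  dsimp only
  rw [edist_comm, Lp.edist_def]
  rw [volume_T3_eq]
  have hco : ∀ k, UnitAddTorus.mFourierCoeff (hfc.toLp) k
      = UnitAddTorus.mFourierCoeff (fun x => (f x : ℂ)) k := fun k => by
    refine integral_congr_ae ?_
    filter_upwards [hfc.coeFn_toLp] with x hx
    rw [hx]
  refine eLpNorm_mono_ae ?_
  have hs : ∀ᵐ x ∂(Measure.pi fun _ : Fin 3 => AddCircle.haarAddCircle),
      (∑ k ∈ S, UnitAddTorus.mFourierCoeff (hfc.toLp) k • UnitAddTorus.mFourierLp 2 k :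
        Lp ℂ 2 (Measure.pi fun _ : Fin 3 => AddCircle.haarAddCircle)) x
      = ∑ k ∈ S, UnitAddTorus.mFourierCoeff (fun x => (f x : ℂ)) k * UnitAddTorus.mFourier k x := by
    have h2 : ∀ᵐ x ∂(Measure.pi fun _ : Fin 3 => AddCircle.haarAddCircle), ∀ k : Fin 3 → ℤ,
        (UnitAddTorus.mFourierCoeff (hfc.toLp) k • UnitAddTorus.mFourierLp 2 k :
          Lp ℂ 2 (Measure.pi fun _ : Fin 3 => AddCircle.haarAddCircle)) x
        = UnitAddTorus.mFourierCoeff (fun x => (f x : ℂ)) k * UnitAddTorus.mFourier k x := by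
      refine ae_all_iff.2 fun k => ?_
      filter_upwards [Lp.coeFn_smul (UnitAddTorus.mFourierCoeff (hfc.toLp) k)
        (UnitAddTorus.mFourierLp (d := Fin 3) 2 k), UnitAddTorus.coeFn_mFourierLp 2 k] with x h3 h4
      refine h3.trans ?_
      rw [Pi.smul_apply, h4, hco]; rfl
    filter_upwards [h2, Lp.coeFn_finsetSum S fun k =>
      (UnitAddTorus.mFourierCoeff (hfc.toLp) k • UnitAddTorus.mFourierLp 2 k :
          Lp ℂ 2 (Measure.pi fun _ : Fin 3 => AddCircle.haarAddCircle))] with x h3 h4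
    rw [h4, Finset.sum_apply]
    exact Finset.sum_congr rfl fun k _ => h3 k
  filter_upwards [hs, hfc.coeFn_toLp] with x hx hx'
  rw [Pi.sub_apply, hx']
  have : f x - trigSum S f x = ((f x : ℂ) - ∑ k ∈ S,
      UnitAddTorus.mFourierCoeff (fun x => (f x : ℂ)) k * UnitAddTorus.mFourier k x).re := by
    rw [Complex.sub_re, Complex.re_sum, Complex.ofReal_re, trigSum]
    simp only [mFourierCoeff_re_mul hfi]
  rw [this]
  refine (Complex.abs_re_le_norm _).trans (le_of_eq ?_)
  congr 1
  congr 1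
  exact hx.symm

/-! ### Weak derivatives -/

lemma integral_mul_smooth_integrable {f φ : T3 → ℝ} (hf : Integrable f) (h : Continuous φ) :
    Integrable fun x => f x * φ x := by
  obtain ⟨C, hC⟩ := exists_bound_of_continuous h
  exact hf.mul_bdd h.aestronglyMeasurable (Eventually.of_forall hC)

/-- An integrable function that annihilates the smooth functions vanishes. It annihilates the
characters, hence all continuous functions, and the measures with the densities `h⁺` and `h⁻`
agree. -/
lemma ae_eq_zero_of_integral_smooth_eq_zero {h : T3 → ℝ} (hi : Integrable h)
    (h0 : ∀ φ, IsSmooth φ → ∫ x, h x * φ x = 0) : h =ᵐ[volume] 0 := by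
  have hint : ∀ φ : C(T3, ℂ), Integrable fun x => (h x : ℂ) * φ x := fun φ =>
    hi.ofReal.mul_bdd (c := ‖φ‖) φ.continuous.aestronglyMeasurable
      (Eventually.of_forall φ.norm_coe_le_norm)
  let Λ : C(T3, ℂ) →ₗ[ℂ] ℂ :=
    { toFun := fun φ => ∫ x, (h x : ℂ) * φ x
      map_add' := fun φ ψ => by
        rw [← integral_add (hint φ) (hint ψ)]
        simp only [ContinuousMap.add_apply, mul_add]
      map_smul' := fun c φ => by
        rw [RingHom.id_apply, smul_eq_mul, ← integral_const_mul]
        congr 1; funext x; simp; ring }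
  have hΛb : ∀ φ, ‖Λ φ‖ ≤ (∫ x, ‖h x‖) * ‖φ‖ := fun φ => by
    rw [← integral_mul_const]
    refine norm_integral_le_of_norm_le (hi.norm.mul_const _) (Eventually.of_forall fun x => ?_)
    rw [norm_mul, Complex.norm_real]
    gcongr
    exact φ.norm_coe_le_norm x
  let Λc : C(T3, ℂ) →L[ℂ] ℂ := Λ.mkContinuous _ hΛb
  have hker : (Submodule.span ℂ (Set.range (UnitAddTorus.mFourier (d := Fin 3)))) ≤
      LinearMap.ker (Λc : C(T3, ℂ) →ₗ[ℂ] ℂ) := by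
    refine Submodule.span_le.2 ?_
    rintro _ ⟨k, rfl⟩
    change ∫ x, (h x : ℂ) * UnitAddTorus.mFourier k x = 0
    have h1 := h0 _ (isSmooth_trigC k)
    have h2 := h0 _ (isSmooth_trigS k)
    apply Complex.ext
    · refine (integral_re (hint _)).symm.trans ?_
      simpa [trigC] using h1
    · refine (integral_im (hint _)).symm.trans ?_
      simpa [trigS] using h2
  have hzero : ∀ φ : C(T3, ℂ), ∫ x, (h x : ℂ) * φ x = 0 := by
    intro φ
    have h1 : (Submodule.span ℂ (Set.range (UnitAddTorus.mFourier (d := Fin 3)))).topologicalClosure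
        ≤ LinearMap.ker (Λc : C(T3, ℂ) →ₗ[ℂ] ℂ) :=
      Submodule.topologicalClosure_minimal _ hker Λc.isClosed_ker
    rw [UnitAddTorus.span_mFourier_closure_eq_top] at h1
    exact h1 (Submodule.mem_top (x := φ))
  have hr : ∀ φ : T3 → ℝ, Continuous φ → ∫ x, h x * φ x = 0 := by
    intro φ hφ
    have := hzero ⟨fun x => (φ x : ℂ), by fun_prop⟩
    simp only [ContinuousMap.coe_mk, ← Complex.ofReal_mul] at this
    rw [integral_complex_ofReal] at this
    exact_mod_cast this
  -- a measurable representative, to be used as a density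
  obtain ⟨h', hm, he⟩ := hi.aestronglyMeasurable
  have hi' : Integrable h' := hi.congr he
  have hr' : ∀ φ : T3 → ℝ, Continuous φ → ∫ x, h' x * φ x = 0 := fun φ hφ => by
    rw [← hr φ hφ]
    refine integral_congr_ae ?_
    filter_upwards [he] with x hx
    rw [hx]
  have hmm := hm.measurable
  have hfin : ∀ g : T3 → ℝ, Integrable g → ∫⁻ x, ENNReal.ofReal (g x) ≠ ⊤ := fun g hg =>
    hg.lintegral_lt_top.ne
  have : IsFiniteMeasure (volume.withDensity fun x : T3 => ENNReal.ofReal (h' x)) :=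
    isFiniteMeasure_withDensity (hfin _ hi')
  have : IsFiniteMeasure (volume.withDensity fun x : T3 => ENNReal.ofReal (-h' x)) :=
    isFiniteMeasure_withDensity (hfin _ hi'.neg)
  have hme : (volume.withDensity fun x : T3 => ENNReal.ofReal (h' x))
      = volume.withDensity fun x : T3 => ENNReal.ofReal (-h' x) := by
    refine ext_of_forall_integral_eq_of_IsFiniteMeasure fun φ => ?_
    rw [integral_withDensity_eq_integral_toReal_smul (by fun_prop) (by simp),
      integral_withDensity_eq_integral_toReal_smul (by fun_prop) (by simp), ← sub_eq_zero,
      ← integral_sub, ← hr' φ φ.continuous]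
    · refine integral_congr_ae (Eventually.of_forall fun x => ?_)
      simp only [ENNReal.toReal_ofReal', smul_eq_mul]
      rcases le_total 0 (h' x) with h1 | h1
      · rw [max_eq_left h1, max_eq_right (by linarith)]; ring
      · rw [max_eq_right h1, max_eq_left (by linarith)]; ring
    · simp only [ENNReal.toReal_ofReal', smul_eq_mul]
      exact integral_mul_smooth_integrable hi'.pos_part φ.continuous
    · simp only [ENNReal.toReal_ofReal', smul_eq_mul]
      exact integral_mul_smooth_integrable hi'.neg_part φ.continuous
  have hae := (withDensity_eq_iff (by fun_prop) (by fun_prop) (hfin _ hi')).1 hme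
  filter_upwards [hae, he] with x hx hx'
  rw [hx', Pi.zero_apply]
  have h1 := congrArg ENNReal.toReal hx
  simp only [ENNReal.toReal_ofReal'] at h1
  rcases le_total 0 (h' x) with h2 | h2
  · rw [max_eq_left h2, max_eq_right (by linarith)] at h1; exact h1
  · rw [max_eq_right h2, max_eq_left (by linarith)] at h1; linarith

lemma HasWeakPartial.unique {i : Fin 3} {f g g' : T3 → ℝ} (h : HasWeakPartial i f g)
    (h' : HasWeakPartial i f g') : g =ᵐ[volume] g' := by
  have := ae_eq_zero_of_integral_smooth_eq_zero (h := fun x => g x - g' x) (h.2.1.sub h'.2.1)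
    fun φ hφ => by
      simp only [sub_mul]
      rw [integral_sub (integral_mul_smooth_integrable h.2.1 hφ.continuous)
        (integral_mul_smooth_integrable h'.2.1 hφ.continuous)]
      have h1 := h.2.2 φ hφ
      have h2 := h'.2.2 φ hφ
      linarith
  filter_upwards [this] with x hx
  simpa [sub_eq_zero] using hx

lemma HasWeakPartial.weakPartial_eq {i : Fin 3} {f g : T3 → ℝ} (h : HasWeakPartial i f g) :
    weakPartial i f =ᵐ[volume] g := by
  have hex : ∃ g, HasWeakPartial i f g := ⟨g, h⟩
  have h1 : HasWeakPartial i f (weakPartial i f) := by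
    unfold weakPartial
    rw [dif_pos hex]
    exact hex.choose_spec
  exact h1.unique h

lemma hasWeakPartial_weakPartial {i : Fin 3} {f : T3 → ℝ} (h : ∃ g, HasWeakPartial i f g) :
    HasWeakPartial i f (weakPartial i f) := by
  unfold weakPartial
  rw [dif_pos h]
  exact h.choose_spec

lemma HasWeakPartial.congr {i : Fin 3} {f g f' g' : T3 → ℝ} (h : HasWeakPartial i f g)
    (hf : f =ᵐ[volume] f') (hg : g =ᵐ[volume] g') : HasWeakPartial i f' g' := by
  refine ⟨h.1.congr hf, h.2.1.congr hg, fun φ hφ => ?_⟩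
  have e1 : ∫ x, f' x * partialD i φ x = ∫ x, f x * partialD i φ x :=
    integral_congr_ae (by filter_upwards [hf] with x hx; rw [hx])
  have e2 : ∫ x, g' x * φ x = ∫ x, g x * φ x :=
    integral_congr_ae (by filter_upwards [hg] with x hx; rw [hx])
  rw [e1, e2, h.2.2 φ hφ]

lemma HasWeakPartial.add {i : Fin 3} {f g f' g' : T3 → ℝ} (h : HasWeakPartial i f g)
    (h' : HasWeakPartial i f' g') :
    HasWeakPartial i (fun x => f x + f' x) (fun x => g x + g' x) := by
  refine ⟨h.1.add h'.1, h.2.1.add h'.2.1, fun φ hφ => ?_⟩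
  simp only [add_mul]
  rw [integral_add (integral_mul_smooth_integrable h.1 (hφ.partialD i).continuous)
      (integral_mul_smooth_integrable h'.1 (hφ.partialD i).continuous),
    integral_add (integral_mul_smooth_integrable h.2.1 hφ.continuous)
      (integral_mul_smooth_integrable h'.2.1 hφ.continuous), h.2.2 φ hφ, h'.2.2 φ hφ]
  ring

lemma HasWeakPartial.const_mul {i : Fin 3} {f g : T3 → ℝ} (h : HasWeakPartial i f g) (c : ℝ) :
    HasWeakPartial i (fun x => c * f x) (fun x => c * g x) := by
  refine ⟨h.1.const_mul c, h.2.1.const_mul c, fun φ hφ => ?_⟩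
  simp only [mul_assoc]
  rw [integral_const_mul, integral_const_mul, h.2.2 φ hφ]
  ring

/-- `f` and its weak derivative `g = ∂_i f` are square integrable. -/
structure HasL2Partial (i : Fin 3) (f g : T3 → ℝ) : Prop where
  memLp : MemLp f 2 volume
  memLp' : MemLp g 2 volume
  weak : HasWeakPartial i f g

/-- `f` lies in `H¹` and has the weak gradient `g`. -/
def HasGrad (f : T3 → ℝ) (g : Fin 3 → T3 → ℝ) : Prop := ∀ i, HasL2Partial i f (g i)

lemma HasL2Partial.congr {i : Fin 3} {f g f' g' : T3 → ℝ} (h : HasL2Partial i f g)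
    (hf : f =ᵐ[volume] f') (hg : g =ᵐ[volume] g') : HasL2Partial i f' g' :=
  ⟨(memLp_congr_ae hf).1 h.memLp, (memLp_congr_ae hg).1 h.memLp', h.weak.congr hf hg⟩

lemma HasL2Partial.add {i : Fin 3} {f g f' g' : T3 → ℝ} (h : HasL2Partial i f g)
    (h' : HasL2Partial i f' g') :
    HasL2Partial i (fun x => f x + f' x) (fun x => g x + g' x) :=
  ⟨h.memLp.add h'.memLp, h.memLp'.add h'.memLp', h.weak.add h'.weak⟩

lemma HasL2Partial.const_mul {i : Fin 3} {f g : T3 → ℝ} (h : HasL2Partial i f g) (c : ℝ) :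
    HasL2Partial i (fun x => c * f x) (fun x => c * g x) :=
  ⟨h.memLp.const_mul c, h.memLp'.const_mul c, h.weak.const_mul c⟩

lemma HasL2Partial.neg {i : Fin 3} {f g : T3 → ℝ} (h : HasL2Partial i f g) :
    HasL2Partial i (fun x => - f x) (fun x => - g x) := by
  simpa using h.const_mul (-1)

lemma HasL2Partial.sub {i : Fin 3} {f g f' g' : T3 → ℝ} (h : HasL2Partial i f g)
    (h' : HasL2Partial i f' g') :
    HasL2Partial i (fun x => f x - f' x) (fun x => g x - g' x) := by
  simpa [sub_eq_add_neg] using h.add h'.neg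

lemma hasL2Partial_of_isSmooth {φ : T3 → ℝ} (h : IsSmooth φ) (i : Fin 3) :
    HasL2Partial i φ (partialD i φ) :=
  ⟨memLp_of_continuous h.continuous 2, memLp_of_continuous (h.partialD i).continuous 2,
    hasWeakPartial_of_isSmooth h i⟩

lemma abs_integral_mul_le {a b : T3 → ℝ} (ha : MemLp a 2 volume) (hb : MemLp b 2 volume) :
    |∫ x, a x * b x| ≤ (eLpNorm a 2 volume).toReal * (eLpNorm b 2 volume).toReal := by
  have h := norm_inner_le_norm (𝕜 := ℝ) hb.toLp ha.toLp
  rw [Lp.norm_toLp, Lp.norm_toLp, L2.inner_def] at h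
  rw [mul_comm]
  refine le_trans (le_of_eq ?_) h
  rw [Real.norm_eq_abs]
  congr 1
  refine integral_congr_ae ?_
  filter_upwards [ha.coeFn_toLp, hb.coeFn_toLp] with x h1 h2
  simp [h1, h2]

lemma integrable_mul_L2 {a b : T3 → ℝ} (ha : MemLp a 2 volume) (hb : MemLp b 2 volume) :
    Integrable fun x => a x * b x := ha.integrable_mul hb

lemma tendsto_integral_mul_L2 {ι : Type*} {l : Filter ι} {a : ι → T3 → ℝ} {a' b : T3 → ℝ}
    (ha : ∀ n, MemLp (a n) 2 volume) (ha' : MemLp a' 2 volume) (hb : MemLp b 2 volume)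
    (h : Tendsto (fun n => eLpNorm (fun x => a' x - a n x) 2 volume) l (𝓝 0)) :
    Tendsto (fun n => ∫ x, a n x * b x) l (𝓝 (∫ x, a' x * b x)) := by
  rw [tendsto_iff_norm_sub_tendsto_zero]
  have h1 : Tendsto (fun n => (eLpNorm (fun x => a' x - a n x) 2 volume).toReal
      * (eLpNorm b 2 volume).toReal) l (𝓝 0) := by
    simpa using ((ENNReal.tendsto_toReal ENNReal.zero_ne_top).comp h).mul_const
      (eLpNorm b 2 volume).toReal
  refine squeeze_zero (fun _ => norm_nonneg _) (fun n => ?_) h1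
  rw [← integral_sub (integrable_mul_L2 (ha n) hb) (integrable_mul_L2 ha' hb), norm_sub_rev_aux]
  refine le_trans (le_of_eq ?_) (abs_integral_mul_le (ha'.sub (ha n)) hb)
  rw [← integral_neg]
  congr 2; funext x; simp; ring
where norm_sub_rev_aux {r : ℝ} : ‖r‖ = |(-r)| := by rw [abs_neg, Real.norm_eq_abs]

/-- `h` is integrable with vanishing integral. -/
def NullInt (h : T3 → ℝ) : Prop := Integrable h ∧ ∫ x, h x = 0

lemma NullInt.add {h k : T3 → ℝ} (hh : NullInt h) (hk : NullInt k) :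
    NullInt fun x => h x + k x :=
  ⟨hh.1.add hk.1, by rw [integral_add hh.1 hk.1, hh.2, hk.2, add_zero]⟩

lemma NullInt.const_mul {h : T3 → ℝ} (hh : NullInt h) (c : ℝ) : NullInt fun x => c * h x :=
  ⟨hh.1.const_mul c, by rw [integral_const_mul, hh.2, mul_zero]⟩

lemma NullInt.sum {ι : Type*} (S : Finset ι) {h : ι → T3 → ℝ} (hh : ∀ k ∈ S, NullInt (h k)) :
    NullInt fun x => ∑ k ∈ S, h k x :=
  ⟨integrable_finsetSum S fun k hk => (hh k hk).1, by
    rw [integral_finsetSum S fun k hk => (hh k hk).1]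
    exact Finset.sum_eq_zero fun k hk => (hh k hk).2⟩

/-- Integration by parts for `H¹` functions. -/
lemma HasL2Partial.nullInt {i : Fin 3} {f g h k : T3 → ℝ} (hf : HasL2Partial i f g)
    (hh : HasL2Partial i h k) : NullInt fun x => f x * k x + g x * h x := by
  refine ⟨(integrable_mul_L2 hf.memLp hh.memLp').add (integrable_mul_L2 hf.memLp' hh.memLp), ?_⟩
  rw [integral_add (integrable_mul_L2 hf.memLp hh.memLp') (integrable_mul_L2 hf.memLp' hh.memLp)]
  have hs : ∀ S, MemLp (trigSum S h) 2 volume := fun S =>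
    memLp_of_continuous (isSmooth_trigSum S h).continuous 2
  have hs' : ∀ S, MemLp (trigSum S k) 2 volume := fun S =>
    memLp_of_continuous (isSmooth_trigSum S k).continuous 2
  have t1 := tendsto_integral_mul_L2 hs hh.memLp hf.memLp' (tendsto_trigSum hh.memLp)
  have t2 := tendsto_integral_mul_L2 hs' hh.memLp' hf.memLp (tendsto_trigSum hh.memLp')
  have e : ∀ S, ∫ x, trigSum S h x * g x = - ∫ x, trigSum S k x * f x := fun S => by
    have := hf.weak.2.2 _ (isSmooth_trigSum S h)
    simp only [partialD_trigSum S hh.weak] at this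
    simp only [mul_comm (trigSum S _ _)]
    linarith
  simp only [e] at t1
  have := tendsto_nhds_unique t1 t2.neg
  simp only [mul_comm (h _), mul_comm (k _)] at this
  linarith

lemma HasL2Partial.mul_smooth {i : Fin 3} {f g φ : T3 → ℝ} (hf : HasL2Partial i f g)
    (hφ : IsSmooth φ) :
    HasL2Partial i (fun x => f x * φ x) (fun x => f x * partialD i φ x + g x * φ x) := by
  have key : ∀ {a : T3 → ℝ} {ψ : T3 → ℝ}, MemLp a 2 volume → Continuous ψ →
      MemLp (fun x => a x * ψ x) 2 volume := fun ha hψ =>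
    (memLp_of_continuous hψ ⊤).mul ha
  have m1 := key hf.memLp hφ.continuous
  have m2 := (key hf.memLp (hφ.partialD i).continuous).add (key hf.memLp' hφ.continuous)
  refine ⟨m1, m2, m1.integrable (by norm_num), m2.integrable (by norm_num), fun ψ hψ => ?_⟩
  have h1 := hf.weak.2.2 _ (hφ.mul hψ)
  simp only [partialD_mul hφ hψ] at h1
  have i1 : Integrable fun x => f x * (φ x * partialD i ψ x) :=
    integral_mul_smooth_integrable hf.weak.1 (hφ.continuous.mul (hψ.partialD i).continuous)
  have i2 : Integrable fun x => f x * (partialD i φ x * ψ x) :=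
    integral_mul_smooth_integrable hf.weak.1 ((hφ.partialD i).continuous.mul hψ.continuous)
  have i3 : Integrable fun x => g x * (φ x * ψ x) :=
    integral_mul_smooth_integrable hf.weak.2.1 (hφ.continuous.mul hψ.continuous)
  simp only [mul_add] at h1
  rw [integral_add i1 i2] at h1
  have e1 : ∫ x, f x * φ x * partialD i ψ x = ∫ x, f x * (φ x * partialD i ψ x) := by
    simp only [mul_assoc]
  have e2 : ∫ x, (f x * partialD i φ x + g x * φ x) * ψ x
      = ∫ x, f x * (partialD i φ x * ψ x) + g x * (φ x * ψ x) := by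
    congr 1; funext x; ring
  rw [e1]
  refine Eq.trans ?_ (congrArg Neg.neg e2).symm
  rw [integral_add i2 i3]
  linarith

/-- The product rule; the product of two `H¹` functions has an integrable weak derivative. -/
lemma HasL2Partial.mul_weak {i : Fin 3} {f g h k : T3 → ℝ} (hf : HasL2Partial i f g)
    (hh : HasL2Partial i h k) :
    HasWeakPartial i (fun x => f x * h x) (fun x => f x * k x + g x * h x) := by
  refine ⟨integrable_mul_L2 hf.memLp hh.memLp, (hf.nullInt hh).1, fun φ hφ => ?_⟩
  have h1 := (hf.nullInt (hh.mul_smooth hφ)).2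
  have i1 := integral_mul_smooth_integrable (integrable_mul_L2 hf.memLp hh.memLp)
    (hφ.partialD i).continuous
  have i2 := integral_mul_smooth_integrable (hf.nullInt hh).1 hφ.continuous
  have : ∫ x, f x * h x * partialD i φ x + (f x * k x + g x * h x) * φ x = 0 := by
    rw [← h1]; congr 1; funext x; ring
  rw [integral_add i1 i2] at this
  linarith

/-- An essentially bounded function. -/
def EssBdd (f : T3 → ℝ) : Prop := MemLp f ⊤ volume

lemma EssBdd.mul_memLp {f g : T3 → ℝ} {p : ℝ≥0∞} (hf : EssBdd f) (hg : MemLp g p volume) :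
    MemLp (fun x => f x * g x) p volume := hg.mul hf

lemma HasL2Partial.mul {i : Fin 3} {f g h k : T3 → ℝ} (hf : HasL2Partial i f g)
    (hh : HasL2Partial i h k) (hb : EssBdd f) (hb' : MemLp (fun x => g x * h x) 2 volume) :
    HasL2Partial i (fun x => f x * h x) (fun x => f x * k x + g x * h x) :=
  ⟨hb.mul_memLp hh.memLp, (hb.mul_memLp hh.memLp').add hb', hf.mul_weak hh⟩

/-- The product of a Lipschitz function and an `H¹` function. -/
lemma HasL2Partial.mul_of_lip {i : Fin 3} {f g h k : T3 → ℝ} (hf : HasL2Partial i f g)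
    (hh : HasL2Partial i h k) (hb : EssBdd f) (hb' : EssBdd g) :
    HasL2Partial i (fun x => f x * h x) (fun x => f x * k x + g x * h x) :=
  hf.mul hh hb (hb'.mul_memLp hh.memLp)

/-- The product of two bounded `H¹` functions. -/
lemma HasL2Partial.mul_of_bdd {i : Fin 3} {f g h k : T3 → ℝ} (hf : HasL2Partial i f g)
    (hh : HasL2Partial i h k) (hb : EssBdd f) (hb' : EssBdd h) :
    HasL2Partial i (fun x => f x * h x) (fun x => f x * k x + g x * h x) :=
  hf.mul hh hb (by simpa only [mul_comm] using hb'.mul_memLp hf.memLp')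

lemma exists_seq_trigSum_ae {f : T3 → ℝ} (hf : MemLp f 2 volume) :
    ∃ u : ℕ → Finset (Fin 3 → ℤ), Tendsto u atTop atTop ∧
      ∀ᵐ x, Tendsto (fun n => trigSum (u n) f x) atTop (𝓝 (f x)) := by
  obtain ⟨u, hu⟩ := exists_seq_tendsto (atTop : Filter (Finset (Fin 3 → ℤ)))
  have h1 : TendstoInMeasure volume (fun n => trigSum (u n) f) atTop f := by
    refine tendstoInMeasure_of_tendsto_eLpNorm (p := 2) (by norm_num)
      (fun n => (isSmooth_trigSum _ f).continuous.aestronglyMeasurable)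
      hf.aestronglyMeasurable ?_
    refine ((tendsto_trigSum hf).comp hu).congr fun n => ?_
    exact eLpNorm_sub_comm f (trigSum (u n) f) 2 volume
  obtain ⟨v, hv, hv'⟩ := h1.exists_seq_tendsto_ae
  exact ⟨u ∘ v, hu.comp hv.tendsto_atTop, hv'⟩

/-- The chain rule for a `C¹` function with bounded derivative. -/
lemma HasL2Partial.comp {i : Fin 3} {f g : T3 → ℝ} (hf : HasL2Partial i f g) {F F' : ℝ → ℝ}
    (hF : ∀ x, HasDerivAt F (F' x) x) (hc : Continuous F') {C : ℝ} (hC : ∀ x, |F' x| ≤ C) :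
    HasL2Partial i (fun x => F (f x)) (fun x => F' (f x) * g x) := by
  have hFc : Continuous F := continuous_iff_continuousAt.2 fun x => (hF x).continuousAt
  have hlip : ∀ x y, |F x - F y| ≤ C * |x - y| := fun x y => by
    have := Convex.norm_image_sub_le_of_norm_hasDerivWithin_le (f := F) (f' := F') (s := Set.univ)
      (C := C) (fun x _ => (hF x).hasDerivWithinAt) (fun x _ => hC x) convex_univ
      (Set.mem_univ y) (Set.mem_univ x)
    simpa using this
  have mF : MemLp (fun x => F (f x)) 2 volume := by
    have h1 : MemLp (fun x => F (f x) - F 0) 2 volume := by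
      refine MemLp.of_le_mul (c := C) hf.memLp
        ((hFc.comp_aestronglyMeasurable hf.memLp.aestronglyMeasurable).sub
          aestronglyMeasurable_const) (Eventually.of_forall fun x => ?_)
      simpa using hlip (f x) 0
    exact (memLp_congr_ae (Eventually.of_forall fun x => by simp)).1 (h1.add (memLp_const (F 0)))
  have mF' : EssBdd fun x => F' (f x) :=
    memLp_top_of_bound (hc.comp_aestronglyMeasurable hf.memLp.aestronglyMeasurable) C
      (Eventually.of_forall fun x => hC _)
  have mG := mF'.mul_memLp hf.memLp'
  refine ⟨mF, mG, mF.integrable (by norm_num), mG.integrable (by norm_num), fun ψ hψ => ?_⟩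
  obtain ⟨u, hu, hae⟩ := exists_seq_trigSum_ae hf.memLp
  have sm := fun n => isSmooth_trigSum (u n) f
  -- the identity for the smooth approximations
  have key : ∀ n, ∫ x, F (trigSum (u n) f x) * partialD i ψ x
      = - ∫ x, F' (trigSum (u n) f x) * ψ x * trigSum (u n) g x := fun n => by
    have c1 := (sm n).continuous
    have c2 := (isSmooth_trigSum (u n) g).continuous
    have c3 := hψ.continuous
    have c4 := (hψ.partialD i).continuous
    have e := integral_dirDeriv_eq_zero i
      (h := fun x => F (trigSum (u n) f x) * ψ x)
      (h' := fun x => F' (trigSum (u n) f x) * ψ x * trigSum (u n) g x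
        + F (trigSum (u n) f x) * partialD i ψ x)
      (by fun_prop) (by fun_prop) fun x s => by
        have d1 := (sm n).hasDerivAt i x s
        rw [partialD_trigSum (u n) hf.weak] at d1
        have d2 := ((hF _).comp s d1).mul (hψ.hasDerivAt i x s)
        refine d2.congr_deriv ?_
        simp only [Function.comp]
        ring
    have i1 : Integrable fun x => F' (trigSum (u n) f x) * ψ x * trigSum (u n) g x :=
      integrable_of_continuous (by fun_prop)
    have i2 : Integrable fun x => F (trigSum (u n) f x) * partialD i ψ x :=
      integrable_of_continuous (by fun_prop)
    rw [integral_add i1 i2] at e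
    linarith
  have cψ := memLp_of_continuous hψ.continuous ⊤
  have cψ' := memLp_of_continuous (hψ.partialD i).continuous 2
  obtain ⟨B, hB⟩ := exists_bound_of_continuous hψ.continuous
  -- convergence of the left side
  have t1 : Tendsto (fun n => ∫ x, F (trigSum (u n) f x) * partialD i ψ x) atTop
      (𝓝 (∫ x, F (f x) * partialD i ψ x)) := by
    refine tendsto_integral_mul_L2 (fun n => memLp_of_continuous
      (hFc.comp (sm n).continuous) 2) mF cψ' ?_
    have h2 : Tendsto (fun n => ENNReal.ofReal C
        * eLpNorm (fun x => f x - trigSum (u n) f x) 2 volume) atTop (𝓝 0) := by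
      simpa using ENNReal.Tendsto.const_mul ((tendsto_trigSum hf.memLp).comp hu)
        (Or.inr (ENNReal.ofReal_ne_top (r := C)))
    refine tendsto_of_tendsto_of_tendsto_of_le_of_le tendsto_const_nhds h2 (fun _ => zero_le)
      fun n => ?_
    exact eLpNorm_le_mul_eLpNorm_of_ae_le_mul (Eventually.of_forall fun x => hlip _ _) 2
  -- convergence of the right side, split as `∫ a_n (g_n - g) + ∫ a_n g` with `a_n = F'(f_n) ψ`
  have t2 : Tendsto (fun n => ∫ x, F' (trigSum (u n) f x) * ψ x * g x) atTop
      (𝓝 (∫ x, F' (f x) * ψ x * g x)) := by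
    refine tendsto_integral_of_dominated_convergence (fun x => C * B * |g x|)
      (fun n => ?_) ?_ (fun n => Eventually.of_forall fun x => ?_) ?_
    · have c1 := (sm n).continuous
      have c3 := hψ.continuous
      exact (Continuous.aestronglyMeasurable (by fun_prop)).mul hf.memLp'.aestronglyMeasurable
    · exact (hf.memLp'.integrable (by norm_num)).abs.const_mul _
    · rw [norm_mul, norm_mul, Real.norm_eq_abs, Real.norm_eq_abs (g x)]
      gcongr
      · exact (abs_nonneg _).trans (hC 0)
      · exact hC _
      · exact hB x
    · filter_upwards [hae] with x hx
      exact ((hc.tendsto _).comp hx |>.mul_const _).mul_const _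
  have t3 : Tendsto (fun n => ∫ x, F' (trigSum (u n) f x) * ψ x * (trigSum (u n) g x - g x)) atTop
      (𝓝 0) := by
    have h2 : Tendsto (fun n => (C * B)
        * (eLpNorm (fun x => g x - trigSum (u n) g x) 2 volume).toReal) atTop (𝓝 0) := by
      simpa using ((ENNReal.tendsto_toReal ENNReal.zero_ne_top).comp
        ((tendsto_trigSum hf.memLp').comp hu)).const_mul (C * B)
    refine squeeze_zero_norm (fun n => ?_) h2
    have c1 := (sm n).continuous
    have c3 := hψ.continuous
    have mg := hf.memLp'.sub (memLp_of_continuous (isSmooth_trigSum (u n) g).continuous 2)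
    have h3 : ∀ x, ‖F' (trigSum (u n) f x) * ψ x‖ ≤ C * B := fun x => by
      rw [norm_mul]
      exact mul_le_mul (hC _) (hB x) (norm_nonneg _) ((abs_nonneg _).trans (hC 0))
    have h4 := abs_integral_mul_le
      (memLp_of_continuous (φ := fun x => F' (trigSum (u n) f x) * ψ x) (by fun_prop) 2) mg
    have h5 : (eLpNorm (fun x => F' (trigSum (u n) f x) * ψ x) 2 volume).toReal ≤ C * B := by
      have h6 := eLpNorm_le_of_ae_bound (p := 2) (μ := (volume : Measure T3))
        (Eventually.of_forall h3)
      simp at h6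
      exact ENNReal.toReal_le_of_le_ofReal ((norm_nonneg _).trans (h3 0)) h6
    calc _ = |∫ x, F' (trigSum (u n) f x) * ψ x * (g x - trigSum (u n) g x)| := by
            rw [Real.norm_eq_abs, ← abs_neg, ← integral_neg]
            congr 2; funext x; ring
      _ ≤ _ := h4
      _ ≤ _ := mul_le_mul h5 le_rfl ENNReal.toReal_nonneg
        ((norm_nonneg _).trans (h3 0))
  have e : ∀ n, ∫ x, F (trigSum (u n) f x) * partialD i ψ x
      = - (∫ x, F' (trigSum (u n) f x) * ψ x * g x)
        - ∫ x, F' (trigSum (u n) f x) * ψ x * (trigSum (u n) g x - g x) := fun n => by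
    have c1 := (sm n).continuous
    have c2 := (isSmooth_trigSum (u n) g).continuous
    have c3 := hψ.continuous
    have mm : MemLp (fun x => F' (trigSum (u n) f x) * ψ x) 2 volume :=
      memLp_of_continuous (by fun_prop) 2
    have i1 : Integrable fun x => F' (trigSum (u n) f x) * ψ x * (trigSum (u n) g x - g x) :=
      integrable_mul_L2 mm ((memLp_of_continuous c2 2).sub hf.memLp')
    rw [key n, ← neg_add', ← integral_add (integrable_mul_L2 mm hf.memLp') i1]
    congr 2; funext x; ring
  simp only [e] at t1
  have h7 := tendsto_nhds_unique t1 (t2.neg.sub t3)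
  rw [h7, sub_zero]
  congr 2; funext x; ring

/-- The chain rule for a function that is `C¹` on an interval containing the values of `f`. -/
lemma HasL2Partial.comp_Icc {i : Fin 3} {f g : T3 → ℝ} (hf : HasL2Partial i f g) {F F' : ℝ → ℝ}
    {a b : ℝ} (hab : a ≤ b) (hr : ∀ᵐ x, f x ∈ Set.Icc a b)
    (hF : ∀ x ∈ Set.Icc a b, HasDerivAt F (F' x) x) (hc : ContinuousOn F' (Set.Icc a b)) :
    HasL2Partial i (fun x => F (f x)) (fun x => F' (f x) * g x) := by
  -- extend `F` beyond the interval with the boundary values of `F'` as slopes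
  set G' : ℝ → ℝ := Set.IccExtend hab (fun x => F' x) with hG'
  have cG' : Continuous G' := (continuousOn_iff_continuous_domRestrict.1 hc).Icc_extend'
  set G : ℝ → ℝ := fun x => F a + ∫ s in a..x, G' s with hG
  have dG : ∀ x, HasDerivAt G (G' x) x := fun x =>
    (intervalIntegral.integral_hasDerivAt_right (cG'.intervalIntegrable _ _)
      cG'.aestronglyMeasurable.stronglyMeasurableAtFilter cG'.continuousAt).const_add _
  obtain ⟨C, hC⟩ := isCompact_Icc.exists_bound_of_continuousOn hc
  have bG : ∀ x, |G' x| ≤ C := fun x => hC _ (Set.projIcc a b hab x).2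
  have eG' : ∀ x ∈ Set.Icc a b, G' x = F' x := fun x hx => Set.IccExtend_of_mem hab _ hx
  have eG : ∀ x ∈ Set.Icc a b, G x = F x := fun x hx => by
    have h1 : ∫ s in a..x, G' s = F x - F a := by
      refine intervalIntegral.integral_eq_sub_of_hasDerivAt (fun y hy => ?_)
        (cG'.intervalIntegrable _ _)
      rw [Set.uIcc_of_le hx.1] at hy
      have hy' : y ∈ Set.Icc a b := ⟨hy.1, hy.2.trans hx.2⟩
      rw [eG' y hy']; exact hF y hy'
    simp only [hG, h1]; ring
  refine (hf.comp dG cG' bG).congr ?_ ?_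
  · filter_upwards [hr] with x hx using eG _ hx
  · filter_upwards [hr] with x hx
    rw [eG' _ hx]

/-! ### The Sobolev inequality -/

/-- A continuously differentiable function on the circle is bounded by the mean of
`|p| + |p'|`. -/
lemma enorm_le_lintegral_circle {p p' : UnitAddCircle → ℝ} (hp : Continuous p)
    (hp' : Continuous p') (hd : ∀ r : ℝ, HasDerivAt (fun r : ℝ => p r) (p' r) r)
    (z : UnitAddCircle) : ‖p z‖ₑ ≤ ∫⁻ s, (‖p s‖ₑ + ‖p' s‖ₑ) := by
  obtain ⟨a, rfl⟩ := QuotientAddGroup.mk_surjective z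
  set J := ∫⁻ s, ‖p' s‖ₑ with hJ
  have hcr : Continuous fun r : ℝ => p' (r : UnitAddCircle) :=
    hp'.comp (AddCircle.continuous_mk' 1)
  have key : ∀ w : UnitAddCircle, ‖p (a : UnitAddCircle)‖ₑ ≤ ‖p w‖ₑ + J := by
    intro w
    obtain ⟨b, hb, rfl⟩ : ∃ b ∈ Set.Ioc a (a + 1), (b : UnitAddCircle) = w :=
      ⟨AddCircle.equivIoc 1 a w, (AddCircle.equivIoc 1 a w).2,
        (AddCircle.equivIoc 1 a).symm_apply_apply w⟩
    have h1 : ∫ r in a..b, p' (r : UnitAddCircle) = p b - p a :=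
      intervalIntegral.integral_eq_sub_of_hasDerivAt (fun r _ => hd r)
        (hcr.intervalIntegrable _ _)
    have h2 : ‖∫ r in a..b, p' (r : UnitAddCircle)‖ₑ ≤ J := by
      rw [intervalIntegral.integral_of_le hb.1.le]
      refine (enorm_integral_le_lintegral_enorm _).trans ?_
      rw [hJ, ← UnitAddCircle.lintegral_preimage a]
      exact lintegral_mono_set (Set.Ioc_subset_Ioc_right hb.2)
    have h3 : p (a : UnitAddCircle) = p b - ∫ r in a..b, p' (r : UnitAddCircle) := by
      rw [h1]; ring
    rw [h3]
    exact (enorm_sub_le).trans (by gcongr)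
  calc ‖p (a : UnitAddCircle)‖ₑ = ∫⁻ _ : UnitAddCircle, ‖p (a : UnitAddCircle)‖ₑ := by simp
    _ ≤ ∫⁻ w : UnitAddCircle, (‖p w‖ₑ + J) := lintegral_mono fun w => key w
    _ = _ := by
      rw [lintegral_add_right _ measurable_const, lintegral_add_left (by fun_prop)]
      simp [hJ]

lemma update_eq_add_single (x : T3) (i : Fin 3) (r : UnitAddCircle) :
    Function.update x i r = Function.update x i 0 + Pi.single i r := by
  funext j
  by_cases h : j = i
  · subst h; simp
  · simp [h]

/-- The Gagliardo–Nirenberg inequality `W^{1,1} ⊂ L^{3/2}` on the torus. -/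
lemma lintegral_rpow_le_of_isSmooth {ψ : T3 → ℝ} (h : IsSmooth ψ) :
    ∫⁻ x, ‖ψ x‖ₑ ^ (3 / 2 : ℝ) ≤
      (∫⁻ x, (‖ψ x‖ₑ + ∑ i, ‖partialD i ψ x‖ₑ)) ^ (3 / 2 : ℝ) := by
  set F : T3 → ℝ≥0∞ := fun x => ‖ψ x‖ₑ + ∑ i, ‖partialD i ψ x‖ₑ with hF
  have hc := h.continuous
  have hc' := fun i => (h.partialD i).continuous
  have hFm : Measurable F := by
    have : Continuous fun x => ‖ψ x‖ₑ + ∑ i, ‖partialD i ψ x‖ₑ := by fun_prop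
    exact this.measurable
  -- each value is controlled along each of the three coordinate circles
  have hb : ∀ (x : T3) i, ‖ψ x‖ₑ ≤ ∫⁻ s, F (Function.update x i s) := by
    intro x i
    have h1 := enorm_le_lintegral_circle (p := fun s => ψ (Function.update x i s))
      (p' := fun s => partialD i ψ (Function.update x i s))
      (hc.comp (continuous_const.update i continuous_id))
      ((hc' i).comp (continuous_const.update i continuous_id))
      (fun r => by
        have := h.hasDerivAt i (Function.update x i 0) r
        simpa only [← update_eq_add_single x i] using this) (x i)
    simp only [Function.update_eq_self] at h1
    refine h1.trans (lintegral_mono fun s => ?_)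
    exact add_le_add le_rfl (Finset.single_le_sum
      (f := fun j => ‖partialD j ψ (Function.update x i s)‖ₑ)
      (fun _ _ => zero_le) (Finset.mem_univ i))
  have hp : Real.HolderConjugate (Fintype.card (Fin 3) : ℝ) (3 / 2) := by
    rw [Real.holderConjugate_iff, Fintype.card_fin]; norm_num
  have hg := lintegral_prod_lintegral_pow_le (fun _ : Fin 3 => (volume : Measure UnitAddCircle))
    hp hFm
  rw [← volume_pi] at hg
  refine le_trans (lintegral_mono fun x => ?_) hg
  calc ‖ψ x‖ₑ ^ (3 / 2 : ℝ) = ∏ i : Fin 3, ‖ψ x‖ₑ ^ (1 / ((Fintype.card (Fin 3) : ℝ) - 1)) := by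
        rw [Finset.prod_const, ← ENNReal.rpow_natCast, ← ENNReal.rpow_mul]
        norm_num
    _ ≤ _ := Finset.prod_le_prod' fun i _ => ENNReal.rpow_le_rpow (hb x i) (by norm_num)

lemma toReal_eLpNorm_two_sq {a : T3 → ℝ} (ha : MemLp a 2 volume) :
    (eLpNorm a 2 volume).toReal ^ 2 = ∫ x, a x ^ 2 := by
  have h := real_inner_self_eq_norm_sq ha.toLp
  rw [Lp.norm_toLp, L2.inner_def] at h
  rw [← h]
  refine integral_congr_ae ?_
  filter_upwards [ha.coeFn_toLp] with x hx
  simp [hx]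

/-- The right side of the Sobolev inequality. -/
def sobolevA (f : T3 → ℝ) (g : Fin 3 → T3 → ℝ) : ℝ :=
  (eLpNorm f 2 volume).toReal + ∑ i, 4 * (eLpNorm (g i) 2 volume).toReal

lemma sobolevA_nonneg (f : T3 → ℝ) (g : Fin 3 → T3 → ℝ) : 0 ≤ sobolevA f g := by
  unfold sobolevA
  have : ∀ i, 0 ≤ 4 * (eLpNorm (g i) 2 volume).toReal := fun i =>
    mul_nonneg (by norm_num) ENNReal.toReal_nonneg
  exact add_nonneg ENNReal.toReal_nonneg (Finset.sum_nonneg fun i _ => this i)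

/-- The Sobolev inequality for smooth `φ`: the inequality `W^{1,1} ⊂ L^{3/2}` for `φ⁴`, and Hölder's
inequality for `∫ |φ|³ |∇φ|`. -/
lemma integral_pow_six_le_of_isSmooth {φ : T3 → ℝ} (h : IsSmooth φ) :
    ∫ x, φ x ^ 6 ≤ sobolevA φ (fun i => partialD i φ) ^ 6 := by
  have hc := h.continuous
  have hc' := fun i => (h.partialD i).continuous
  set X := ∫ x, φ x ^ 6 with hX
  set A := sobolevA φ (fun i => partialD i φ) with hA
  have hA0 : 0 ≤ A := sobolevA_nonneg _ _
  have hX0 : 0 ≤ X := integral_nonneg fun x => by positivity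
  have h4 : IsSmooth fun x => φ x ^ 4 := ContDiff.pow h 4
  have hd : ∀ i x, partialD i (fun x => φ x ^ 4) x = 4 * φ x ^ 3 * partialD i φ x := by
    intro i x
    have := ((hasDerivAt_partialD h i x).pow 4).deriv
    simp only [QuotientAddGroup.mk_zero, Pi.single_zero, add_zero] at this
    exact this
  have h1 := lintegral_rpow_le_of_isSmooth h4
  simp only [hd] at h1
  -- convert to real integrals
  have e1 : ∫⁻ x, ‖φ x ^ 4‖ₑ ^ (3 / 2 : ℝ) = ENNReal.ofReal X := by
    rw [hX, ofReal_integral_eq_lintegral_ofReal (integrable_of_continuous (by fun_prop))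
      (Eventually.of_forall fun x => by positivity)]
    refine lintegral_congr fun x => ?_
    rw [Real.enorm_eq_ofReal_abs, ENNReal.ofReal_rpow_of_nonneg (abs_nonneg _) (by norm_num)]
    congr 1
    rw [abs_pow, ← Real.rpow_natCast, ← Real.rpow_mul (abs_nonneg _), ← Even.pow_abs (by decide)]
    norm_num
  set I := ∫ x, (|φ x ^ 4| + ∑ i, |4 * φ x ^ 3 * partialD i φ x|) with hI
  have e2 : ∫⁻ x, (‖φ x ^ 4‖ₑ + ∑ i, ‖4 * φ x ^ 3 * partialD i φ x‖ₑ) = ENNReal.ofReal I := by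
    rw [hI, ofReal_integral_eq_lintegral_ofReal (integrable_of_continuous (by fun_prop))
      (Eventually.of_forall fun x => by positivity)]
    refine lintegral_congr fun x => ?_
    simp only [Real.enorm_eq_ofReal_abs]
    rw [ENNReal.ofReal_add (by positivity) (by positivity),
      ENNReal.ofReal_sum_of_nonneg fun i _ => by positivity]
  have hI0 : 0 ≤ I := integral_nonneg fun x => by positivity
  rw [e1, e2, ENNReal.ofReal_rpow_of_nonneg hI0 (by norm_num)] at h1
  have h2 : X ≤ I ^ (3 / 2 : ℝ) := (ENNReal.ofReal_le_ofReal_iff (by positivity)).1 h1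
  -- Hölder
  have m3 : MemLp (fun x => |φ x| ^ 3) 2 volume := memLp_of_continuous (by fun_prop) 2
  have n3 : (eLpNorm (fun x => |φ x| ^ 3) 2 volume).toReal = X ^ (1 / 2 : ℝ) := by
    have := toReal_eLpNorm_two_sq m3
    rw [← Real.sqrt_eq_rpow, ← Real.sqrt_sq (ENNReal.toReal_nonneg
      (a := eLpNorm (fun x => |φ x| ^ 3) 2 volume)), this]
    congr 2; funext x
    rw [← pow_mul, Even.pow_abs (by decide)]
  have hol : ∀ a : T3 → ℝ, Continuous a →
      ∫ x, |φ x| ^ 3 * |a x| ≤ X ^ (1 / 2 : ℝ) * (eLpNorm a 2 volume).toReal := by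
    intro a ha
    have := abs_integral_mul_le m3 (memLp_of_continuous (φ := fun x => |a x|) (by fun_prop) 2)
    rw [n3] at this
    refine (le_abs_self _).trans (this.trans (le_of_eq ?_))
    congr 2
    exact eLpNorm_norm a
  have h3 : I ≤ X ^ (1 / 2 : ℝ) * A := by
    have e3 : I = (∫ x, |φ x| ^ 3 * |φ x|) + ∑ i, 4 * ∫ x, |φ x| ^ 3 * |partialD i φ x| := by
      rw [hI, integral_add (integrable_of_continuous (by fun_prop))
        (integrable_of_continuous (by fun_prop)),
        integral_finsetSum _ fun i _ => integrable_of_continuous (by fun_prop)]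
      congr 1
      · congr 1; funext x; rw [abs_pow]; ring
      · refine Finset.sum_congr rfl fun i _ => ?_
        rw [← integral_const_mul]
        congr 1; funext x; rw [abs_mul, abs_mul, abs_pow, abs_of_pos (by norm_num : (0:ℝ) < 4)]
        ring
    rw [e3, hA, sobolevA, mul_add, Finset.mul_sum]
    refine add_le_add (hol _ hc) (Finset.sum_le_sum fun i _ => ?_)
    have := hol _ (hc' i)
    linarith
  have h4 : X ≤ X ^ (3 / 4 : ℝ) * A ^ (3 / 2 : ℝ) := by
    refine h2.trans ((Real.rpow_le_rpow hI0 h3 (by norm_num)).trans (le_of_eq ?_))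
    rw [Real.mul_rpow (by positivity) hA0, ← Real.rpow_mul hX0]
    norm_num
  rcases hX0.eq_or_lt with h0 | h0
  · rw [← h0]; positivity
  · have h5 : X ^ (1 / 4 : ℝ) ≤ A ^ (3 / 2 : ℝ) := by
      have h6 : X ^ (3 / 4 : ℝ) * X ^ (1 / 4 : ℝ) = X := by
        rw [← Real.rpow_add h0]; norm_num
      have h7 : X ^ (3 / 4 : ℝ) * X ^ (1 / 4 : ℝ) ≤ X ^ (3 / 4 : ℝ) * A ^ (3 / 2 : ℝ) := by
        rw [h6]; exact h4
      exact le_of_mul_le_mul_left h7 (by positivity)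
    have h8 := Real.rpow_le_rpow (by positivity) h5 (by norm_num : (0:ℝ) ≤ 4)
    rw [← Real.rpow_mul hX0, ← Real.rpow_mul hA0] at h8
    norm_num at h8
    exact_mod_cast h8

lemma tendsto_toReal_eLpNorm_trigSum {a : T3 → ℝ} (ha : MemLp a 2 volume) :
    Tendsto (fun S => (eLpNorm (trigSum S a) 2 volume).toReal) atTop
      (𝓝 (eLpNorm a 2 volume).toReal) := by
  rw [tendsto_iff_norm_sub_tendsto_zero]
  have h1 : Tendsto (fun S => (eLpNorm (fun x => a x - trigSum S a x) 2 volume).toReal)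
      atTop (𝓝 0) :=
    (ENNReal.tendsto_toReal ENNReal.zero_ne_top).comp (tendsto_trigSum ha)
  refine squeeze_zero (fun _ => norm_nonneg _) (fun S => ?_) h1
  have ma := memLp_of_continuous (isSmooth_trigSum S a).continuous 2
  have := abs_norm_sub_norm_le ma.toLp ha.toLp
  rw [Lp.norm_toLp, Lp.norm_toLp, ← MemLp.toLp_sub, Lp.norm_toLp] at this
  rw [Real.norm_eq_abs]
  refine this.trans (le_of_eq ?_)
  congr 1
  exact eLpNorm_sub_comm _ _ _ _

/-- The Sobolev inequality `H¹ ⊂ L⁶` on the torus, from smooth functions by Fatou's lemma. -/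
lemma HasGrad.lintegral_pow_six_le {f : T3 → ℝ} {g : Fin 3 → T3 → ℝ} (h : HasGrad f g) :
    ∫⁻ x, ENNReal.ofReal (f x ^ 6) ≤ ENNReal.ofReal (sobolevA f g ^ 6) := by
  obtain ⟨u, hu, hae⟩ := exists_seq_trigSum_ae (h 0).memLp
  have sm := fun n => isSmooth_trigSum (u n) f
  have hn : ∀ {a : T3 → ℝ}, MemLp a 2 volume →
      Tendsto (fun n => (eLpNorm (trigSum (u n) a) 2 volume).toReal) atTop
        (𝓝 (eLpNorm a 2 volume).toReal) := fun ha =>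
    (tendsto_toReal_eLpNorm_trigSum ha).comp hu
  have hA : Tendsto (fun n => ENNReal.ofReal
      (sobolevA (trigSum (u n) f) (fun i => trigSum (u n) (g i)) ^ 6)) atTop
      (𝓝 (ENNReal.ofReal (sobolevA f g ^ 6))) := by
    refine ENNReal.tendsto_ofReal (Tendsto.pow ?_ 6)
    exact (hn (h 0).memLp).add (tendsto_finsetSum _ fun i _ =>
      (hn (h i).memLp').const_mul 4)
  calc ∫⁻ x, ENNReal.ofReal (f x ^ 6)
      = ∫⁻ x, liminf (fun n => ENNReal.ofReal (trigSum (u n) f x ^ 6)) atTop := by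
        refine lintegral_congr_ae ?_
        filter_upwards [hae] with x hx
        exact (ENNReal.tendsto_ofReal (hx.pow 6)).liminf_eq.symm
    _ ≤ liminf (fun n => ∫⁻ x, ENNReal.ofReal (trigSum (u n) f x ^ 6)) atTop :=
        lintegral_liminf_le fun n => by
          have := (sm n).continuous
          exact (ENNReal.continuous_ofReal.comp (by fun_prop)).measurable
    _ ≤ liminf (fun n => ENNReal.ofReal
          (sobolevA (trigSum (u n) f) (fun i => trigSum (u n) (g i)) ^ 6)) atTop := by
        refine liminf_le_liminf (Eventually.of_forall fun n => ?_)
        have c := (sm n).continuous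
        rw [← ofReal_integral_eq_lintegral_ofReal (integrable_of_continuous (by fun_prop))
          (Eventually.of_forall fun x => by positivity)]
        refine ENNReal.ofReal_le_ofReal ?_
        have := integral_pow_six_le_of_isSmooth (sm n)
        have e : (fun i => partialD i (trigSum (u n) f)) = fun i => trigSum (u n) (g i) :=
          funext fun i => funext fun x => partialD_trigSum (u n) (h i).weak x
        rwa [e] at this
    _ = _ := hA.liminf_eq

lemma sobolevA_sq_le {f : T3 → ℝ} {g : Fin 3 → T3 → ℝ} (h : HasGrad f g) :
    sobolevA f g ^ 2 ≤ 49 * ((∫ x, f x ^ 2) + ∑ i, ∫ x, g i x ^ 2) := by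
  rw [← toReal_eLpNorm_two_sq (h 0).memLp]
  simp only [fun i => (toReal_eLpNorm_two_sq (h i).memLp').symm]
  unfold sobolevA
  simp only [Fin.sum_univ_three]
  set a := (eLpNorm f 2 volume).toReal
  set b := (eLpNorm (g 0) 2 volume).toReal
  set c := (eLpNorm (g 1) 2 volume).toReal
  set d := (eLpNorm (g 2) 2 volume).toReal
  nlinarith [sq_nonneg (4 * a - b), sq_nonneg (4 * a - c), sq_nonneg (4 * a - d),
    sq_nonneg (b - c), sq_nonneg (b - d), sq_nonneg (c - d)]

lemma HasGrad.integrable_pow_six {f : T3 → ℝ} {g : Fin 3 → T3 → ℝ} (h : HasGrad f g) :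
    Integrable fun x => f x ^ 6 := by
  refine ⟨(h 0).memLp.aestronglyMeasurable.pow 6, ?_⟩
  rw [hasFiniteIntegral_iff_ofReal (Eventually.of_forall fun x => by positivity)]
  exact h.lintegral_pow_six_le.trans_lt ENNReal.ofReal_lt_top

lemma HasGrad.integral_pow_six_le {f : T3 → ℝ} {g : Fin 3 → T3 → ℝ} (h : HasGrad f g) :
    (∫ x, f x ^ 6) ^ (1 / 3 : ℝ) ≤ 49 * ((∫ x, f x ^ 2) + ∑ i, ∫ x, g i x ^ 2) := by
  refine le_trans ?_ (sobolevA_sq_le h)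
  have h1 := h.lintegral_pow_six_le
  have hA := sobolevA_nonneg f g
  rw [← ofReal_integral_eq_lintegral_ofReal h.integrable_pow_six
    (Eventually.of_forall fun x => by positivity), ENNReal.ofReal_le_ofReal_iff (by positivity)] at h1
  have h2 := Real.rpow_le_rpow (integral_nonneg fun x => by positivity) h1
    (by norm_num : (0:ℝ) ≤ 1 / 3)
  refine h2.trans (le_of_eq ?_)
  rw [← Real.rpow_natCast, ← Real.rpow_mul hA]
  norm_num

/-! ### `H²` functions are bounded -/

/-- The symbol of `1 - Δ / (4 π²)`. -/
def symb (k : Fin 3 → ℤ) : ℝ := 1 + ∑ i, (k i : ℝ) ^ 2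

lemma symb_pos (k : Fin 3 → ℤ) : 0 < symb k := by unfold symb; positivity

lemma summable_one_add_sq_rpow :
    Summable fun n : ℤ => (1 + (n : ℝ) ^ 2) ^ (-(2 / 3 : ℝ)) := by
  have h1 : Summable fun n : ℤ => |(n : ℝ)| ^ (-(4 / 3 : ℝ)) :=
    Real.summable_abs_int_rpow (by norm_num)
  have h2 : Summable fun n : ℤ => if n = 0 then (1 : ℝ) else 0 :=
    summable_of_hasFiniteSupport (Set.Finite.subset (Set.finite_singleton 0) fun n hn => by
      simpa using hn)
  refine Summable.of_nonneg_of_le (fun n => by positivity) (fun n => ?_) (h1.add h2)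
  by_cases hn : n = 0
  · subst hn; simp
  · simp only [hn, if_false, add_zero]
    have hn' : (0:ℝ) < |(n : ℝ)| := by simpa using hn
    have : |(n : ℝ)| ^ (-(4 / 3 : ℝ)) = ((n : ℝ) ^ 2) ^ (-(2 / 3 : ℝ)) := by
      rw [← sq_abs, ← Real.rpow_natCast, ← Real.rpow_mul hn'.le]; norm_num
    rw [this]
    refine Real.rpow_le_rpow_of_nonpos (by positivity) (by linarith) (by norm_num)

lemma summable_symb : Summable fun k : Fin 3 → ℤ => symb k ^ (-2 : ℝ) := by
  set h : ℤ → ℝ := fun n => (1 + (n : ℝ) ^ 2) ^ (-(2 / 3 : ℝ)) with hh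
  have hnn : ∀ n, 0 ≤ h n := fun n => by simp only [hh]; positivity
  refine summable_of_sum_le (c := ∏ _i : Fin 3, ∑' n, h n)
    (fun k => Real.rpow_nonneg (symb_pos k).le _) fun S => ?_
  have hle : ∀ k, symb k ^ (-2 : ℝ) ≤ ∏ i, h (k i) := by
    intro k
    have e : symb k ^ (-2 : ℝ) = ∏ _i : Fin 3, symb k ^ (-(2 / 3 : ℝ)) := by
      rw [Finset.prod_const, ← Real.rpow_natCast, ← Real.rpow_mul (symb_pos k).le]; norm_num
    rw [e]
    refine Finset.prod_le_prod (fun i _ => Real.rpow_nonneg (symb_pos k).le _) fun i _ => ?_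
    refine Real.rpow_le_rpow_of_nonpos (by positivity) ?_ (by norm_num)
    unfold symb
    gcongr
    exact Finset.single_le_sum (f := fun i => (k i : ℝ) ^ 2) (fun _ _ => sq_nonneg _)
      (Finset.mem_univ i)
  calc ∑ k ∈ S, symb k ^ (-2 : ℝ) ≤ ∑ k ∈ S, ∏ i, h (k i) := Finset.sum_le_sum fun k _ => hle k
    _ ≤ ∑ k ∈ Fintype.piFinset fun i => S.image fun k => k i, ∏ i, h (k i) := by
        refine Finset.sum_le_sum_of_subset_of_nonneg (fun k hk => ?_)
          fun k _ _ => Finset.prod_nonneg fun i _ => hnn _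
        exact Fintype.mem_piFinset.2 fun i => Finset.mem_image_of_mem _ hk
    _ = ∏ i, ∑ n ∈ S.image fun k => k i, h n := (Finset.prod_univ_sum _ _).symm
    _ ≤ _ := Finset.prod_le_prod (fun i _ => Finset.sum_nonneg fun n _ => hnn n) fun i _ =>
        summable_one_add_sq_rpow.sum_le_tsum _ fun n _ => hnn n

/-- Bessel's inequality for the real trigonometric system. -/
lemma sum_trig_sq_le {q : T3 → ℝ} (hq : MemLp q 2 volume) (S : Finset (Fin 3 → ℤ)) :
    ∑ k ∈ S, ((∫ x, q x * trigC k x) ^ 2 + (∫ x, q x * trigS k x) ^ 2) ≤ ∫ x, q x ^ 2 := by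
  have e : ∀ S : Finset (Fin 3 → ℤ), ∫ x, trigSum S q x * q x
      = ∑ k ∈ S, ((∫ x, q x * trigC k x) ^ 2 + (∫ x, q x * trigS k x) ^ 2) := by
    intro S
    have hi := hq.integrable (by norm_num : (1:ℝ≥0∞) ≤ 2)
    have i1 := fun k => integral_mul_smooth_integrable hi (isSmooth_trigC k).continuous
    have i2 := fun k => integral_mul_smooth_integrable hi (isSmooth_trigS k).continuous
    have e1 : (fun x => trigSum S q x * q x) = fun x => ∑ k ∈ S,
        ((∫ y, q y * trigC k y) * (q x * trigC k x)
          + (∫ y, q y * trigS k y) * (q x * trigS k x)) := by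
      funext x
      rw [trigSum, Finset.sum_mul]
      exact Finset.sum_congr rfl fun k _ => by ring
    have i3 : ∀ k ∈ S, Integrable fun x => (∫ y, q y * trigC k y) * (q x * trigC k x)
          + (∫ y, q y * trigS k y) * (q x * trigS k x) := fun k _ =>
      ((i1 k).const_mul _).add ((i2 k).const_mul _)
    rw [e1, integral_finsetSum _ i3]
    refine Finset.sum_congr rfl fun k _ => ?_
    rw [integral_add ((i1 k).const_mul _) ((i2 k).const_mul _), integral_const_mul,
      integral_const_mul]
    ring
  have t := tendsto_integral_mul_L2 (fun S => memLp_of_continuous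
    (isSmooth_trigSum S q).continuous 2) hq hq (tendsto_trigSum hq)
  simp only [e, ← sq] at t
  refine ge_of_tendsto t (eventually_ge_atTop S |>.mono fun S' hS => ?_)
  exact Finset.sum_le_sum_of_subset_of_nonneg hS fun k _ _ => by positivity

/-- The constant of the embedding `H² ⊂ L^∞`. -/
def embC : ℝ := 2 * Real.sqrt (∑' k : Fin 3 → ℤ, symb k ^ (-2 : ℝ))

/-- `H² ⊂ L^∞`: the Fourier coefficients of `f - Δf/(4π²)` are those of `f` times `symb`, and `1/symb`
is square summable over `ℤ³`. -/
lemma ae_abs_le_of_second_derivs {f : T3 → ℝ} {g l : Fin 3 → T3 → ℝ} (h : HasGrad f g)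
    (h' : ∀ i, HasL2Partial i (g i) (l i)) :
    ∀ᵐ x, |f x| ≤ embC * (eLpNorm (fun x => f x - (4 * Real.pi ^ 2)⁻¹ * ∑ i, l i x) 2
      volume).toReal := by
  set q : T3 → ℝ := fun x => f x - (4 * Real.pi ^ 2)⁻¹ * ∑ i, l i x with hqd
  have hq : MemLp q 2 volume :=
    (h 0).memLp.sub ((memLp_finsetSum _ fun i _ => (h' i).memLp').const_mul _)
  set N := (eLpNorm q 2 volume).toReal with hN
  have hN0 : 0 ≤ N := ENNReal.toReal_nonneg
  have hfi := (h 0).weak.1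
  have hli := fun i => (h' i).weak.2.1
  have hpi := Real.pi_pos.ne'
  -- the Fourier coefficients of `q`
  have coef : ∀ (τ τ' : T3 → ℝ) (k : Fin 3 → ℤ), IsSmooth τ → IsSmooth τ' →
      (∀ i x, partialD i τ x = 2 * Real.pi * k i * τ' x) →
      (∀ i x, partialD i τ' x = - (2 * Real.pi * k i) * τ x) →
      ∫ x, q x * τ x = symb k * ∫ x, f x * τ x := by
    intro τ τ' k hτ hτ' hd hd'
    have e1 : ∀ i, ∫ x, l i x * τ x = - (2 * Real.pi * k i) ^ 2 * ∫ x, f x * τ x := by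
      intro i
      have a1 := (h' i).weak.2.2 τ hτ
      have a2 := (h i).weak.2.2 τ' hτ'
      simp only [hd] at a1
      simp only [hd'] at a2
      have b1 : ∫ x, g i x * (2 * Real.pi * k i * τ' x)
          = (2 * Real.pi * k i) * ∫ x, g i x * τ' x := by
        rw [← integral_const_mul]; congr 1; funext x; ring
      have b2 : ∫ x, f x * (-(2 * Real.pi * k i) * τ x)
          = -(2 * Real.pi * k i) * ∫ x, f x * τ x := by
        rw [← integral_const_mul]; congr 1; funext x; ring
      rw [b1] at a1
      rw [b2] at a2
      linear_combination a1 - (2 * Real.pi * k i) * a2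
    have i1 := integral_mul_smooth_integrable hfi hτ.continuous
    have i2 := fun i => integral_mul_smooth_integrable (hli i) hτ.continuous
    have e2 : (fun x => q x * τ x)
        = fun x => f x * τ x - (4 * Real.pi ^ 2)⁻¹ * ∑ i, l i x * τ x := by
      funext x; simp only [hqd, ← Finset.sum_mul]; ring
    rw [e2, integral_sub i1 ((integrable_finsetSum _ fun i _ => i2 i).const_mul _),
      integral_const_mul, integral_finsetSum _ fun i _ => i2 i]
    simp only [e1, ← Finset.sum_mul, symb, mul_pow, Finset.sum_neg_distrib, ← Finset.mul_sum]
    field_simp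
    ring
  have cC := fun k => coef (trigC k) (fun x => - trigS k x) k (isSmooth_trigC k)
    (by simpa using (isSmooth_const (-1)).mul (isSmooth_trigS k))
    (fun i x => by rw [partialD_trigC]; ring)
    (fun i x => by
      have := partialD_const_mul (isSmooth_trigS k) (-1) i x
      simp only [neg_mul, one_mul] at this
      rw [this, partialD_trigS]; ring)
  have cS := fun k => coef (trigS k) (trigC k) k (isSmooth_trigS k) (isSmooth_trigC k)
    (fun i x => by rw [partialD_trigS]) (fun i x => by rw [partialD_trigC])
  have hC1 : ∀ k x, |trigC k x| ≤ 1 := fun k x => by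
    obtain ⟨y, rfl⟩ := toT3_surjective x
    rw [trigC_toT3]; exact Real.abs_cos_le_one _
  have hS1 : ∀ k x, |trigS k x| ≤ 1 := fun k x => by
    obtain ⟨y, rfl⟩ := toT3_surjective x
    rw [trigS_toT3]; exact Real.abs_sin_le_one _
  have hΛ : ∀ S : Finset (Fin 3 → ℤ), ∑ k ∈ S, (symb k)⁻¹ ^ 2
      ≤ ∑' k : Fin 3 → ℤ, symb k ^ (-2 : ℝ) := by
    intro S
    have : ∀ k, (symb k)⁻¹ ^ 2 = symb k ^ (-2 : ℝ) := fun k => by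
      rw [Real.rpow_neg (symb_pos k).le, inv_pow]
      congr 1; exact (Real.rpow_natCast _ 2).symm
    simp only [this]
    exact summable_symb.sum_le_tsum _ fun k _ => Real.rpow_nonneg (symb_pos k).le _
  -- a uniform bound for the partial sums by Cauchy-Schwarz
  have half : ∀ (S : Finset (Fin 3 → ℤ)) (c d : (Fin 3 → ℤ) → ℝ),
      (∀ k, d k = symb k * c k) → ∑ k ∈ S, d k ^ 2 ≤ N ^ 2 →
      ∑ k ∈ S, |c k| ≤ Real.sqrt (∑' k : Fin 3 → ℤ, symb k ^ (-2 : ℝ)) * N := by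
    intro S c d hcd hd
    have h1 : ∑ k ∈ S, |c k| = ∑ k ∈ S, (symb k)⁻¹ * |d k| := by
      refine Finset.sum_congr rfl fun k _ => ?_
      rw [hcd, abs_mul, abs_of_pos (symb_pos k), inv_mul_cancel_left₀ (symb_pos k).ne']
    rw [h1]
    refine (Real.sum_mul_le_sqrt_mul_sqrt S _ _).trans ?_
    gcongr
    · exact hΛ S
    · simp only [sq_abs]
      rw [← Real.sqrt_sq hN0]
      exact Real.sqrt_le_sqrt hd
  have hNs : N ^ 2 = ∫ x, q x ^ 2 := toReal_eLpNorm_two_sq hq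
  have hpart : ∀ (S : Finset (Fin 3 → ℤ)) x, |trigSum S f x| ≤ embC * N := by
    intro S x
    have bes := sum_trig_sq_le hq S
    rw [← hNs, Finset.sum_add_distrib] at bes
    have p1 : 0 ≤ ∑ k ∈ S, (∫ x, q x * trigC k x) ^ 2 := Finset.sum_nonneg fun _ _ => sq_nonneg _
    have p2 : 0 ≤ ∑ k ∈ S, (∫ x, q x * trigS k x) ^ 2 := Finset.sum_nonneg fun _ _ => sq_nonneg _
    have h1 := half S (fun k => ∫ x, f x * trigC k x) (fun k => ∫ x, q x * trigC k x) cC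
      (by linarith)
    have h2 := half S (fun k => ∫ x, f x * trigS k x) (fun k => ∫ x, q x * trigS k x) cS
      (by linarith)
    calc |trigSum S f x| ≤ ∑ k ∈ S, (|∫ y, f y * trigC k y| + |∫ y, f y * trigS k y|) := by
          refine (Finset.abs_sum_le_sum_abs _ _).trans (Finset.sum_le_sum fun k _ => ?_)
          refine (abs_add_le _ _).trans ?_
          rw [abs_mul, abs_mul]
          exact add_le_add (mul_le_of_le_one_right (abs_nonneg _) (hC1 k x))
            (mul_le_of_le_one_right (abs_nonneg _) (hS1 k x))
      _ ≤ _ := by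
          rw [Finset.sum_add_distrib, embC]
          linarith
  obtain ⟨u, _, hae⟩ := exists_seq_trigSum_ae (h 0).memLp
  filter_upwards [hae] with x hx
  exact le_of_tendsto hx.abs (Eventually.of_forall fun n => hpart _ x)

/-! ### Sobolev norms -/

lemma weakPartial_congr_ae {i : Fin 3} {f g : T3 → ℝ} (h : f =ᵐ[volume] g) :
    weakPartial i f =ᵐ[volume] weakPartial i g := by
  by_cases hf : ∃ k, HasWeakPartial i f k
  · obtain ⟨k, hk⟩ := hf
    exact hk.weakPartial_eq.trans (hk.congr h (ae_eq_refl k)).weakPartial_eq.symm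
  · have hg : ¬ ∃ k, HasWeakPartial i g k := fun ⟨k, hk⟩ =>
      hf ⟨k, hk.congr h.symm (ae_eq_refl k)⟩
    unfold weakPartial
    rw [dif_neg hf, dif_neg hg]

lemma sobolevSq_congr_ae {k : ℕ} : ∀ {f g : T3 → ℝ}, f =ᵐ[volume] g →
    sobolevSq k f = sobolevSq k g := by
  induction k with
  | zero => intro f g h; simp only [sobolevSq, eLpNorm_congr_ae h]
  | succ k ih =>
    intro f g h
    simp only [sobolevSq, eLpNorm_congr_ae h]
    congr 1
    exact Finset.sum_congr rfl fun i _ => ih (weakPartial_congr_ae h)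

lemma MemH.memLp {k : ℕ} {f : T3 → ℝ} (h : MemH k f) : MemLp f 2 volume := by
  cases k with
  | zero => exact h
  | succ k => exact h.1

lemma MemH.partial {k : ℕ} {f : T3 → ℝ} (h : MemH (k + 1) f) (i : Fin 3) :
    MemH k (weakPartial i f) := (h.2 i).2

lemma MemH.hasGrad {k : ℕ} {f : T3 → ℝ} (h : MemH (k + 1) f) :
    HasGrad f fun i => weakPartial i f := fun i =>
  ⟨h.memLp, (h.partial i).memLp, hasWeakPartial_weakPartial (h.2 i).1⟩

lemma eLpNorm_sq_le_sobolevSq (k : ℕ) (f : T3 → ℝ) : eLpNorm f 2 volume ^ 2 ≤ sobolevSq k f := by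
  cases k with
  | zero => exact le_rfl
  | succ k => exact le_self_add

lemma sobolevSq_partial_le (k : ℕ) (f : T3 → ℝ) (i : Fin 3) :
    sobolevSq k (weakPartial i f) ≤ sobolevSq (k + 1) f := by
  refine le_trans ?_ le_add_self
  exact Finset.single_le_sum (f := fun i => sobolevSq k (weakPartial i f)) (fun _ _ => zero_le)
    (Finset.mem_univ i)

lemma MemH.sobolevSq_lt_top {k : ℕ} : ∀ {f : T3 → ℝ}, MemH k f → sobolevSq k f < ⊤ := by
  induction k with
  | zero => intro f h; exact ENNReal.pow_lt_top h.2
  | succ k ih =>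
    intro f h
    exact ENNReal.add_lt_top.2 ⟨ENNReal.pow_lt_top h.memLp.2,
      ENNReal.sum_lt_top.2 fun i _ => ih (h.partial i)⟩

lemma ennreal_sq_add_le (a b : ℝ≥0∞) : (a + b) ^ 2 ≤ 2 * a ^ 2 + 2 * b ^ 2 := by
  have h := ENNReal.rpow_add_le_mul_rpow_add_rpow a b (p := 2) (by norm_num)
  norm_num at h
  calc _ ≤ _ := h
    _ = _ := by ring

lemma sobolevSq_le_of_sub {k : ℕ} : ∀ {f g : T3 → ℝ}, MemH k f → MemH k g →
    sobolevSq k f ≤ 2 * sobolevSq k (fun x => f x - g x) + 2 * sobolevSq k g := by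
  have base : ∀ {f g : T3 → ℝ}, MemLp f 2 volume → MemLp g 2 volume →
      eLpNorm f 2 volume ^ 2
        ≤ 2 * eLpNorm (fun x => f x - g x) 2 volume ^ 2 + 2 * eLpNorm g 2 volume ^ 2 := by
    intro f g hf hg
    refine le_trans ?_ (ennreal_sq_add_le _ _)
    gcongr
    refine le_trans (le_of_eq ?_) (eLpNorm_add_le (hf.sub hg).1 hg.1 (by norm_num))
    congr 1
    funext x; simp
  induction k with
  | zero => intro f g hf hg; exact base hf hg
  | succ k ih =>
    intro f g hf hg
    simp only [sobolevSq, mul_add, Finset.mul_sum]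
    have h1 := base hf.memLp hg.memLp
    have h2 : ∀ i, sobolevSq k (weakPartial i f)
        ≤ 2 * sobolevSq k (weakPartial i fun x => f x - g x)
          + 2 * sobolevSq k (weakPartial i g) := fun i => by
      have e := ((hf.hasGrad i).sub (hg.hasGrad i)).weak.weakPartial_eq
      rw [sobolevSq_congr_ae e]
      exact ih (hf.partial i) (hg.partial i)
    calc _ ≤ _ := add_le_add h1 (Finset.sum_le_sum fun i _ => h2 i)
      _ = _ := by rw [Finset.sum_add_distrib]; ring

lemma MemCH.memH {Tstar : ℝ} {k : ℕ} {f : ℝ → T3 → ℝ} (h : MemCH Tstar k f) {t : ℝ}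
    (ht : t ∈ Set.Ico 0 Tstar) : MemH k (f t) := h.1 t ht

/-- A curve that is continuous into `H^k` is bounded in `H^k` on compact time intervals. -/
lemma MemCH.exists_bound {Tstar T : ℝ} (hT : T < Tstar) {k : ℕ} {f : ℝ → T3 → ℝ}
    (h : MemCH Tstar k f) : ∃ M : ℝ≥0∞, M ≠ ⊤ ∧ ∀ t ∈ Set.Icc 0 T, sobolevSq k (f t) ≤ M := by
  have hsub : Set.Icc 0 T ⊆ Set.Ico 0 Tstar := fun t ht => ⟨ht.1, ht.2.trans_lt hT⟩
  refine isCompact_Icc.induction_on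
    (p := fun S => ∃ M : ℝ≥0∞, M ≠ ⊤ ∧ ∀ t ∈ S, sobolevSq k (f t) ≤ M) ?_ ?_ ?_ ?_
  · exact ⟨0, by simp, by simp⟩
  · rintro S S' hS ⟨M, hM, hb⟩
    exact ⟨M, hM, fun t ht => hb t (hS ht)⟩
  · rintro S S' ⟨M, hM, hb⟩ ⟨M', hM', hb'⟩
    refine ⟨max M M', (max_lt hM.lt_top hM'.lt_top).ne, ?_⟩
    rintro t (ht | ht)
    · exact (hb t ht).trans (le_max_left _ _)
    · exact (hb' t ht).trans (le_max_right _ _)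
  · intro s hs
    have h1 := (h.2 s (hsub hs)).eventually (Iio_mem_nhds (zero_lt_one (α := ℝ≥0∞)))
    have h2 : ∀ᶠ t in 𝓝[Set.Icc 0 T] s, t ∈ Set.Icc 0 T ∧
        sobolevSq k (fun x => f t x - f s x) < 1 :=
      (eventually_mem_nhdsWithin).and (nhdsWithin_mono _ hsub h1)
    refine ⟨_, h2, 2 * 1 + 2 * sobolevSq k (f s), ?_, fun t ht => ?_⟩
    · have := (h.memH (hsub hs)).sobolevSq_lt_top
      finiteness
    · refine (sobolevSq_le_of_sub (h.memH (hsub ht.1)) (h.memH (hsub hs))).trans ?_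
      gcongr
      exact ht.2.le

lemma ennreal_le_one_add_sq (a : ℝ≥0∞) : a ≤ 1 + a ^ 2 := by
  rcases le_total a 1 with h | h
  · exact h.trans le_self_add
  · refine le_trans ?_ le_add_self
    calc a = a * 1 := (mul_one a).symm
      _ ≤ a * a := by gcongr
      _ = a ^ 2 := (sq a).symm

/-- The embedding `H² ⊂ L^∞`, uniformly on bounded sets. -/
lemma exists_ae_bound_of_sobolevSq_le {M : ℝ≥0∞} (hM : M ≠ ⊤) :
    ∃ B : ℝ, 0 ≤ B ∧ ∀ f : T3 → ℝ, MemH 2 f → sobolevSq 2 f ≤ M → ∀ᵐ x, |f x| ≤ B := by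
  have hpos : (0:ℝ) ≤ (4 * Real.pi ^ 2)⁻¹ := by positivity
  set N : ℝ≥0∞ := (1 + M) + ENNReal.ofReal (4 * Real.pi ^ 2)⁻¹ * ∑ _i : Fin 3, (1 + M) with hN
  have hNt : N ≠ ⊤ := by
    rw [hN]
    exact ENNReal.add_ne_top.2 ⟨by finiteness, ENNReal.mul_ne_top ENNReal.ofReal_ne_top
      (ENNReal.sum_ne_top.2 fun _ _ => by finiteness)⟩
  refine ⟨embC * N.toReal, by unfold embC; positivity, fun f hf hfM => ?_⟩
  have hl : ∀ a : T3 → ℝ, ∀ k, sobolevSq k a ≤ M → eLpNorm a 2 volume ≤ 1 + M := fun a k ha =>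
    (ennreal_le_one_add_sq _).trans (add_le_add le_rfl ((eLpNorm_sq_le_sobolevSq k a).trans ha))
  have h1 := ae_abs_le_of_second_derivs (l := fun i => weakPartial i (weakPartial i f)) hf.hasGrad
    fun i => (hf.partial i).hasGrad i
  filter_upwards [h1] with x hx
  refine hx.trans ?_
  have : (0:ℝ) ≤ embC := by unfold embC; positivity
  gcongr
  have m2 : ∀ i, MemLp (weakPartial i (weakPartial i f)) 2 volume := fun i =>
    ((hf.partial i).hasGrad i).memLp'
  have e : eLpNorm (fun x => f x - (4 * Real.pi ^ 2)⁻¹ * ∑ i, weakPartial i (weakPartial i f) x) 2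
      volume ≤ eLpNorm f 2 volume + eLpNorm ((4 * Real.pi ^ 2)⁻¹ •
        ∑ i, weakPartial i (weakPartial i f)) 2 volume := by
    refine le_trans (le_of_eq ?_) (eLpNorm_sub_le hf.memLp.1
      ((memLp_finsetSum' _ fun i _ => m2 i).const_smul (4 * Real.pi ^ 2)⁻¹).1 (by norm_num))
    congr 1
  refine e.trans (add_le_add (hl f 2 hfM) ?_)
  rw [eLpNorm_const_smul, Real.enorm_eq_ofReal hpos]
  gcongr
  refine (eLpNorm_sum_le (fun i _ => (m2 i).1) (by norm_num)).trans
    (Finset.sum_le_sum fun i _ => hl _ 0 ?_)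
  exact (sobolevSq_partial_le 0 _ i).trans ((sobolevSq_partial_le 1 f i).trans hfM)

lemma MemCH.exists_ae_bound {Tstar T : ℝ} (hT : T < Tstar) {f : ℝ → T3 → ℝ}
    (h : MemCH Tstar 2 f) : ∃ B : ℝ, 0 ≤ B ∧ ∀ t ∈ Set.Icc 0 T, ∀ᵐ x, |f t x| ≤ B := by
  obtain ⟨M, hM, hb⟩ := h.exists_bound hT
  obtain ⟨B, hB, h1⟩ := exists_ae_bound_of_sobolevSq_le hM
  exact ⟨B, hB, fun t ht => h1 _ (h.memH ⟨ht.1, ht.2.trans_lt hT⟩) (hb t ht)⟩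

lemma MemCH.exists_ae_bound_partial {Tstar T : ℝ} (hT : T < Tstar) {f : ℝ → T3 → ℝ}
    (h : MemCH Tstar 3 f) :
    ∃ B : ℝ, 0 ≤ B ∧ ∀ t ∈ Set.Icc 0 T, ∀ i, ∀ᵐ x, |weakPartial i (f t) x| ≤ B := by
  obtain ⟨M, hM, hb⟩ := h.exists_bound hT
  obtain ⟨B, hB, h1⟩ := exists_ae_bound_of_sobolevSq_le hM
  exact ⟨B, hB, fun t ht i => h1 _ ((h.memH ⟨ht.1, ht.2.trans_lt hT⟩).partial i)
    ((sobolevSq_partial_le 2 _ i).trans (hb t ht))⟩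

lemma MemCH.mono {Tstar : ℝ} {k : ℕ} {f : ℝ → T3 → ℝ} (h : MemCH Tstar (k + 1) f) :
    MemCH Tstar k f := by
  have h1 : ∀ k (f : T3 → ℝ), MemH (k + 1) f → MemH k f := by
    intro k
    induction k with
    | zero => intro f hf; exact hf.memLp
    | succ k ih => intro f hf; exact ⟨hf.memLp, fun i => ⟨(hf.2 i).1, ih _ (hf.partial i)⟩⟩
  have h2 : ∀ k (f : T3 → ℝ), sobolevSq k f ≤ sobolevSq (k + 1) f := by
    intro k
    induction k with
    | zero => intro f; exact eLpNorm_sq_le_sobolevSq 1 f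
    | succ k ih => intro f; exact add_le_add le_rfl (Finset.sum_le_sum fun i _ => ih _)
  exact ⟨fun t ht => h1 _ _ (h.1 t ht), fun s hs =>
    tendsto_of_tendsto_of_tendsto_of_le_of_le tendsto_const_nhds (h.2 s hs)
      (fun _ => zero_le) fun t => h2 _ _⟩

lemma MemCH.continuousOn_integral_mul {Tstar : ℝ} {k : ℕ} {f : ℝ → T3 → ℝ}
    (h : MemCH Tstar k f) {η : T3 → ℝ} (hη : MemLp η 2 volume) :
    ContinuousOn (fun t => ∫ x, f t x * η x) (Set.Ico 0 Tstar) := by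
  intro s hs
  have hs' := (h.memH hs).memLp
  have h1 : Tendsto (fun t => eLpNorm (fun x => f t x - f s x) 2 volume)
      (𝓝[Set.Ico 0 Tstar] s) (𝓝 0) := by
    have h2 : Tendsto (fun t => eLpNorm (fun x => f t x - f s x) 2 volume ^ 2)
        (𝓝[Set.Ico 0 Tstar] s) (𝓝 0) :=
      tendsto_of_tendsto_of_tendsto_of_le_of_le tendsto_const_nhds (h.2 s hs)
        (fun _ => zero_le) fun t => eLpNorm_sq_le_sobolevSq k _
    have h3 := h2.ennrpow_const (1 / 2)
    simp only [← ENNReal.rpow_natCast, ← ENNReal.rpow_mul] at h3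
    simpa using h3
  rw [ContinuousWithinAt, tendsto_iff_norm_sub_tendsto_zero]
  have h4 : Tendsto (fun t => (eLpNorm (fun x => f t x - f s x) 2 volume).toReal
      * (eLpNorm η 2 volume).toReal) (𝓝[Set.Ico 0 Tstar] s) (𝓝 0) := by
    simpa using ((ENNReal.tendsto_toReal ENNReal.zero_ne_top).comp h1).mul_const
      (eLpNorm η 2 volume).toReal
  refine squeeze_zero' (Eventually.of_forall fun _ => norm_nonneg _) ?_ h4
  filter_upwards [eventually_mem_nhdsWithin] with t ht
  have ht' := (h.memH ht).memLp
  rw [← integral_sub (integrable_mul_L2 ht' hη) (integrable_mul_L2 hs' hη), Real.norm_eq_abs]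
  refine le_trans (le_of_eq ?_) (abs_integral_mul_le (ht'.sub hs') hη)
  congr 2; funext x; ring

/-! ### Functions of time with a weak derivative -/

/-- A continuous function on `[0, Ts)` with a locally integrable weak derivative is the integral
of that derivative. -/
lemma eq_add_integral_of_weak_deriv {Ts : ℝ} (hTs : 0 < Ts) {m n : ℝ → ℝ}
    (hm : ContinuousOn m (Set.Ico 0 Ts))
    (hn : ∀ T, 0 < T → T < Ts → IntervalIntegrable n volume 0 T)
    (h : ∀ θ : ℝ → ℝ, ContDiff ℝ ∞ θ → HasCompactSupport θ → tsupport θ ⊆ Set.Ioo 0 Ts →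
      ∫ t in Set.Ioo 0 Ts, deriv θ t * m t = - ∫ t in Set.Ioo 0 Ts, θ t * n t) :
    ∀ t ∈ Set.Ico 0 Ts, m t = m 0 + ∫ τ in 0..t, n τ := by
  set N : ℝ → ℝ := fun t => ∫ τ in 0..t, n τ with hN
  have hNc : ContinuousOn N (Set.Ico 0 Ts) := by
    intro s hs
    obtain ⟨T, hT1, hT2⟩ := exists_between hs.2
    have h1 := intervalIntegral.continuousOn_primitive_interval' (hn T (hs.1.trans_lt hT1) hT2)
      (Set.left_mem_uIcc)
    rw [Set.uIcc_of_le (hs.1.trans hT1.le)] at h1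
    refine (h1 s ⟨hs.1, hT1.le⟩).mono_of_mem_nhdsWithin ?_
    refine mem_nhdsWithin.2 ⟨Set.Iio T, isOpen_Iio, hT1, fun r hr => ⟨hr.2.1, hr.1.le⟩⟩
  set k : ℝ → ℝ := fun t => m t - N t with hk
  have hkc : ContinuousOn k (Set.Ico 0 Ts) := hm.sub hNc
  -- a compact subset of the open interval lies in a closed subinterval
  have hcpt : ∀ K : Set ℝ, IsCompact K → K ⊆ Set.Ioo 0 Ts →
      ∃ a b, 0 < a ∧ a ≤ b ∧ b < Ts ∧ K ⊆ Set.Icc a b := by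
    intro K hK hKs
    rcases K.eq_empty_or_nonempty with rfl | hne
    · exact ⟨Ts / 2, Ts / 2, by linarith, le_rfl, by linarith, by simp⟩
    · obtain ⟨a, ha, ha'⟩ := hK.exists_isLeast hne
      obtain ⟨b, hb, hb'⟩ := hK.exists_isGreatest hne
      exact ⟨a, b, (hKs ha).1, ha' hb, (hKs hb).2, fun x hx => ⟨ha' hx, hb' hx⟩⟩
  -- integrals over the whole interval of functions supported in a subinterval
  have hsupp : ∀ (F : ℝ → ℝ) (a b : ℝ), 0 < a → b < Ts → a ≤ b →
      (∀ t, t ∉ Set.Icc a b → F t = 0) → ∀ T, b ≤ T → T < Ts →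
      ∫ t in Set.Ioo 0 Ts, F t = ∫ t in 0..T, F t := by
    intro F a b ha hb hab hF T hbT hT
    rw [intervalIntegral.integral_of_le (ha.le.trans (hab.trans hbT))]
    refine setIntegral_eq_of_subset_of_forall_sdiff_eq_zero measurableSet_Ioo
      (fun t (ht : t ∈ Set.Ioc 0 T) => ⟨ht.1, ht.2.trans_lt hT⟩) fun t ht => hF t fun h => ht.2 ?_
    exact ⟨ha.trans_le h.1, h.2.trans hbT⟩
  -- `k` has vanishing weak derivative
  have key : ∀ θ : ℝ → ℝ, ContDiff ℝ ∞ θ → HasCompactSupport θ → tsupport θ ⊆ Set.Ioo 0 Ts →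
      ∫ t in Set.Ioo 0 Ts, deriv θ t * k t = 0 := by
    intro θ hθ hθc hθs
    obtain ⟨a, b, ha, hab, hb, hK⟩ := hcpt _ hθc hθs
    obtain ⟨T, hbT, hT⟩ := exists_between hb
    have hT0 : 0 < T := ha.trans_le (hab.trans hbT.le)
    have z1 : ∀ t, t ∉ Set.Icc a b → θ t = 0 := fun t ht =>
      image_eq_zero_of_notMem_tsupport fun h => ht (hK h)
    have z2 : ∀ t, t ∉ Set.Icc a b → deriv θ t = 0 := fun t ht => by
      by_contra h0
      exact ht (hK (support_deriv_subset (f := θ) h0))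
    have h0 := h θ hθ hθc hθs
    have hdc : Continuous (deriv θ) := hθ.continuous_deriv (by simp)
    rw [hsupp _ a b ha hb hab (fun t ht => by rw [z2 t ht, zero_mul]) T hbT.le hT,
      hsupp _ a b ha hb hab (fun t ht => by rw [z1 t ht, zero_mul]) T hbT.le hT] at h0
    rw [hsupp _ a b ha hb hab (fun t ht => by rw [z2 t ht, zero_mul]) T hbT.le hT]
    have hsubT : Set.uIcc 0 T ⊆ Set.Ico 0 Ts := by
      rw [Set.uIcc_of_le hT0.le]
      exact fun t ht => ⟨ht.1, ht.2.trans_lt hT⟩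
    have ac1 : AbsolutelyContinuousOnInterval θ 0 T :=
      (hθ.of_le (by simp)).contDiffOn.absolutelyContinuousOnInterval
    have ac2 : AbsolutelyContinuousOnInterval N 0 T :=
      (hn T hT0 hT).absolutelyContinuousOnInterval_intervalIntegral Set.left_mem_uIcc
    have ibp := ac1.integral_mul_deriv_eq_deriv_mul ac2
    have e1 : ∫ t in 0..T, θ t * deriv N t = ∫ t in 0..T, θ t * n t := by
      refine intervalIntegral.integral_congr_ae ?_
      filter_upwards [(hn T hT0 hT).ae_hasDerivAt_integral] with t ht hmem
      rw [(ht (Set.uIoc_subset_uIcc hmem) 0 Set.left_mem_uIcc).deriv]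
    rw [e1, z1 T (fun h => not_lt.2 h.2 hbT), z1 0 (fun h => not_lt.2 h.1 ha), zero_mul, zero_mul,
      sub_zero, zero_sub] at ibp
    have i1 : IntervalIntegrable (fun t => deriv θ t * m t) volume 0 T :=
      (hdc.continuousOn.mul (hm.mono hsubT)).intervalIntegrable
    have i2 : IntervalIntegrable (fun t => deriv θ t * N t) volume 0 T :=
      (hdc.continuousOn.mul (hNc.mono hsubT)).intervalIntegrable
    simp only [hk, mul_sub]
    rw [intervalIntegral.integral_sub i1 i2, h0, ibp]
    ring
  -- a normalised bump function
  obtain ⟨χ, hχs, hχc, hχt, hχ1⟩ : ∃ χ : ℝ → ℝ, ContDiff ℝ ∞ χ ∧ HasCompactSupport χ ∧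
      tsupport χ ⊆ Set.Ioo 0 Ts ∧ ∫ t, χ t = 1 := by
    let B : ContDiffBump (Ts / 2) := ⟨Ts / 8, Ts / 4, by linarith, by linarith⟩
    refine ⟨B.normed volume, B.contDiff_normed, B.hasCompactSupport_normed, ?_,
      B.integral_normed⟩
    rw [B.tsupport_normed_eq, Real.closedBall_eq_Icc]
    intro t ht
    have h1 : Ts / 2 - Ts / 4 ≤ t := ht.1
    have h2 : t ≤ Ts / 2 + Ts / 4 := ht.2
    exact ⟨by linarith, by linarith⟩
  set c := ∫ t in Set.Ioo 0 Ts, χ t * k t with hc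
  have intg : ∀ ψ : ℝ → ℝ, Continuous ψ → HasCompactSupport ψ → tsupport ψ ⊆ Set.Ioo 0 Ts →
      ∀ F : ℝ → ℝ, ContinuousOn F (Set.Ico 0 Ts) →
      IntegrableOn (fun t => ψ t * F t) (Set.Ioo 0 Ts) := by
    intro ψ hψ hψc hψs F hF
    obtain ⟨a, b, ha, hab, hb, hK⟩ := hcpt _ hψc hψs
    have h1 : IntegrableOn (fun t => ψ t * F t) (Set.Icc a b) :=
      (hψ.continuousOn.mul (hF.mono fun t ht => ⟨ha.le.trans ht.1, ht.2.trans_lt hb⟩)).integrableOn_Icc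
    refine h1.of_forall_sdiff_eq_zero measurableSet_Ioo fun t ht => ?_
    rw [image_eq_zero_of_notMem_tsupport fun h => ht.2 (hK h), zero_mul]
  -- test with the primitive of `ψ - (∫ ψ) χ`, where `∫ χ = 1`
  have hae : ∀ᵐ t : ℝ, t ∈ Set.Ioo 0 Ts → k t - c = 0 := by
    refine isOpen_Ioo.ae_eq_zero_of_integral_contDiff_smul_eq_zero ?_ ?_
    · exact ((hkc.mono Set.Ioo_subset_Ico_self).sub continuousOn_const).locallyIntegrableOn
        measurableSet_Ioo
    · intro ψ hψ hψc hψs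
      set I := ∫ t, ψ t with hI
      set w : ℝ → ℝ := fun t => ψ t - I * χ t with hw
      have hws : ContDiff ℝ ∞ w := hψ.sub (contDiff_const.mul hχs)
      have hwc : Continuous w := hws.continuous
      obtain ⟨a, b, ha, hab, hb, hK⟩ := hcpt (tsupport ψ ∪ tsupport χ) (hψc.union hχc)
        (Set.union_subset hψs hχt)
      have z : ∀ t, t ∉ Set.Icc a b → w t = 0 := fun t ht => by
        simp only [hw]
        rw [image_eq_zero_of_notMem_tsupport fun h => ht (hK (Or.inl h)),
          image_eq_zero_of_notMem_tsupport fun h => ht (hK (Or.inr h))]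
        ring
      set θ : ℝ → ℝ := fun t => ∫ τ in 0..t, w τ with hθ
      have dθ : ∀ t, HasDerivAt θ (w t) t := fun t =>
        intervalIntegral.integral_hasDerivAt_right (hwc.intervalIntegrable _ _)
          hwc.aestronglyMeasurable.stronglyMeasurableAtFilter hwc.continuousAt
      have dθ' : deriv θ = w := funext fun t => (dθ t).deriv
      have sθ : ContDiff ℝ ∞ θ := contDiff_infty_iff_deriv.2
        ⟨fun t => (dθ t).differentiableAt, by rw [dθ']; exact hws⟩
      have ψi : Integrable ψ := hψ.continuous.integrable_of_hasCompactSupport hψc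
      have χi : Integrable χ := hχs.continuous.integrable_of_hasCompactSupport hχc
      have tot : ∫ t, w t = 0 := by
        simp only [hw]
        rw [integral_sub ψi (χi.const_mul I), integral_const_mul, hχ1, ← hI]; ring
      have zθ : ∀ t, t ∉ Set.Icc a b → θ t = 0 := by
        intro t ht
        by_cases hta : t < a
        · simp only [hθ]
          refine intervalIntegral.integral_zero_ae (ae_of_all _ fun r hr => ?_)
          refine z r fun h => not_lt.2 h.1 ?_
          rcases le_total 0 t with h0 | h0
          · rw [Set.uIoc_of_le h0] at hr; exact hr.2.trans_lt hta
          · rw [Set.uIoc_of_ge h0] at hr; exact hr.2.trans_lt ha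
        · have hbt : b < t := by
            by_contra h1
            exact ht ⟨not_lt.1 hta, not_lt.1 h1⟩
          simp only [hθ]
          rw [intervalIntegral.integral_of_le (ha.le.trans (hab.trans hbt.le))]
          refine Eq.trans ?_ tot
          refine setIntegral_eq_integral_of_forall_compl_eq_zero fun r hr => z r fun h => hr ?_
          exact ⟨ha.trans_le h.1, h.2.trans hbt.le⟩
      have tsθ : tsupport θ ⊆ Set.Icc a b := by
        refine closure_minimal (fun t ht => ?_) isClosed_Icc
        by_contra h1
        exact ht (zθ t h1)
      have h2 := key θ sθ (HasCompactSupport.of_support_subset_isCompact isCompact_Icc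
        (subset_closure.trans tsθ)) (tsθ.trans fun t ht => ⟨ha.trans_le ht.1, ht.2.trans_lt hb⟩)
      rw [dθ'] at h2
      have i1 := intg ψ hψ.continuous hψc hψs k hkc
      have i2 := intg χ hχs.continuous hχc hχt k hkc
      have e1 : ∫ t in Set.Ioo 0 Ts, w t * k t = (∫ t in Set.Ioo 0 Ts, ψ t * k t) - I * c := by
        rw [hc, ← integral_const_mul, ← integral_sub i1 (i2.const_mul I)]
        congr 1; funext t; simp only [hw]; ring
      have e2 : I = ∫ t in Set.Ioo 0 Ts, ψ t :=
        (setIntegral_eq_integral_of_forall_compl_eq_zero fun t ht =>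
          image_eq_zero_of_notMem_tsupport fun h => ht (hψs h)).symm
      rw [setIntegral_eq_integral_of_forall_compl_eq_zero (s := Set.Ioo 0 Ts) (fun t ht => by
        rw [image_eq_zero_of_notMem_tsupport fun h => ht (hψs h), zero_smul]) |>.symm]
      simp only [smul_eq_mul, mul_sub]
      rw [integral_sub i1 (ψi.integrableOn.mul_const c), integral_mul_const, ← e2]
      linarith
  have heq : Set.EqOn k (fun _ => c) (Set.Ico 0 Ts) := by
    refine Measure.eqOn_Ico_of_ae_eq (μ := volume) ?_ hkc continuousOn_const
    rw [EventuallyEq, ae_restrict_iff' measurableSet_Ico]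
    have h0 : ∀ᵐ t : ℝ, t ≠ 0 := by simp [ae_iff]
    filter_upwards [hae, h0] with t ht h0 hmem
    have := ht ⟨lt_of_le_of_ne hmem.1 (Ne.symm h0), hmem.2⟩
    linarith
  intro t ht
  have h1 := heq ht
  have h2 := heq (⟨le_rfl, hTs⟩ : (0:ℝ) ∈ Set.Ico 0 Ts)
  simp only [hk, hN, intervalIntegral.integral_same] at h1 h2
  linarith

/-! ### Lipschitz curves in `L²` -/

/-- `f` is a Lipschitz curve `[0, T] → L²` with the weak derivative `g`, both tested with smooth
functions of the space variable. No joint measurability in time and space is asked for. -/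
structure IsCurve (T : ℝ) (f g : ℝ → T3 → ℝ) : Prop where
  memLp : ∀ t ∈ Set.Icc 0 T, MemLp (f t) 2 volume
  bound : ∃ M : ℝ, 0 ≤ M ∧ ∀ᵐ t ∂(volume.restrict (Set.Ioo 0 T)),
    MemLp (g t) 2 volume ∧ eLpNorm (g t) 2 volume ≤ ENNReal.ofReal M
  meas : ∀ η, IsSmooth η →
    AEStronglyMeasurable (fun t => ∫ x, g t x * η x) (volume.restrict (Set.Ioo 0 T))
  ftc : ∀ η, IsSmooth η → ∀ t ∈ Set.Icc 0 T,
    ∫ x, f t x * η x = (∫ x, f 0 x * η x) + ∫ τ in 0..t, ∫ x, g τ x * η x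

lemma MemCH.memLinftyL2 {Tstar : ℝ} {k : ℕ} {f : ℝ → T3 → ℝ} (h : MemCH Tstar k f) :
    MemLinftyL2 Tstar f := by
  intro T _ hT'
  obtain ⟨M, hM, hb⟩ := h.exists_bound hT'
  refine ⟨(1 + M).toReal, ?_⟩
  filter_upwards [ae_restrict_mem measurableSet_Ioo] with t ht
  have ht' : t ∈ Set.Icc 0 T := Set.Ioo_subset_Icc_self ht
  refine ⟨(h.memH ⟨ht'.1, ht'.2.trans_lt hT'⟩).memLp, ?_⟩
  rw [ENNReal.ofReal_toReal (by finiteness)]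
  exact (ennreal_le_one_add_sq _).trans
    (add_le_add le_rfl ((eLpNorm_sq_le_sobolevSq k _).trans (hb t ht')))

lemma intervalIntegrable_of_bound {T : ℝ} (hT : 0 ≤ T) {n : ℝ → ℝ} {M : ℝ}
    (hm : AEStronglyMeasurable n (volume.restrict (Set.Ioo 0 T)))
    (hb : ∀ᵐ t ∂(volume.restrict (Set.Ioo 0 T)), ‖n t‖ ≤ M) :
    IntervalIntegrable n volume 0 T := by
  rw [intervalIntegrable_iff_integrableOn_Ioo_of_le hT]
  exact Integrable.of_bound hm M hb

lemma abs_integral_mul_le_of_bound {a η : T3 → ℝ} {M : ℝ} (hM : 0 ≤ M) (hη : MemLp η 2 volume)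
    (h : MemLp a 2 volume ∧ eLpNorm a 2 volume ≤ ENNReal.ofReal M) :
    ‖∫ x, a x * η x‖ ≤ M * (eLpNorm η 2 volume).toReal := by
  refine (abs_integral_mul_le h.1 hη).trans ?_
  gcongr
  exact ENNReal.toReal_le_of_le_ofReal hM h.2

/-- Testing the weak time derivative with products `θ(t) η(x)` gives the fundamental theorem of calculus
for `t ↦ ∫ f(t) η`. -/
lemma isCurve_of_hasWeakTimeDeriv {Tstar T : ℝ} (hT : 0 < T) (hT' : T < Tstar) {k : ℕ}
    {f g : ℝ → T3 → ℝ} (hf : MemCH Tstar k f) (hg : SpaceTimeMeasurable Tstar g)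
    (hb : MemLinftyL2 Tstar g) (hw : HasWeakTimeDeriv Tstar f g) : IsCurve T f g := by
  have hTs : 0 < Tstar := hT.trans hT'
  have hbd : ∀ T, 0 < T → T < Tstar → ∃ M : ℝ, 0 ≤ M ∧ ∀ᵐ t ∂(volume.restrict (Set.Ioo 0 T)),
      MemLp (g t) 2 volume ∧ eLpNorm (g t) 2 volume ≤ ENNReal.ofReal M := by
    intro T h1 h2
    obtain ⟨M, hM⟩ := hb T h1 h2
    refine ⟨max M 0, le_max_right _ _, hM.mono fun t ht => ⟨ht.1, ht.2.trans ?_⟩⟩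
    exact ENNReal.ofReal_le_ofReal (le_max_left _ _)
  have hmeas : ∀ η, IsSmooth η → AEStronglyMeasurable (fun t => ∫ x, g t x * η x)
      (volume.restrict (Set.Ioo 0 Tstar)) := fun η hη => by
    have h1 : AEStronglyMeasurable (fun p : ℝ × T3 => g p.1 p.2 * η p.2)
        ((volume.restrict (Set.Ioo 0 Tstar)).prod volume) :=
      hg.mul (hη.continuous.comp continuous_snd).aestronglyMeasurable
    exact h1.integral_prod_right'
  have hmeas' : ∀ η, IsSmooth η → ∀ T, T < Tstar → AEStronglyMeasurable (fun t => ∫ x, g t x * η x)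
      (volume.restrict (Set.Ioo 0 T)) := fun η hη T h2 =>
    (hmeas η hη).mono_measure (Measure.restrict_mono (Set.Ioo_subset_Ioo_right h2.le) le_rfl)
  refine ⟨fun t ht => (hf.memH ⟨ht.1, ht.2.trans_lt hT'⟩).memLp, hbd T hT hT',
    fun η hη => hmeas' η hη T hT', fun η hη t ht => ?_⟩
  have mη : MemLp η 2 volume := memLp_of_continuous hη.continuous 2
  refine eq_add_integral_of_weak_deriv (m := fun t => ∫ x, f t x * η x)
    (n := fun t => ∫ x, g t x * η x) hTs (hf.continuousOn_integral_mul mη) ?_ ?_ t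
    ⟨ht.1, ht.2.trans_lt hT'⟩
  · intro T h1 h2
    obtain ⟨M, hM, hMb⟩ := hbd T h1 h2
    exact intervalIntegrable_of_bound h1.le (hmeas' η hη T h2)
      (hMb.mono fun t ht => abs_integral_mul_le_of_bound hM mη ht)
  · intro θ hθ hθc hθs
    have htest : IsSpaceTimeTest Tstar (fun t x => θ t * η x) := by
      refine ⟨?_, ?_⟩
      · exact (hθ.comp contDiff_fst).mul (ContDiff.comp (g := fun y => η (toT3 y)) hη contDiff_snd)
      · rcases (tsupport θ).eq_empty_or_nonempty with h0 | hne
        · refine ⟨Tstar / 2, Tstar / 2, by linarith, by linarith, fun t _ x => ?_⟩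
          have h0' : θ t = 0 := image_eq_zero_of_notMem_tsupport (by rw [h0]; simp)
          show θ t * η x = 0
          rw [h0', zero_mul]
        · obtain ⟨a, ha, ha'⟩ := hθc.isCompact.exists_isLeast hne
          obtain ⟨b, hb, hb'⟩ := hθc.isCompact.exists_isGreatest hne
          refine ⟨a, b, (hθs ha).1, (hθs hb).2, fun t ht x => ?_⟩
          have h0' : θ t = 0 := image_eq_zero_of_notMem_tsupport fun h => ht ⟨ha' h, hb' h⟩
          show θ t * η x = 0
          rw [h0', zero_mul]
    have h1 := hw _ htest
    have e1 : ∀ t, ∫ x, f t x * deriv (fun s => θ s * η x) t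
        = deriv θ t * ∫ x, f t x * η x := fun t => by
      rw [← integral_const_mul]
      congr 1; funext x
      rw [deriv_mul_const (hθ.differentiable (by simp) t)]; ring
    have e2 : ∀ t, ∫ x, g t x * (θ t * η x) = θ t * ∫ x, g t x * η x := fun t => by
      rw [← integral_const_mul]
      congr 1; funext x; ring
    simpa only [e1, e2] using h1

/-- The spatial derivative of a curve is a curve. -/
lemma IsCurve.partial {T : ℝ} {f g : ℝ → T3 → ℝ} (h : IsCurve T f g) (i : Fin 3)
    (hf : ∀ t ∈ Set.Icc 0 T, HasL2Partial i (f t) (weakPartial i (f t)))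
    (hg : ∃ M : ℝ, 0 ≤ M ∧ ∀ᵐ t ∂(volume.restrict (Set.Ioo 0 T)),
      HasL2Partial i (g t) (weakPartial i (g t)) ∧
        eLpNorm (weakPartial i (g t)) 2 volume ≤ ENNReal.ofReal M) :
    IsCurve T (fun t => weakPartial i (f t)) (fun t => weakPartial i (g t)) := by
  obtain ⟨M, hM, hMb⟩ := hg
  refine ⟨fun t ht => (hf t ht).memLp', ⟨M, hM, hMb.mono fun t ht => ⟨ht.1.memLp', ht.2⟩⟩,
    fun η hη => ?_, fun η hη t ht => ?_⟩
  · refine (h.meas _ (hη.partialD i)).neg.congr ?_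
    filter_upwards [hMb] with t ht
    rw [Pi.neg_apply, ht.1.weak.2.2 η hη, neg_neg]
  · have h1 := h.ftc _ (hη.partialD i) t ht
    have e1 := (hf t ht).weak.2.2 η hη
    have e2 := (hf 0 ⟨le_rfl, ht.1.trans ht.2⟩).weak.2.2 η hη
    have e3 : ∫ τ in 0..t, ∫ x, g τ x * partialD i η x
        = - ∫ τ in 0..t, ∫ x, weakPartial i (g τ) x * η x := by
      rw [← intervalIntegral.integral_neg, intervalIntegral.integral_of_le ht.1,
        intervalIntegral.integral_of_le ht.1, integral_Ioc_eq_integral_Ioo,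
        integral_Ioc_eq_integral_Ioo]
      refine integral_congr_ae ?_
      filter_upwards [ae_mono (Measure.restrict_mono (Set.Ioo_subset_Ioo_right ht.2) le_rfl) hMb]
        with τ hτ
      exact hτ.1.weak.2.2 η hη
    rw [e1, e2, e3] at h1
    linarith

lemma IsCurve.intervalIntegrable {T : ℝ} (hT : 0 ≤ T) {f g : ℝ → T3 → ℝ} (h : IsCurve T f g)
    {η : T3 → ℝ} (hη : IsSmooth η) :
    IntervalIntegrable (fun t => ∫ x, g t x * η x) volume 0 T := by
  obtain ⟨M, hM, hMb⟩ := h.bound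
  exact intervalIntegrable_of_bound hT (h.meas η hη) (hMb.mono fun t ht =>
    abs_integral_mul_le_of_bound hM (memLp_of_continuous hη.continuous 2) ht)

/-- A curve with bounded weak derivative is Lipschitz in `L²`. -/
lemma IsCurve.lipschitz {T : ℝ} {f g : ℝ → T3 → ℝ} (h : IsCurve T f g) :
    ∃ M : ℝ, 0 ≤ M ∧ ∀ s ∈ Set.Icc 0 T, ∀ t ∈ Set.Icc 0 T,
      (eLpNorm (fun x => f t x - f s x) 2 volume).toReal ≤ M * |t - s| := by
  obtain ⟨M, hM, hMb⟩ := h.bound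
  refine ⟨M, hM, fun s hs t ht => ?_⟩
  set d : T3 → ℝ := fun x => f t x - f s x with hd
  have md : MemLp d 2 volume := (h.memLp t ht).sub (h.memLp s hs)
  have hT : 0 ≤ T := hs.1.trans hs.2
  -- the difference is tested with its own Fourier sums
  have key : ∀ S, ∫ x, trigSum S d x * d x
      ≤ M * |t - s| * (eLpNorm (trigSum S d) 2 volume).toReal := by
    intro S
    have hη := isSmooth_trigSum S d
    have mη : MemLp (trigSum S d) 2 volume := memLp_of_continuous hη.continuous 2
    have hi := h.intervalIntegrable hT hη
    have e1 : ∫ x, trigSum S d x * d x = ∫ τ in s..t, ∫ x, g τ x * trigSum S d x := by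
      have h1 := h.ftc _ hη t ht
      have h2 := h.ftc _ hη s hs
      have e2 : ∫ x, trigSum S d x * d x
          = (∫ x, f t x * trigSum S d x) - ∫ x, f s x * trigSum S d x := by
        rw [← integral_sub (integrable_mul_L2 (h.memLp t ht) mη)
          (integrable_mul_L2 (h.memLp s hs) mη)]
        congr 1; funext x; simp only [hd]; ring
      have sub : ∀ r ∈ Set.Icc 0 T,
          IntervalIntegrable (fun τ => ∫ x, g τ x * trigSum S d x) volume 0 r := fun r hr =>
        hi.mono_set (by rw [Set.uIcc_of_le hr.1, Set.uIcc_of_le hT]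
                        exact Set.Icc_subset_Icc_right hr.2)
      rw [← intervalIntegral.integral_interval_sub_left (sub t ht) (sub s hs), e2, h1, h2]
      ring
    rw [e1]
    refine (le_abs_self _).trans ?_
    have h3 := intervalIntegral.norm_integral_le_of_norm_le_const_ae (a := s) (b := t)
      (f := fun τ => ∫ x, g τ x * trigSum S d x)
      (C := M * (eLpNorm (trigSum S d) 2 volume).toReal) ?_
    · rw [Real.norm_eq_abs] at h3
      linarith
    · have h4 : ∀ᵐ r : ℝ, r ≠ T := by simp [ae_iff]
      filter_upwards [(ae_restrict_iff' measurableSet_Ioo).1 hMb, h4] with r hr h4 hmem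
      refine abs_integral_mul_le_of_bound hM mη (hr ⟨?_, lt_of_le_of_ne ?_ h4⟩)
      · exact (le_min hs.1 ht.1).trans_lt hmem.1
      · exact hmem.2.trans (max_le hs.2 ht.2)
  have l1 := tendsto_integral_mul_L2 (fun S => memLp_of_continuous
    (isSmooth_trigSum S d).continuous 2) md md (tendsto_trigSum md)
  have l2 := (tendsto_toReal_eLpNorm_trigSum md).const_mul (M * |t - s|)
  have h5 := le_of_tendsto_of_tendsto' l1 l2 key
  have h6 : ∫ x, d x * d x = (eLpNorm d 2 volume).toReal ^ 2 := by
    rw [toReal_eLpNorm_two_sq md]; congr 1; funext x; ring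
  rw [h6, sq] at h5
  rcases (ENNReal.toReal_nonneg (a := eLpNorm d 2 volume)).eq_or_lt with h0 | h0
  · rw [← h0]; positivity
  · exact le_of_mul_le_mul_right h5 h0

/-- At almost every time a curve is weakly differentiable in `L²`. -/
lemma IsCurve.ae_hasDerivAt {T : ℝ} (hT : 0 < T) {f g : ℝ → T3 → ℝ} (h : IsCurve T f g) :
    ∀ᵐ t ∂(volume.restrict (Set.Ioo 0 T)), MemLp (g t) 2 volume ∧
      ∀ η, MemLp η 2 volume → HasDerivAt (fun τ => ∫ x, f τ x * η x) (∫ x, g t x * η x) t := by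
  obtain ⟨M, hM, hMb⟩ := h.bound
  obtain ⟨L, hL, hLip⟩ := h.lipschitz
  have smooth : ∀ η, IsSmooth η → ∀ᵐ t ∂(volume.restrict (Set.Ioo 0 T)),
      HasDerivAt (fun τ => ∫ x, f τ x * η x) (∫ x, g t x * η x) t := by
    intro η hη
    rw [ae_restrict_iff' measurableSet_Ioo]
    filter_upwards [(h.intervalIntegrable hT.le hη).ae_hasDerivAt_integral] with t ht hmem
    have h1 := (ht (by rw [Set.uIcc_of_le hT.le]; exact Set.Ioo_subset_Icc_self hmem) 0
      Set.left_mem_uIcc).const_add (∫ x, f 0 x * η x)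
    refine h1.congr_of_eventuallyEq ?_
    filter_upwards [isOpen_Ioo.mem_nhds hmem] with τ hτ
    exact h.ftc η hη τ (Set.Ioo_subset_Icc_self hτ)
  -- countably many characters leave one null set of times
  have hC : ∀ᵐ t ∂(volume.restrict (Set.Ioo 0 T)), ∀ k : Fin 3 → ℤ,
      HasDerivAt (fun τ => ∫ x, f τ x * trigC k x) (∫ x, g t x * trigC k x) t ∧
      HasDerivAt (fun τ => ∫ x, f τ x * trigS k x) (∫ x, g t x * trigS k x) t :=
    ae_all_iff.2 fun k => (smooth _ (isSmooth_trigC k)).and (smooth _ (isSmooth_trigS k))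
  filter_upwards [hC, hMb, ae_restrict_mem measurableSet_Ioo] with t ht hg hmem
  refine ⟨hg.1, fun η hη => ?_⟩
  have htI : t ∈ Set.Icc 0 T := Set.Ioo_subset_Icc_self hmem
  -- trigonometric polynomials
  have trig : ∀ S, HasDerivAt (fun τ => ∫ x, f τ x * trigSum S η x)
      (∫ x, g t x * trigSum S η x) t := by
    intro S
    have expand : ∀ a : T3 → ℝ, MemLp a 2 volume → ∫ x, a x * trigSum S η x
        = ∑ k ∈ S, ((∫ y, η y * trigC k y) * (∫ x, a x * trigC k x)
          + (∫ y, η y * trigS k y) * ∫ x, a x * trigS k x) := by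
      intro a ha
      have hi := ha.integrable (by norm_num : (1:ℝ≥0∞) ≤ 2)
      have i1 := fun k => (integral_mul_smooth_integrable hi (isSmooth_trigC k).continuous).const_mul
        (∫ y, η y * trigC k y)
      have i2 := fun k => (integral_mul_smooth_integrable hi (isSmooth_trigS k).continuous).const_mul
        (∫ y, η y * trigS k y)
      have i3 : ∀ k ∈ S, Integrable fun x => (∫ y, η y * trigC k y) * (a x * trigC k x)
          + (∫ y, η y * trigS k y) * (a x * trigS k x) := fun k _ => (i1 k).add (i2 k)
      have e1 : (fun x => a x * trigSum S η x) = fun x => ∑ k ∈ S,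
          ((∫ y, η y * trigC k y) * (a x * trigC k x)
            + (∫ y, η y * trigS k y) * (a x * trigS k x)) := by
        funext x
        rw [trigSum, Finset.mul_sum]
        exact Finset.sum_congr rfl fun k _ => by ring
      rw [e1, integral_finsetSum _ i3]
      refine Finset.sum_congr rfl fun k _ => ?_
      rw [integral_add (i1 k) (i2 k), integral_const_mul, integral_const_mul]
    rw [expand _ hg.1]
    have h1 : HasDerivAt (fun τ => ∑ k ∈ S, ((∫ y, η y * trigC k y) * (∫ x, f τ x * trigC k x)
          + (∫ y, η y * trigS k y) * ∫ x, f τ x * trigS k x))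
        (∑ k ∈ S, ((∫ y, η y * trigC k y) * (∫ x, g t x * trigC k x)
          + (∫ y, η y * trigS k y) * ∫ x, g t x * trigS k x)) t :=
      HasDerivAt.fun_sum fun k _ => ((ht k).1.const_mul _).add ((ht k).2.const_mul _)
    refine h1.congr_of_eventuallyEq ?_
    filter_upwards [isOpen_Ioo.mem_nhds hmem] with τ hτ
    exact expand _ (h.memLp τ (Set.Ioo_subset_Icc_self hτ))
  -- approximation of a general test function
  rw [hasDerivAt_iff_isLittleO, Asymptotics.isLittleO_iff]
  intro ε hε
  set δ := ε / (2 * (L + M + 1)) with hδ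
  have hδ0 : 0 < δ := by positivity
  have hsm : ∀ᶠ S in atTop, (eLpNorm (fun x => η x - trigSum S η x) 2 volume).toReal < δ :=
    ((ENNReal.tendsto_toReal ENNReal.zero_ne_top).comp (tendsto_trigSum hη)).eventually
      (Iio_mem_nhds (by simpa using hδ0))
  obtain ⟨S, hS⟩ := hsm.exists
  set e : T3 → ℝ := fun x => η x - trigSum S η x with he
  have mS : MemLp (trigSum S η) 2 volume := memLp_of_continuous (isSmooth_trigSum S η).continuous 2
  have me : MemLp e 2 volume := hη.sub mS
  have h1 := trig S
  rw [hasDerivAt_iff_isLittleO, Asymptotics.isLittleO_iff] at h1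
  filter_upwards [h1 (half_pos hε), isOpen_Ioo.mem_nhds hmem] with τ hτ hτm
  have hτI : τ ∈ Set.Icc 0 T := Set.Ioo_subset_Icc_self hτm
  have split : ∀ a : T3 → ℝ, MemLp a 2 volume →
      ∫ x, a x * η x = (∫ x, a x * trigSum S η x) + ∫ x, a x * e x := fun a ha => by
    rw [← integral_add (integrable_mul_L2 ha mS) (integrable_mul_L2 ha me)]
    congr 1; funext x; simp only [he]; ring
  rw [split _ (h.memLp τ hτI), split _ (h.memLp t htI), split _ hg.1]
  have b1 : |(∫ x, f τ x * e x) - ∫ x, f t x * e x| ≤ L * |τ - t| * δ := by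
    rw [← integral_sub (integrable_mul_L2 (h.memLp τ hτI) me) (integrable_mul_L2 (h.memLp t htI) me)]
    have h2 := abs_integral_mul_le ((h.memLp τ hτI).sub (h.memLp t htI)) me
    calc _ = |∫ x, (f τ x - f t x) * e x| := by congr 2; funext x; ring
      _ ≤ _ := h2
      _ ≤ _ := by
        refine mul_le_mul (hLip t htI τ hτI) hS.le ENNReal.toReal_nonneg (by positivity)
  have b2 : |∫ x, g t x * e x| ≤ M * δ := by
    refine (abs_integral_mul_le_of_bound hM me hg).trans ?_
    gcongr
  rw [Real.norm_eq_abs, smul_eq_mul, Real.norm_eq_abs] at hτ ⊢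
  have b3 : |(τ - t) * ∫ x, g t x * e x| ≤ |τ - t| * (M * δ) := by
    rw [abs_mul]; gcongr
  have b4 : L * |τ - t| * δ + |τ - t| * (M * δ) ≤ ε / 2 * |τ - t| := by
    have : (L + M) * δ ≤ ε / 2 := by
      rw [hδ, mul_div_assoc', div_le_iff₀ (by positivity)]
      nlinarith
    nlinarith [abs_nonneg (τ - t)]
  calc _ = |((∫ x, f τ x * trigSum S η x) - (∫ x, f t x * trigSum S η x)
          - (τ - t) * ∫ x, g t x * trigSum S η x)
        + (((∫ x, f τ x * e x) - ∫ x, f t x * e x) - (τ - t) * ∫ x, g t x * e x)| := by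
        congr 1; ring
    _ ≤ _ := abs_add_le _ _
    _ ≤ ε / 2 * |τ - t| + (L * |τ - t| * δ + |τ - t| * (M * δ)) :=
        add_le_add hτ ((abs_sub _ _).trans (add_le_add b1 b3))
    _ ≤ _ := by linarith

/-! ### Nonlinear functionals along curves -/

/-- A `C²` function has a quadratic Taylor remainder, and is Lipschitz, on a compact convex set. -/
lemma exists_taylor_bound {ι : Type*} [Fintype ι] {G : (ι → ℝ) → ℝ} {K : Set (ι → ℝ)}
    (hK : IsCompact K) (hKc : Convex ℝ K) (hG : ∀ a ∈ K, ContDiffAt ℝ 2 G a) :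
    ∃ C : ℝ, 0 ≤ C ∧ (∀ a ∈ K, ‖fderiv ℝ G a‖ ≤ C) ∧
      (∀ a ∈ K, ∀ b ∈ K, |G b - G a| ≤ C * ‖b - a‖) ∧
      ∀ a ∈ K, ∀ b ∈ K, |G b - G a - fderiv ℝ G a (b - a)| ≤ C * ‖b - a‖ ^ 2 := by
  have h1 : ∀ a ∈ K, ContDiffAt ℝ 1 (fderiv ℝ G) a := fun a ha =>
    (hG a ha).fderiv_right (by norm_num)
  have c1 : ContinuousOn (fderiv ℝ G) K := fun a ha => (h1 a ha).continuousAt.continuousWithinAt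
  have c2 : ContinuousOn (fun a => ‖fderiv ℝ (fderiv ℝ G) a‖) K := fun a ha =>
    ((h1 a ha).fderiv_right (m := 0) (by norm_num)).continuousAt.norm.continuousWithinAt
  obtain ⟨C1, hC1⟩ := hK.exists_bound_of_continuousOn c1
  obtain ⟨C2, hC2'⟩ := hK.bddAbove_image c2
  have hC2 : ∀ x ∈ K, ‖fderiv ℝ (fderiv ℝ G) x‖ ≤ C2 := fun x hx =>
    hC2' (Set.mem_image_of_mem _ hx)
  have lip : ∀ a ∈ K, ∀ b ∈ K, ‖fderiv ℝ G b - fderiv ℝ G a‖ ≤ C2 * ‖b - a‖ :=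
    fun a ha b hb => hKc.norm_image_sub_le_of_norm_hasFDerivWithin_le
      (fun x hx => ((h1 x hx).differentiableAt (by norm_num)).hasFDerivAt.hasFDerivWithinAt)
      hC2 ha hb
  have dG : ∀ a ∈ K, HasFDerivAt G (fderiv ℝ G a) a := fun a ha =>
    ((hG a ha).differentiableAt (by norm_num)).hasFDerivAt
  refine ⟨max (max C1 C2) 0, le_max_right _ _, fun a ha => (hC1 a ha).trans ?_,
    fun a ha b hb => ?_, fun a ha b hb => ?_⟩
  · exact (le_max_left _ _).trans (le_max_left _ _)
  · have := hKc.norm_image_sub_le_of_norm_hasFDerivWithin_le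
      (fun x hx => (dG x hx).hasFDerivWithinAt) hC1 ha hb
    refine this.trans ?_
    gcongr
    exact (le_max_left _ _).trans (le_max_left _ _)
  · have hseg : segment ℝ a b ⊆ K := hKc.segment_subset ha hb
    have hC20 : 0 ≤ C2 := le_trans (by positivity) (hC2 a ha)
    have := (convex_segment a b).norm_image_sub_le_of_norm_hasFDerivWithin_le'
      (φ := fderiv ℝ G a) (C := C2 * ‖b - a‖)
      (fun x hx => (dG x (hseg hx)).hasFDerivWithinAt) (fun x hx => by
        refine (lip a ha x (hseg hx)).trans ?_
        gcongr
        obtain ⟨u, w, hu, hw, huw, rfl⟩ := hx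
        have : u • a + w • b - a = w • (b - a) := by
          have hu' : u = 1 - w := by linarith
          rw [hu']; module
        rw [this, norm_smul, Real.norm_eq_abs, abs_of_nonneg hw]
        exact mul_le_of_le_one_left (norm_nonneg _) (by linarith))
      (left_mem_segment ℝ a b) (right_mem_segment ℝ a b)
    rw [Real.norm_eq_abs] at this
    refine this.trans ?_
    rw [mul_assoc, ← sq]
    gcongr
    exact (le_max_right _ _).trans (le_max_left _ _)

lemma integral_abs_le_eLpNorm_two {d : T3 → ℝ} (md : MemLp d 2 volume) :
    ∫ x, |d x| ≤ (eLpNorm d 2 volume).toReal := by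
  have ma : MemLp (fun x => |d x|) 2 volume := md.abs
  have h1 := abs_integral_mul_le ma (memLp_const (1:ℝ))
  simp only [mul_one] at h1
  have e : eLpNorm (fun x => |d x|) 2 volume = eLpNorm d 2 volume := by
    simp_rw [← Real.norm_eq_abs]; exact eLpNorm_norm _
  have e2 : eLpNorm (fun _ : T3 => (1:ℝ)) 2 volume = 1 := by
    rw [eLpNorm_const _ (by norm_num) (NeZero.ne _)]; simp
  rw [e, e2] at h1
  refine (le_abs_self _).trans (h1.trans ?_)
  simp

lemma pi_norm_le_sum_abs {ι : Type*} [Fintype ι] (a : ι → ℝ) : ‖a‖ ≤ ∑ i, |a i| :=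
  (pi_norm_le_iff_of_nonneg (Finset.sum_nonneg fun i _ => abs_nonneg _)).2 fun i =>
    Finset.single_le_sum (f := fun i => |a i|) (fun _ _ => abs_nonneg _) (Finset.mem_univ i)

lemma pi_norm_sq_le_sum_sq {ι : Type*} [Fintype ι] (a : ι → ℝ) : ‖a‖ ^ 2 ≤ ∑ i, a i ^ 2 := by
  have h1 : ‖a‖ ≤ Real.sqrt (∑ i, a i ^ 2) :=
    (pi_norm_le_iff_of_nonneg (Real.sqrt_nonneg _)).2 fun i => Real.abs_le_sqrt
      (Finset.single_le_sum (f := fun i => a i ^ 2) (fun _ _ => sq_nonneg _) (Finset.mem_univ i))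
  calc ‖a‖ ^ 2 ≤ Real.sqrt (∑ i, a i ^ 2) ^ 2 := by gcongr
    _ = _ := Real.sq_sqrt (Finset.sum_nonneg fun i _ => sq_nonneg _)

/-- The chain rule along curves: `t ↦ ∫ G(f(t,x)) dx` is Lipschitz, and at almost every time its
derivative is given by the formal expression. -/
lemma chain_rule_curve {ι : Type*} [Fintype ι] {T : ℝ} (hT : 0 < T)
    {f g : ι → ℝ → T3 → ℝ} (h : ∀ i, IsCurve T (f i) (g i)) {G : (ι → ℝ) → ℝ} (hGm : Measurable G)
    {K : Set (ι → ℝ)} (hK : IsCompact K) (hKc : Convex ℝ K) (hG : ∀ a ∈ K, ContDiffAt ℝ 2 G a)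
    (hf : ∀ t ∈ Set.Icc 0 T, ∀ᵐ x, (fun i => f i t x) ∈ K) :
    (∃ L, LipschitzOnWith L (fun t => ∫ x, G fun i => f i t x) (Set.Icc 0 T)) ∧
      (∀ t ∈ Set.Icc 0 T, Integrable fun x => G fun i => f i t x) ∧
      ∀ᵐ t ∂(volume.restrict (Set.Ioo 0 T)), HasDerivAt (fun t => ∫ x, G fun i => f i t x)
        (∫ x, fderiv ℝ G (fun i => f i t x) (fun i => g i t x)) t := by
  classical
  obtain ⟨C, hC0, hC1, hC2, hC3⟩ := exists_taylor_bound hK hKc hG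
  obtain ⟨B, hB⟩ := hK.exists_bound_of_continuousOn
    (fun a ha => (hG a ha).continuousAt.continuousWithinAt)
  choose L hL0 hL using fun i => (h i).lipschitz
  have am : ∀ t ∈ Set.Icc 0 T, AEMeasurable (fun x => fun i => f i t x) := fun t ht =>
    aemeasurable_pi_lambda _ fun i => ((h i).memLp t ht).1.aemeasurable
  have intG : ∀ t ∈ Set.Icc 0 T, Integrable fun x => G fun i => f i t x := fun t ht =>
    Integrable.of_bound (hGm.comp_aemeasurable (am t ht)).aestronglyMeasurable B
      ((hf t ht).mono fun x hx => hB _ hx)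
  have l1 : ∀ (i : ι) (s t), s ∈ Set.Icc 0 T → t ∈ Set.Icc 0 T →
      ∫ x, |f i t x - f i s x| ≤ L i * |t - s| := by
    intro i s t hs ht
    have md : MemLp (fun x => f i t x - f i s x) 2 volume :=
      ((h i).memLp t ht).sub ((h i).memLp s hs)
    exact (integral_abs_le_eLpNorm_two md).trans (hL i s hs t ht)
  have l2 : ∀ (i : ι) (s t), s ∈ Set.Icc 0 T → t ∈ Set.Icc 0 T →
      ∫ x, (f i t x - f i s x) ^ 2 ≤ (L i * |t - s|) ^ 2 := by
    intro i s t hs ht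
    have md : MemLp (fun x => f i t x - f i s x) 2 volume :=
      ((h i).memLp t ht).sub ((h i).memLp s hs)
    rw [← toReal_eLpNorm_two_sq md]
    exact pow_le_pow_left₀ ENNReal.toReal_nonneg (hL i s hs t ht) 2
  refine ⟨⟨Real.toNNReal (C * ∑ i, L i), ?_⟩, intG, ?_⟩
  · refine LipschitzOnWith.of_dist_le_mul fun t ht s hs => ?_
    have hnn : 0 ≤ C * ∑ i, L i := mul_nonneg hC0 (Finset.sum_nonneg fun i _ => hL0 i)
    rw [Real.dist_eq, Real.dist_eq, Real.coe_toNNReal _ hnn, ← integral_sub (intG t ht) (intG s hs)]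
    have i1 : ∀ i, Integrable fun x => |f i t x - f i s x| := fun i =>
      ((((h i).memLp t ht).sub ((h i).memLp s hs)).integrable (by norm_num)).abs
    have i2 : Integrable fun x => C * ∑ i, |f i t x - f i s x| :=
      (integrable_finsetSum _ fun i _ => i1 i).const_mul C
    calc |∫ x, ((G fun i => f i t x) - G fun i => f i s x)|
        ≤ ∫ x, C * ∑ i, |f i t x - f i s x| := by
          rw [← Real.norm_eq_abs]
          refine norm_integral_le_of_norm_le i2 ?_
          filter_upwards [hf t ht, hf s hs] with x hx hx'
          refine (hC2 _ hx' _ hx).trans ?_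
          gcongr
          exact pi_norm_le_sum_abs _
      _ = C * ∑ i, ∫ x, |f i t x - f i s x| := by
          rw [integral_const_mul, integral_finsetSum _ fun i _ => i1 i]
      _ ≤ C * ∑ i, L i * |t - s| := by
          gcongr with i
          exact l1 i s t hs ht
      _ = _ := by rw [← Finset.sum_mul]; ring
  · have hall : ∀ᵐ t ∂(volume.restrict (Set.Ioo 0 T)), ∀ i, MemLp (g i t) 2 volume ∧
        ∀ η, MemLp η 2 volume →
          HasDerivAt (fun τ => ∫ x, f i τ x * η x) (∫ x, g i t x * η x) t :=
      ae_all_iff.2 fun i => (h i).ae_hasDerivAt hT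
    filter_upwards [hall, ae_restrict_mem measurableSet_Ioo] with t ht hmem
    have htI : t ∈ Set.Icc 0 T := Set.Ioo_subset_Icc_self hmem
    -- the linear part of Taylor's formula at time `t` pairs `f i τ` with functions independent of `τ`
    set η : ι → T3 → ℝ := fun i x => fderiv ℝ G (fun i => f i t x) (Pi.single i 1) with hη
    have mη : ∀ i, MemLp (η i) 2 volume := fun i => by
      refine MemLp.of_bound ((measurable_fderiv_apply_const ℝ G (Pi.single i 1)).comp_aemeasurable
        (am t htI)).aestronglyMeasurable C ((hf t htI).mono fun x hx => ?_)
      refine ((fderiv ℝ G _).le_opNorm _).trans ?_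
      rw [Pi.norm_single, norm_one, mul_one]
      exact hC1 _ hx
    have lin : ∀ (x : T3) (b : ι → ℝ), fderiv ℝ G (fun i => f i t x) b = ∑ i, b i * η i x := by
      intro x b
      conv_lhs => rw [pi_eq_sum_univ' b]
      rw [map_sum]
      refine Finset.sum_congr rfl fun i _ => ?_
      simp only [hη]
      rw [← smul_eq_mul, ← map_smul]
    have i3 : ∀ i, Integrable fun x => g i t x * η i x := fun i =>
      integrable_mul_L2 (ht i).1 (mη i)
    have e1 : ∫ x, fderiv ℝ G (fun i => f i t x) (fun i => g i t x)
        = 0 + ∑ i, ∫ x, g i t x * η i x := by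
      simp only [lin]
      rw [integral_finsetSum _ fun i _ => i3 i, zero_add]
    rw [e1]
    have d1 : HasDerivAt (fun τ => ∑ i, ∫ x, f i τ x * η i x) (∑ i, ∫ x, g i t x * η i x) t :=
      HasDerivAt.fun_sum fun i _ => (ht i).2 _ (mη i)
    -- the Taylor remainder is quadratic in time
    have d2 : HasDerivAt (fun τ => (∫ x, G fun i => f i τ x) - ∑ i, ∫ x, f i τ x * η i x) 0 t := by
      have hb : ∀ τ ∈ Set.Icc 0 T, |((∫ x, G fun i => f i τ x) - ∑ i, ∫ x, f i τ x * η i x)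
          - ((∫ x, G fun i => f i t x) - ∑ i, ∫ x, f i t x * η i x)|
          ≤ (C * ∑ i, L i ^ 2) * |τ - t| ^ 2 := by
        intro τ hτ
        have j1 := fun i => integrable_mul_L2 ((h i).memLp τ hτ) (mη i)
        have j2 := fun i => integrable_mul_L2 ((h i).memLp t htI) (mη i)
        have j3 : ∀ i, Integrable fun x => (f i τ x - f i t x) ^ 2 := fun i =>
          (((h i).memLp τ hτ).sub ((h i).memLp t htI)).integrable_sq
        have e2 : ((∫ x, G fun i => f i τ x) - ∑ i, ∫ x, f i τ x * η i x)
            - ((∫ x, G fun i => f i t x) - ∑ i, ∫ x, f i t x * η i x)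
            = ∫ x, (((G fun i => f i τ x) - (∑ i, f i τ x * η i x))
              - ((G fun i => f i t x) - ∑ i, f i t x * η i x)) := by
          have k1 : Integrable fun x => ∑ i, f i τ x * η i x :=
            integrable_finsetSum _ fun i _ => j1 i
          have k2 : Integrable fun x => ∑ i, f i t x * η i x :=
            integrable_finsetSum _ fun i _ => j2 i
          have k3 : Integrable fun x => (G fun i => f i τ x) - ∑ i, f i τ x * η i x :=
            (intG τ hτ).sub k1
          have k4 : Integrable fun x => (G fun i => f i t x) - ∑ i, f i t x * η i x :=
            (intG t htI).sub k2
          rw [integral_sub k3 k4, integral_sub (intG τ hτ) k1, integral_sub (intG t htI) k2,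
            integral_finsetSum _ fun i _ => j1 i, integral_finsetSum _ fun i _ => j2 i]
        rw [e2]
        have j4 : Integrable fun x => C * ∑ i, (f i τ x - f i t x) ^ 2 :=
          (integrable_finsetSum _ fun i _ => j3 i).const_mul C
        calc _ ≤ ∫ x, C * ∑ i, (f i τ x - f i t x) ^ 2 := by
              rw [← Real.norm_eq_abs]
              refine norm_integral_le_of_norm_le j4 ?_
              filter_upwards [hf τ hτ, hf t htI] with x hx hx'
              have h5 := hC3 _ hx' _ hx
              rw [lin] at h5
              rw [Real.norm_eq_abs]
              refine le_trans (le_of_eq ?_) (h5.trans ?_)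
              · congr 1
                simp only [Pi.sub_apply, sub_mul, Finset.sum_sub_distrib]
                ring
              · gcongr
                exact pi_norm_sq_le_sum_sq _
          _ = C * ∑ i, ∫ x, (f i τ x - f i t x) ^ 2 := by
              rw [integral_const_mul, integral_finsetSum _ fun i _ => j3 i]
          _ ≤ C * ∑ i, (L i * |τ - t|) ^ 2 := by
              gcongr with i
              exact l2 i t τ htI hτ
          _ = _ := by simp only [mul_pow, ← Finset.sum_mul]; ring
      rw [hasDerivAt_iff_isLittleO]
      simp only [smul_zero, sub_zero]
      have hO : (fun τ => ((∫ x, G fun i => f i τ x) - ∑ i, ∫ x, f i τ x * η i x)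
          - ((∫ x, G fun i => f i t x) - ∑ i, ∫ x, f i t x * η i x))
          =O[𝓝 t] fun τ => (τ - t) ^ 2 := by
        refine Asymptotics.IsBigO.of_bound (C * ∑ i, L i ^ 2) ?_
        filter_upwards [isOpen_Ioo.mem_nhds hmem] with τ hτ
        rw [Real.norm_eq_abs, norm_pow, Real.norm_eq_abs]
        exact hb τ (Set.Ioo_subset_Icc_self hτ)
      refine hO.trans_isLittleO ?_
      have := Asymptotics.isLittleO_pow_pow (𝕜 := ℝ) (show 1 < 2 by norm_num)
      have ht0 : Tendsto (fun τ : ℝ => τ - t) (𝓝 t) (𝓝 0) := by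
        have h7 : Continuous fun τ : ℝ => τ - t := by fun_prop
        have h8 := h7.tendsto t
        rwa [sub_self] at h8
      simpa [Function.comp_def] using this.comp_tendsto ht0
    refine (d2.add d1).congr_of_eventuallyEq (Eventually.of_forall fun τ => ?_)
    simp

/-- A Lipschitz function with nonpositive derivative almost everywhere does not exceed its initial
value. -/
lemma le_of_ae_deriv_nonpos {T : ℝ} {f : ℝ → ℝ} (hf : AbsolutelyContinuousOnInterval f 0 T)
    (hd : ∀ᵐ t ∂(volume.restrict (Set.Ioo 0 T)), ∃ d ≤ 0, HasDerivAt f d t) :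
    ∀ t ∈ Set.Icc 0 T, f t ≤ f 0 := by
  intro t ht
  have hT : 0 ≤ T := ht.1.trans ht.2
  have h1 := (hf.mono (c := 0) (d := t) (by
    rw [Set.uIcc_of_le ht.1, Set.uIcc_of_le hT]
    exact Set.Icc_subset_Icc_right ht.2)).integral_deriv_eq_sub
  have h2 : ∫ x in 0..t, deriv f x ≤ 0 := by
    rw [intervalIntegral.integral_of_le ht.1, integral_Ioc_eq_integral_Ioo]
    refine integral_nonpos_of_ae ?_
    filter_upwards [ae_mono (Measure.restrict_mono (Set.Ioo_subset_Ioo_right ht.2) le_rfl) hd]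
      with s hs
    obtain ⟨d, hd0, hd1⟩ := hs
    rw [hd1.deriv]; exact hd0
  linarith

/-! ### Identities at a fixed time -/

lemma IsSmooth.partialD_comm {φ : T3 → ℝ} (h : IsSmooth φ) (i j : Fin 3) (x : T3) :
    NSK.partialD j (NSK.partialD i φ) x = NSK.partialD i (NSK.partialD j φ) x := by
  obtain ⟨y, rfl⟩ := toT3_surjective x
  have key : ∀ i j, NSK.partialD j (NSK.partialD i φ) (toT3 y)
      = fderiv ℝ (fderiv ℝ (fun y => φ (toT3 y))) y (Pi.single j 1) (Pi.single i 1) := by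
    intro i j
    rw [(h.partialD i).partialD_lift j y]
    have e : (fun y => NSK.partialD i φ (toT3 y))
        = fun y => fderiv ℝ (fun y => φ (toT3 y)) y (Pi.single i 1) :=
      funext fun y => h.partialD_lift i y
    have hd : DifferentiableAt ℝ (fderiv ℝ (fun y => φ (toT3 y))) y :=
      (ContDiff.fderiv_right (m := ∞) h (by simp)).differentiable (by simp) y
    rw [e, fderiv_clm_apply hd (differentiableAt_const _)]
    simp
  rw [key, key]
  have hs : IsSymmSndFDerivAt ℝ (fun y => φ (toT3 y)) y :=
    (ContDiff.contDiffAt h).isSymmSndFDerivAt (by simp; exact WithTop.coe_le_coe.2 le_top)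
  exact hs _ _

/-- Derivatives may be exchanged between the factors of `∫ ∂_i f ∂_j h`. -/
lemma nullInt_swap {i j : Fin 3} {f g g' h k k' : T3 → ℝ} (hf : HasL2Partial i f g)
    (hf' : HasL2Partial j f g') (hh : HasL2Partial i h k) (hh' : HasL2Partial j h k') :
    NullInt fun x => g x * k' x - g' x * k x := by
  have i1 := integrable_mul_L2 hf.memLp' hh'.memLp'
  have i2 := integrable_mul_L2 hf'.memLp' hh.memLp'
  refine ⟨i1.sub i2, ?_⟩
  rw [integral_sub i1 i2, sub_eq_zero]
  have ms : ∀ {a : T3 → ℝ} S, MemLp (trigSum S a) 2 volume := fun S =>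
    memLp_of_continuous (isSmooth_trigSum S _).continuous 2
  have l1 := tendsto_integral_mul_L2 (fun S => ms (a := g) S) hf.memLp' hh'.memLp'
    (tendsto_trigSum hf.memLp')
  have l2 := tendsto_integral_mul_L2 (fun S => ms (a := g') S) hf'.memLp' hh.memLp'
    (tendsto_trigSum hf'.memLp')
  refine tendsto_nhds_unique l1 (l2.congr fun S => ?_)
  have sm := isSmooth_trigSum S f
  have e : ∀ x, trigSum S g x = partialD i (trigSum S f) x := fun x =>
    (partialD_trigSum S hf.weak x).symm
  have e' : ∀ x, trigSum S g' x = partialD j (trigSum S f) x := fun x =>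
    (partialD_trigSum S hf'.weak x).symm
  have h1 := hh'.weak.2.2 _ (sm.partialD i)
  have h2 := hh.weak.2.2 _ (sm.partialD j)
  simp only [e, e', mul_comm (partialD _ _ _)]
  rw [← neg_inj, ← h1, ← h2]
  congr 1; funext x
  rw [sm.partialD_comm]

/-- Weak second derivatives commute. -/
lemma ae_eq_second_partial {i j : Fin 3} {f g g' k k' : T3 → ℝ} (hf : HasL2Partial i f g)
    (hf' : HasL2Partial j f g') (hk : HasL2Partial j g k) (hk' : HasL2Partial i g' k') :
    k =ᵐ[volume] k' := by
  refine HasWeakPartial.unique hk.weak ⟨hk.weak.1, hk'.weak.2.1, fun φ hφ => ?_⟩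
  have h1 := (nullInt_swap hf hf' (hasL2Partial_of_isSmooth hφ i) (hasL2Partial_of_isSmooth hφ j)).2
  rw [integral_sub (integrable_mul_L2 hf.memLp' (hasL2Partial_of_isSmooth hφ j).memLp')
    (integrable_mul_L2 hf'.memLp' (hasL2Partial_of_isSmooth hφ i).memLp')] at h1
  rw [← hk'.weak.2.2 φ hφ]
  linarith

lemma essBdd_of_abs_le {f : T3 → ℝ} (hf : AEStronglyMeasurable f) {B : ℝ}
    (h : ∀ᵐ x, |f x| ≤ B) : EssBdd f := MemLp.of_bound hf B h

lemma essBdd_comp {f : T3 → ℝ} (hf : AEStronglyMeasurable f) {a b : ℝ}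
    (hr : ∀ᵐ x, f x ∈ Set.Icc a b) {F : ℝ → ℝ} (hm : Measurable F)
    (hF : ContinuousOn F (Set.Icc a b)) : EssBdd fun x => F (f x) := by
  obtain ⟨B, hB⟩ := isCompact_Icc.exists_bound_of_continuousOn hF
  exact essBdd_of_abs_le (hm.comp_aemeasurable hf.aemeasurable).aestronglyMeasurable
    (hr.mono fun x hx => hB _ hx)

lemma EssBdd.mul {f g : T3 → ℝ} (hf : EssBdd f) (hg : EssBdd g) : EssBdd fun x => f x * g x :=
  EssBdd.mul_memLp hf hg

lemma EssBdd.mul_integrable {f g : T3 → ℝ} (hf : EssBdd f) (hg : Integrable g) :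
    Integrable fun x => f x * g x :=
  memLp_one_iff_integrable.1 (hf.mul_memLp (memLp_one_iff_integrable.2 hg))

lemma EssBdd.integrable {f : T3 → ℝ} (hf : EssBdd f) : Integrable f :=
  memLp_one_iff_integrable.1 (MemLp.mono_exponent hf le_top)

/-- Functions with the same integral up to a null-integral correction. -/
lemma integral_eq_of_nullInt {f g n : T3 → ℝ} (hg : Integrable g) (hn : NullInt n)
    (h : ∀ᵐ x, f x = g x + n x) : Integrable f ∧ ∫ x, f x = ∫ x, g x := by
  refine ⟨(hg.add hn.1).congr (h.mono fun x hx => hx.symm), ?_⟩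
  rw [integral_congr_ae h, integral_add hg hn.1, hn.2, add_zero]

lemma NullInt.neg {h : T3 → ℝ} (hh : NullInt h) : NullInt fun x => - h x := by
  simpa using hh.const_mul (-1)

lemma NullInt.sub {h k : T3 → ℝ} (hh : NullInt h) (hk : NullInt k) :
    NullInt fun x => h x - k x := by
  simpa [sub_eq_add_neg] using hh.add hk.neg

/-- The state of a strong solution at one instant: density `ρ` and its time derivative `s`, the
components of the effective velocity `v` and its time derivative `a`, with their weak space
derivatives, where `dv i j = ∂_j v_i` and `ddv i j k = ∂_k ∂_j v_i`, subject to the two equations of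
the system. -/
structure Slice (γ : ℝ) where
  ρ : T3 → ℝ
  s : T3 → ℝ
  v : Fin 3 → T3 → ℝ
  a : Fin 3 → T3 → ℝ
  dρ : Fin 3 → T3 → ℝ
  ds : Fin 3 → T3 → ℝ
  ddρ : Fin 3 → Fin 3 → T3 → ℝ
  dv : Fin 3 → Fin 3 → T3 → ℝ
  ddv : Fin 3 → Fin 3 → Fin 3 → T3 → ℝ
  range_ρ : ∃ c C, 0 < c ∧ ∀ᵐ x, ρ x ∈ Set.Icc c C
  range_v : ∃ B, 0 ≤ B ∧ ∀ i, ∀ᵐ x, |v i x| ≤ B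
  range_dρ : ∃ B, ∀ i, ∀ᵐ x, |dρ i x| ≤ B
  grad_ρ : HasGrad ρ dρ
  grad_s : HasGrad s ds
  grad_dρ : ∀ i, HasGrad (dρ i) (ddρ i)
  grad_v : ∀ i, HasGrad (v i) (dv i)
  grad_dv : ∀ i j, HasGrad (dv i j) (ddv i j)
  mass : ∀ᵐ x, s x = - ∑ j, (ρ x * dv j j x + dρ j x * v j x - ddρ j j x)
  momentum : ∀ i, ∀ᵐ x, ρ x * a i x = (∑ j, (ρ x * ddv i j j x + dρ j x * dv i j x))
    - (∑ j, (ρ x * v j x - dρ j x) * dv i j x) - γ * ρ x ^ (γ - 1) * dρ i x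

namespace Slice

variable {γ : ℝ} (S : Slice γ)

lemma comp_ρ {F F' : ℝ → ℝ} (hF : ∀ x, 0 < x → HasDerivAt F (F' x) x)
    (hF' : ContinuousOn F' (Set.Ioi 0)) (j : Fin 3) :
    HasL2Partial j (fun x => F (S.ρ x)) (fun x => F' (S.ρ x) * S.dρ j x) := by
  obtain ⟨c, C, hc, hr⟩ := S.range_ρ
  obtain ⟨x, hx⟩ := hr.exists
  exact (S.grad_ρ j).comp_Icc (hx.1.trans hx.2) hr (fun x hx => hF x (hc.trans_le hx.1))
    (hF'.mono fun x hx => hc.trans_le hx.1)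

lemma essBdd_comp_ρ {F : ℝ → ℝ} (hm : Measurable F) (hF : ContinuousOn F (Set.Ioi 0)) :
    EssBdd fun x => F (S.ρ x) := by
  obtain ⟨c, C, hc, hr⟩ := S.range_ρ
  exact essBdd_comp (S.grad_ρ 0).memLp.1 hr hm (hF.mono fun x hx => hc.trans_le hx.1)

lemma essBdd_ρ : EssBdd S.ρ := S.essBdd_comp_ρ measurable_id continuousOn_id

lemma essBdd_rpow (p : ℝ) : EssBdd fun x => S.ρ x ^ p :=
  S.essBdd_comp_ρ (F := fun x => x ^ p) (measurable_id.pow_const p)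
    (continuousOn_id.rpow_const fun _ hx => Or.inl (ne_of_gt hx))

lemma ρ_pos : ∀ᵐ x, 0 < S.ρ x := by
  obtain ⟨c, C, hc, hr⟩ := S.range_ρ
  exact hr.mono fun x hx => hc.trans_le hx.1

lemma comp_v {F F' : ℝ → ℝ} (hF : ∀ x, HasDerivAt F (F' x) x) (hF' : Continuous F')
    (i j : Fin 3) :
    HasL2Partial j (fun x => F (S.v i x)) (fun x => F' (S.v i x) * S.dv i j x) := by
  obtain ⟨B, hB, hr⟩ := S.range_v
  exact (S.grad_v i j).comp_Icc (a := -B) (b := B) (by linarith)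
    ((hr i).mono fun x hx => abs_le.1 hx) (fun x _ => hF x) hF'.continuousOn

lemma essBdd_comp_v {F : ℝ → ℝ} (hF : Continuous F) (i : Fin 3) :
    EssBdd fun x => F (S.v i x) := by
  obtain ⟨B, hB, hr⟩ := S.range_v
  exact essBdd_comp (S.grad_v i 0).memLp.1 (a := -B) (b := B) ((hr i).mono fun x hx => abs_le.1 hx)
    hF.measurable hF.continuousOn

lemma essBdd_v (i : Fin 3) : EssBdd (S.v i) := S.essBdd_comp_v continuous_id i

lemma essBdd_dρ (i : Fin 3) : EssBdd (S.dρ i) := by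
  obtain ⟨B, hr⟩ := S.range_dρ
  exact essBdd_of_abs_le (S.grad_dρ i 0).memLp.1 (hr i)

lemma rpow_ρ (p : ℝ) (j : Fin 3) :
    HasL2Partial j (fun x => S.ρ x ^ p) (fun x => p * S.ρ x ^ (p - 1) * S.dρ j x) :=
  S.comp_ρ (F := fun x => x ^ p) (F' := fun x => p * x ^ (p - 1))
    (fun _ hx => Real.hasDerivAt_rpow_const (Or.inl hx.ne'))
    (continuousOn_const.mul (continuousOn_id.rpow_const fun _ hx => Or.inl (ne_of_gt hx))) j

/-- The components of the momentum `ρ u = ρ v - ∇ρ`. -/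
def m (i : Fin 3) (x : T3) : ℝ := S.ρ x * S.v i x - S.dρ i x

/-- The derivatives of the momentum `ρ u`. -/
def dm (i j : Fin 3) (x : T3) : ℝ := S.ρ x * S.dv i j x + S.dρ j x * S.v i x - S.ddρ i j x

lemma grad_m (i : Fin 3) : HasGrad (S.m i) (S.dm i) := fun j =>
  ((S.grad_ρ j).mul_of_lip (S.grad_v i j) S.essBdd_ρ (S.essBdd_dρ j)).sub (S.grad_dρ i j)

lemma flux (i j : Fin 3) : HasL2Partial j (fun x => S.ρ x * S.dv i j x)
    (fun x => S.ρ x * S.ddv i j j x + S.dρ j x * S.dv i j x) :=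
  (S.grad_ρ j).mul_of_lip (S.grad_dv i j j) S.essBdd_ρ (S.essBdd_dρ j)

lemma integrable_mul_dv_sq {b : T3 → ℝ} (hb : EssBdd b) (i j : Fin 3) :
    Integrable fun x => b x * S.dv i j x ^ 2 :=
  hb.mul_integrable (S.grad_v i j).memLp'.integrable_sq

lemma integrable_mul_dv {b : T3 → ℝ} (hb : EssBdd b) (i j : Fin 3) :
    Integrable fun x => b x * S.dv i j x :=
  hb.mul_integrable ((S.grad_v i j).memLp'.integrable (by norm_num))

lemma integrable_mul_dρ_sq {b : T3 → ℝ} (hb : EssBdd b) (i : Fin 3) :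
    Integrable fun x => b x * S.dρ i x ^ 2 :=
  hb.mul_integrable (S.grad_ρ i).memLp'.integrable_sq

/-- The evolution of `∫ ρ F(v_i)`. -/
lemma integral_velocity (i : Fin 3) {F F' F'' : ℝ → ℝ} (hF : ∀ x, HasDerivAt F (F' x) x)
    (hF' : ∀ x, HasDerivAt F' (F'' x) x) (hF'' : Continuous F'') :
    ∫ x, (S.s x * F (S.v i x) + S.ρ x * F' (S.v i x) * S.a i x)
      = ∫ x, (-(∑ j, S.ρ x * F'' (S.v i x) * S.dv i j x ^ 2)
        + S.ρ x ^ γ * F'' (S.v i x) * S.dv i i x) := by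
  have cF' : Continuous F' := continuous_iff_continuousAt.2 fun x => (hF' x).continuousAt
  have i1 : Integrable fun x => (-(∑ j, S.ρ x * F'' (S.v i x) * S.dv i j x ^ 2)
        + S.ρ x ^ γ * F'' (S.v i x) * S.dv i i x) :=
    (integrable_finsetSum _ fun j _ => S.integrable_mul_dv_sq
      (S.essBdd_ρ.mul (S.essBdd_comp_v hF'' i)) i j).neg.add
      (S.integrable_mul_dv ((S.essBdd_rpow γ).mul (S.essBdd_comp_v hF'' i)) i i)
  -- integration by parts in the mass flux, the viscous flux and the pressure
  have n1 := NullInt.sum Finset.univ fun j _ => (S.grad_m j j).nullInt (S.comp_v hF cF' i j)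
  have n2 := NullInt.sum Finset.univ fun j _ => (S.comp_v hF' hF'' i j).nullInt (S.flux i j)
  have n3 := (S.comp_v hF' hF'' i i).nullInt (S.rpow_ρ γ i)
  refine (integral_eq_of_nullInt i1 ((n2.sub n1).sub n3) ?_).2
  filter_upwards [S.mass, S.momentum i] with x hx hm
  have e1 : S.ρ x * F' (S.v i x) * S.a i x = F' (S.v i x) * (S.ρ x * S.a i x) := by ring
  rw [e1, hm, hx]
  simp only [Fin.sum_univ_three, m, dm]
  ring

/-- The evolution of `∫ G(ρ)`. -/
lemma integral_density {G' G'' : ℝ → ℝ} (hG : ∀ x, 0 < x → HasDerivAt G' (G'' x) x)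
    (hG'' : ContinuousOn G'' (Set.Ioi 0)) (hm : Measurable G'') :
    ∫ x, G' (S.ρ x) * S.s x
      = ∫ x, (-(∑ j, G'' (S.ρ x) * S.dρ j x ^ 2)
        + ∑ j, G'' (S.ρ x) * S.ρ x * S.v j x * S.dρ j x) := by
  have b := S.essBdd_comp_ρ hm hG''
  have i1 : Integrable fun x => (-(∑ j, G'' (S.ρ x) * S.dρ j x ^ 2)
        + ∑ j, G'' (S.ρ x) * S.ρ x * S.v j x * S.dρ j x) :=
    (integrable_finsetSum _ fun j _ => S.integrable_mul_dρ_sq b j).neg.add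
      (integrable_finsetSum _ fun j _ => ((((b.mul S.essBdd_ρ).mul (S.essBdd_v j)).mul
        (S.essBdd_dρ j))).integrable)
  have n1 := NullInt.sum Finset.univ fun j _ => (S.grad_m j j).nullInt (S.comp_ρ hG hG'' j)
  refine (integral_eq_of_nullInt i1 n1.neg ?_).2
  filter_upwards [S.mass] with x hx
  rw [hx]
  simp only [Fin.sum_univ_three, m, dm]
  ring

end Slice

/-- The pointwise algebra behind the energy balance: with `w = ∇ log ρ`, `u = v - w`,
`A = ∇v`, `B = ∇w`, all terms of the balance are divergences except for
`-½ ρ |∇u + ∇uᵀ|²`. Here `p = γ ρ^{γ-1}/(γ-1)`, `r = γ ρ^{γ-2}`. -/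
lemma energy_algebra (ρ s p r : ℝ) (v w a ds : Fin 3 → ℝ) (A B C : Fin 3 → Fin 3 → ℝ)
    (hB : ∀ i j, B i j = B j i)
    (hs : s = -∑ j, (ρ * A j j + ρ * w j * v j - ρ * (B j j + w j * w j)))
    (ha : ∀ i, ρ * a i = (∑ j, (ρ * C i j + ρ * w j * A i j))
      - (∑ j, (ρ * v j - ρ * w j) * A i j) - ρ * r * (ρ * w i)) :
    s * (1 / 2 * (∑ i, v i ^ 2) - (∑ i, w i ^ 2) + p) + (∑ i, (ρ * v i - ρ * w i) * a i)
      + ∑ i, ds i * (2 * w i - v i)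
    = -(1 / 2 * ρ * ∑ i, ∑ j, ((A i j - B i j) + (A j i - B j i)) ^ 2)
      + (-(∑ i, ∑ j, 1 / 2 * ((ρ * v j - ρ * w j) * (v i * A i j + A i j * v i)
            + (ρ * A j j + ρ * w j * v j - ρ * (B j j + w j * w j)) * (v i * v i)))
        + (∑ i, ∑ j, ((ρ * v j - ρ * w j) * (w i * B i j + B i j * w i)
            + (ρ * A j j + ρ * w j * v j - ρ * (B j j + w j * w j)) * (w i * w i)))
        - (∑ j, ((ρ * v j - ρ * w j) * (r * (ρ * w j))
            + (ρ * A j j + ρ * w j * v j - ρ * (B j j + w j * w j)) * p))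
        - (∑ i, ∑ j, ((ρ * A i i + ρ * w i * v i - ρ * (B i i + w i * w i)) * (A j j - 2 * B j j)
            - (ρ * A i j + ρ * w j * v i - ρ * (B i j + w i * w j)) * (A j i - 2 * B j i)))
        + (∑ i, ∑ j, ((v i - w i) * (ρ * C i j + ρ * w j * A i j)
            + (A i j - B i j) * (ρ * A i j)))
        - ∑ j, (s * (A j j - 2 * B j j) + ds j * (v j - 2 * w j))) := by
  have e : ∀ i, (ρ * v i - ρ * w i) * a i = (v i - w i) * (ρ * a i) := fun i => by ring
  simp only [e, ha]
  rw [hs]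
  have h1 := hB 1 0
  have h2 := hB 2 0
  have h3 := hB 2 1
  simp only [Fin.sum_univ_three, h1, h2, h3]
  ring

namespace Slice

variable {γ : ℝ} (S : Slice γ)

/-- The components of `w = ∇ log ρ`. -/
def w (i : Fin 3) (x : T3) : ℝ := S.dρ i x * (S.ρ x)⁻¹

/-- The derivatives `dw i j = ∂_j w_i`. -/
def dw (i j : Fin 3) (x : T3) : ℝ :=
  S.dρ i x * (-(S.ρ x ^ 2)⁻¹ * S.dρ j x) + S.ddρ i j x * (S.ρ x)⁻¹

lemma essBdd_inv : EssBdd fun x => (S.ρ x)⁻¹ :=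
  S.essBdd_comp_ρ (F := fun x => x⁻¹) measurable_inv
    (continuousOn_id.inv₀ fun _ hx => ne_of_gt hx)

lemma essBdd_w (i : Fin 3) : EssBdd (S.w i) := (S.essBdd_dρ i).mul S.essBdd_inv

lemma grad_w (i : Fin 3) : HasGrad (S.w i) (S.dw i) := fun j =>
  (S.grad_dρ i j).mul_of_bdd (S.comp_ρ (F := fun x => x⁻¹) (F' := fun x => -(x ^ 2)⁻¹)
    (fun _ hx => hasDerivAt_inv hx.ne')
    ((continuousOn_id.pow 2).inv₀ fun _ hx => pow_ne_zero _ (ne_of_gt hx)).neg j)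
    (S.essBdd_dρ i) S.essBdd_inv

lemma ddρ_symm : ∀ᵐ x, ∀ i j, S.ddρ i j x = S.ddρ j i x :=
  ae_all_iff.2 fun i => ae_all_iff.2 fun j =>
    ae_eq_second_partial (S.grad_ρ i) (S.grad_ρ j) (S.grad_dρ i j) (S.grad_dρ j i)

/-- The energy `∫ (ρ|u|²/2 + ρ^γ/(γ-1) + |∇ρ|²/(2ρ))` dissipates. -/
lemma integral_energy_nonpos (hγ : 1 < γ) :
    ∫ x, (S.s x * (1 / 2 * (∑ i, S.v i x ^ 2) - (∑ i, S.w i x ^ 2)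
        + γ / (γ - 1) * S.ρ x ^ (γ - 1))
      + (∑ i, (S.ρ x * S.v i x - S.dρ i x) * S.a i x)
      + ∑ i, S.ds i x * (2 * S.w i x - S.v i x)) ≤ 0 := by
  have du : ∀ i j, HasL2Partial j (fun x => S.v i x - S.w i x)
      (fun x => S.dv i j x - S.dw i j x) := fun i j => (S.grad_v i j).sub (S.grad_w i j)
  have dz : ∀ i j, HasL2Partial j (fun x => S.v i x - 2 * S.w i x)
      (fun x => S.dv i j x - 2 * S.dw i j x) := fun i j =>
    (S.grad_v i j).sub ((S.grad_w i j).const_mul 2)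
  have i1 : Integrable fun x => -(1 / 2 * S.ρ x * ∑ i, ∑ j, ((S.dv i j x - S.dw i j x)
      + (S.dv j i x - S.dw j i x)) ^ 2) := by
    have b : EssBdd fun x => 1 / 2 * S.ρ x := MemLp.const_mul S.essBdd_ρ (1 / 2)
    refine (b.mul_integrable
      (integrable_finsetSum _ fun i _ => integrable_finsetSum _ fun j _ => ?_)).neg
    exact ((du i j).memLp'.add (du j i).memLp').integrable_sq
  -- the divergences of `energy_algebra`, in order
  have n1 := NullInt.sum Finset.univ fun i _ => NullInt.sum Finset.univ fun j _ =>
    ((S.grad_m j j).nullInt ((S.grad_v i j).mul_of_bdd (S.grad_v i j) (S.essBdd_v i)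
      (S.essBdd_v i))).const_mul (1 / 2)
  have n2 := NullInt.sum Finset.univ fun i _ => NullInt.sum Finset.univ fun j _ =>
    (S.grad_m j j).nullInt ((S.grad_w i j).mul_of_bdd (S.grad_w i j) (S.essBdd_w i)
      (S.essBdd_w i))
  have n3 := NullInt.sum Finset.univ fun j _ =>
    (S.grad_m j j).nullInt ((S.rpow_ρ (γ - 1) j).const_mul (γ / (γ - 1)))
  have n4 := NullInt.sum Finset.univ fun i _ => NullInt.sum Finset.univ fun j _ =>
    nullInt_swap (S.grad_m i i) (S.grad_m i j) (dz j i) (dz j j)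
  have n5 := NullInt.sum Finset.univ fun i _ => NullInt.sum Finset.univ fun j _ =>
    (du i j).nullInt (S.flux i j)
  have n6 := NullInt.sum Finset.univ fun j _ => (S.grad_s j).nullInt (dz j j)
  have hN := ((((n1.neg.add n2).sub n3).sub n4).add n5).sub n6
  rw [(integral_eq_of_nullInt i1 hN ?_).2]
  · refine integral_nonpos_of_ae ?_
    filter_upwards [S.ρ_pos] with x hx
    have : 0 ≤ ∑ i, ∑ j, ((S.dv i j x - S.dw i j x) + (S.dv j i x - S.dw j i x)) ^ 2 :=
      Finset.sum_nonneg fun i _ => Finset.sum_nonneg fun j _ => sq_nonneg _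
    have h2 : 0 ≤ 1 / 2 * S.ρ x := by positivity
    simpa using mul_nonneg h2 this
  · filter_upwards [S.mass, ae_all_iff.2 S.momentum, S.ddρ_symm, S.ρ_pos] with x hs ha hd hρ
    have hw : ∀ i, S.dρ i x = S.ρ x * S.w i x := fun i => by
      rw [w]; field_simp
    have hdd : ∀ i j, S.ddρ i j x = S.ρ x * (S.dw i j x + S.w i x * S.w j x) := fun i j => by
      rw [dw, w, w]; field_simp; ring
    have hB : ∀ i j, S.dw i j x = S.dw j i x := fun i j => by
      rw [dw, dw, hd i j]; ring
    have hp : γ * S.ρ x ^ (γ - 1) = S.ρ x * (γ * S.ρ x ^ (γ - 2)) := by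
      have : S.ρ x ^ (γ - 1) = S.ρ x * S.ρ x ^ (γ - 2) := by
        rw [show γ - 1 = 1 + (γ - 2) by ring, Real.rpow_add hρ, Real.rpow_one]
      rw [this]; ring
    have hr' : ∀ j, γ / (γ - 1) * ((γ - 1) * S.ρ x ^ (γ - 1 - 1) * S.dρ j x)
        = γ * S.ρ x ^ (γ - 2) * S.dρ j x := fun j => by
      have : γ - 1 ≠ 0 := by linarith
      rw [show γ - 1 - 1 = γ - 2 by ring]; field_simp
    have key := energy_algebra (S.ρ x) (S.s x) (γ / (γ - 1) * S.ρ x ^ (γ - 1))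
      (γ * S.ρ x ^ (γ - 2)) (fun i => S.v i x) (fun i => S.w i x) (fun i => S.a i x)
      (fun i => S.ds i x) (fun i j => S.dv i j x) (fun i j => S.dw i j x)
      (fun i j => S.ddv i j j x) hB (by simpa only [hw, hdd] using hs)
      (fun i => by
        have := ha i
        rw [hp] at this
        simpa only [hw] using this)
    simp only [hr', m, dm, hdd]
    simp only [hw]
    exact key

end Slice

/-! ### Strong solutions as curves of slices -/

/-- `S` is the state at time `t` of the solution `(ρ, v)` with time derivatives `(ρt, vt)`. -/
structure Slice.IsAt {γ : ℝ} (S : Slice γ) (ρ ρt : ℝ → T3 → ℝ) (v vt : Fin 3 → ℝ → T3 → ℝ)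
    (t : ℝ) : Prop where
  ρ_eq : S.ρ = ρ t
  s_eq : S.s = ρt t
  v_eq : S.v = fun i => v i t
  a_eq : S.a = fun i => vt i t
  dρ_eq : S.dρ = fun i => weakPartial i (ρ t)
  ds_eq : S.ds = fun i => weakPartial i (ρt t)

/-- A strong solution on the closed time interval `[0, T]`, in the form used for the a priori
estimates: the density, the velocity components and the density gradient are Lipschitz curves in
`L²` with uniform pointwise bounds, and almost every time gives a slice. -/
structure Evolution (γ T : ℝ) (ρ ρt : ℝ → T3 → ℝ) (v vt : Fin 3 → ℝ → T3 → ℝ) : Prop where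
  pos : 0 < T
  curve_ρ : IsCurve T ρ ρt
  curve_v : ∀ i, IsCurve T (v i) (vt i)
  curve_dρ : ∀ i, IsCurve T (fun t => weakPartial i (ρ t)) (fun t => weakPartial i (ρt t))
  range_ρ : ∃ c C, 0 < c ∧ ∀ t ∈ Set.Icc 0 T, ∀ᵐ x, ρ t x ∈ Set.Icc c C
  range_v : ∃ B, 0 ≤ B ∧ ∀ t ∈ Set.Icc 0 T, ∀ i, ∀ᵐ x, |v i t x| ≤ B
  range_dρ : ∃ B, 0 ≤ B ∧ ∀ t ∈ Set.Icc 0 T, ∀ i, ∀ᵐ x, |weakPartial i (ρ t) x| ≤ B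
  grad_ρ : ∀ t ∈ Set.Icc 0 T, HasGrad (ρ t) fun i => weakPartial i (ρ t)
  slice : ∀ᵐ t ∂(volume.restrict (Set.Ioo 0 T)), ∃ S : Slice γ, S.IsAt ρ ρt v vt t

section strong

variable {γ Tstar : ℝ} {ρ ρt : ℝ → T3 → ℝ} {v vt : ℝ → T3 → E3}

lemma IsStrongSolutionWith.range_ρ (h : IsStrongSolutionWith γ Tstar ρ ρt v vt) {T : ℝ}
    (hT : 0 < T) (hT' : T < Tstar) :
    ∃ c C, 0 < c ∧ ∀ t ∈ Set.Icc 0 T, ∀ᵐ x, ρ t x ∈ Set.Icc c C := by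
  obtain ⟨c, hc, h1⟩ := h.positive T hT hT'
  obtain ⟨C, _, h2⟩ := h.ρ_cont.mono.exists_ae_bound hT'
  refine ⟨c, C, hc, fun t ht => ?_⟩
  filter_upwards [h1 t ht, h2 t ht] with x hx hx'
  exact ⟨hx, (le_abs_self _).trans hx'⟩

lemma IsStrongSolutionWith.range_v (h : IsStrongSolutionWith γ Tstar ρ ρt v vt) {T : ℝ}
    (hT' : T < Tstar) :
    ∃ B, 0 ≤ B ∧ ∀ t ∈ Set.Icc 0 T, ∀ i, ∀ᵐ x, |v t x i| ≤ B := by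
  choose B hB h1 using fun i => (h.v_cont i).exists_ae_bound hT'
  refine ⟨∑ i, B i, Finset.sum_nonneg fun i _ => hB i, fun t ht i => ?_⟩
  filter_upwards [h1 i t ht] with x hx
  exact hx.trans (Finset.single_le_sum (f := B) (fun i _ => hB i) (Finset.mem_univ i))

/-- At almost every time a strong solution satisfies the expanded equations, with its spatial
derivatives, almost everywhere on the torus. -/
lemma IsStrongSolutionWith.ae_slice (h : IsStrongSolutionWith γ Tstar ρ ρt v vt) {T : ℝ}
    (hT : 0 < T) (hT' : T < Tstar) :
    ∀ᵐ t ∂(volume.restrict (Set.Ioo 0 T)), ∃ S : Slice γ,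
      S.IsAt ρ ρt (fun i t x => v t x i) (fun i t x => vt t x i) t := by
  obtain ⟨c, C, hc, hr⟩ := h.range_ρ hT hT'
  obtain ⟨B, hB, hv⟩ := h.range_v hT'
  obtain ⟨B', hB', hd⟩ := h.ρ_cont.exists_ae_bound_partial hT'
  have hsub : ∀ {P : ℝ → Prop}, (∀ᵐ t ∂(volume.restrict (Set.Ioo 0 Tstar)), P t) →
      ∀ᵐ t ∂(volume.restrict (Set.Ioo 0 T)), P t := fun hP =>
    ae_mono (Measure.restrict_mono (Set.Ioo_subset_Ioo_right hT'.le) le_rfl) hP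
  filter_upwards [hsub h.mass, hsub h.momentum, ae_restrict_mem measurableSet_Ioo]
    with t hmass hmom ht
  have htI : t ∈ Set.Icc 0 T := Set.Ioo_subset_Icc_self ht
  have htS : t ∈ Set.Ico 0 Tstar := ⟨htI.1, htI.2.trans_lt hT'⟩
  have hρ3 := h.ρ_cont.memH htS
  have hv2 := fun i => (h.v_cont i).memH htS
  have gρ := hρ3.hasGrad
  have gv := fun i => (hv2 i).hasGrad
  have gdv := fun i j => ((hv2 i).partial j).hasGrad
  obtain ⟨x0, hx0⟩ := (hr t htI).exists
  have hcC : c ≤ C := hx0.1.trans hx0.2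
  -- the product and chain rules turn the equations into pointwise ones
  have e1 : ∀ᵐ x, ∀ j, weakPartial j (fun y => ρ t y * v t y j) x
      = ρ t x * weakPartial j (fun y => v t y j) x + weakPartial j (ρ t) x * v t x j :=
    ae_all_iff.2 fun j => ((gρ j).mul_weak (gv j j)).weakPartial_eq
  have e2 : ∀ᵐ x, ∀ j, weakPartial j (fun y => Real.log (ρ t y)) x
      = (ρ t x)⁻¹ * weakPartial j (ρ t) x :=
    ae_all_iff.2 fun j => ((gρ j).comp_Icc (F := Real.log) (F' := fun x => x⁻¹) hcC (hr t htI)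
      (fun x hx => Real.hasDerivAt_log (hc.trans_le hx.1).ne')
      (continuousOn_id.inv₀ fun x hx => (hc.trans_le hx.1).ne')).weak.weakPartial_eq
  have e3 : ∀ᵐ x, ∀ j, weakPartial j (fun y => ρ t y ^ γ) x
      = (γ * ρ t x ^ (γ - 1)) * weakPartial j (ρ t) x :=
    ae_all_iff.2 fun j => ((gρ j).comp_Icc (F := fun x => x ^ γ)
      (F' := fun x => γ * x ^ (γ - 1)) hcC (hr t htI)
      (fun x hx => Real.hasDerivAt_rpow_const (Or.inl (hc.trans_le hx.1).ne'))
      (continuousOn_const.mul (continuousOn_id.rpow_const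
        fun x hx => Or.inl (hc.trans_le hx.1).ne'))).weak.weakPartial_eq
  have e4 : ∀ᵐ x, ∀ i j, weakPartial j (fun y => ρ t y * weakPartial j (fun z => v t z i) y) x
      = ρ t x * weakPartial j (weakPartial j (fun z => v t z i)) x
        + weakPartial j (ρ t) x * weakPartial j (fun z => v t z i) x :=
    ae_all_iff.2 fun i => ae_all_iff.2 fun j => ((gρ j).mul_weak (gdv i j j)).weakPartial_eq
  refine ⟨⟨ρ t, ρt t, fun i x => v t x i, fun i x => vt t x i, fun i => weakPartial i (ρ t),
    fun i => weakPartial i (ρt t), fun i j => weakPartial j (weakPartial i (ρ t)),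
    fun i j => weakPartial j (fun x => v t x i),
    fun i j k => weakPartial k (weakPartial j (fun x => v t x i)), ⟨c, C, hc, hr t htI⟩,
    ⟨B, hB, hv t htI⟩, ⟨B', hd t htI⟩, gρ, (h.ρt_cont.memH htS).hasGrad,
    fun i => (hρ3.partial i).hasGrad, gv, gdv, ?_, fun i => ?_⟩, ⟨rfl, rfl, rfl, rfl, rfl, rfl⟩⟩
  · filter_upwards [hmass, e1] with x hx h1
    simp only [h1] at hx
    rw [Finset.sum_sub_distrib]
    linarith
  · filter_upwards [hmom, e2, e3, e4, hr t htI] with x hx h2 h3 h4 hρx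
    have h5 := hx i
    simp only [h2, h3, h4] at h5
    have hne : ρ t x ≠ 0 := (hc.trans_le hρx.1).ne'
    have e5 : ρ t x * ∑ j, (v t x j - (ρ t x)⁻¹ * weakPartial j (ρ t) x)
        * weakPartial j (fun y => v t y i) x
        = ∑ j, (ρ t x * v t x j - weakPartial j (ρ t) x) * weakPartial j (fun y => v t y i) x := by
      rw [Finset.mul_sum]
      refine Finset.sum_congr rfl fun j _ => ?_
      field_simp
    rw [e5] at h5
    linarith

lemma IsStrongSolutionWith.evolution (h : IsStrongSolutionWith γ Tstar ρ ρt v vt) {T : ℝ}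
    (hT : 0 < T) (hT' : T < Tstar) :
    Evolution γ T ρ ρt (fun i t x => v t x i) (fun i t x => vt t x i) := by
  have hI : ∀ t ∈ Set.Icc 0 T, t ∈ Set.Ico 0 Tstar := fun t ht => ⟨ht.1, ht.2.trans_lt hT'⟩
  have cρ : IsCurve T ρ ρt := isCurve_of_hasWeakTimeDeriv hT hT' h.ρ_cont h.meas_ρt
    h.ρt_cont.memLinftyL2 h.ρ_deriv
  refine ⟨hT, cρ, fun i => isCurve_of_hasWeakTimeDeriv hT hT' (h.v_cont i) (h.meas_vt i)
    (h.vt_Linfty i) (h.v_deriv i), fun i => ?_, h.range_ρ hT hT', h.range_v hT',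
    h.ρ_cont.exists_ae_bound_partial hT', fun t ht => (h.ρ_cont.memH (hI t ht)).hasGrad,
    h.ae_slice hT hT'⟩
  refine cρ.partial i (fun t ht => (h.ρ_cont.memH (hI t ht)).hasGrad i) ?_
  obtain ⟨M, hM, hb⟩ := h.ρt_cont.exists_bound hT'
  refine ⟨(1 + M).toReal, ENNReal.toReal_nonneg, ?_⟩
  filter_upwards [ae_restrict_mem measurableSet_Ioo] with t ht
  have htI : t ∈ Set.Icc 0 T := Set.Ioo_subset_Icc_self ht
  refine ⟨(h.ρt_cont.memH (hI t htI)).hasGrad i, ?_⟩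
  rw [ENNReal.ofReal_toReal (by finiteness)]
  exact (ennreal_le_one_add_sq _).trans
    (add_le_add le_rfl ((sobolevSq_partial_le 0 _ i).trans (hb t htI)))

end strong

/-! ### Evolution of integral functionals -/

lemma fderiv_eq_of_hasDerivAt_line {ι : Type*} [Fintype ι] {G : (ι → ℝ) → ℝ} {a b : ι → ℝ} {D : ℝ}
    (hG : ContDiffAt ℝ 2 G a) (h : HasDerivAt (fun r : ℝ => G (a + r • b)) D 0) :
    fderiv ℝ G a b = D :=
  HasLineDerivAt.unique ((hG.differentiableAt (by norm_num)).hasFDerivAt.hasLineDerivAt b) h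

lemma contDiffOn_two_of_hasDerivAt {F F' F'' : ℝ → ℝ} {s : Set ℝ} (hs : IsOpen s)
    (hF : ∀ x ∈ s, HasDerivAt F (F' x) x) (hF' : ∀ x ∈ s, HasDerivAt F' (F'' x) x)
    (hF'' : ContinuousOn F'' s) : ContDiffOn ℝ 2 F s := by
  have one : ContDiffOn ℝ 1 F' s := by
    rw [show (1 : WithTop ℕ∞) = 0 + 1 by norm_num, contDiffOn_succ_iff_deriv_of_isOpen hs]
    refine ⟨fun x hx => (hF' x hx).differentiableAt.differentiableWithinAt, by simp, ?_⟩
    rw [contDiffOn_zero]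
    exact hF''.congr fun x hx => (hF' x hx).deriv
  rw [show (2 : WithTop ℕ∞) = 1 + 1 by norm_num, contDiffOn_succ_iff_deriv_of_isOpen hs]
  refine ⟨fun x hx => (hF x hx).differentiableAt.differentiableWithinAt, by simp, ?_⟩
  exact one.congr fun x hx => (hF x hx).deriv

namespace Evolution

variable {γ T : ℝ} {ρ ρt : ℝ → T3 → ℝ} {v vt : Fin 3 → ℝ → T3 → ℝ}

/-- The functional `∫ ρ F(v_i)` along a solution. -/
lemma velocity (h : Evolution γ T ρ ρt v vt) (i : Fin 3) {F F' F'' : ℝ → ℝ}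
    (hF : ∀ x, HasDerivAt F (F' x) x) (hF' : ∀ x, HasDerivAt F' (F'' x) x)
    (hF'' : Continuous F'') :
    (∃ L, LipschitzOnWith L (fun t => ∫ x, ρ t x * F (v i t x)) (Set.Icc 0 T)) ∧
    (∀ t ∈ Set.Icc 0 T, Integrable fun x => ρ t x * F (v i t x)) ∧
    ∀ᵐ t ∂(volume.restrict (Set.Ioo 0 T)), ∀ S : Slice γ, S.IsAt ρ ρt v vt t →
      HasDerivAt (fun t => ∫ x, ρ t x * F (v i t x))
        (∫ x, (-(∑ j, S.ρ x * F'' (S.v i x) * S.dv i j x ^ 2)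
          + S.ρ x ^ γ * F'' (S.v i x) * S.dv i i x)) t := by
  obtain ⟨c, C, hc, hr⟩ := h.range_ρ
  obtain ⟨B, hB, hv⟩ := h.range_v
  have cF : Continuous F := continuous_iff_continuousAt.2 fun x => (hF x).continuousAt
  have cd : ContDiff ℝ 2 F := contDiffOn_univ.1 (contDiffOn_two_of_hasDerivAt isOpen_univ
    (fun x _ => hF x) (fun x _ => hF' x) hF''.continuousOn)
  set G : (Fin 2 → ℝ) → ℝ := fun a => a 0 * F (a 1) with hG
  have cG : ContDiff ℝ 2 G := (contDiff_apply ℝ ℝ 0).mul (cd.comp (contDiff_apply ℝ ℝ 1))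
  have key := chain_rule_curve h.pos (f := ![ρ, v i]) (g := ![ρt, vt i])
    (fun k => by fin_cases k; exacts [h.curve_ρ, h.curve_v i]) (G := G) cG.continuous.measurable
    (K := Set.Icc ![c, -B] ![C, B]) isCompact_Icc (convex_Icc _ _) (fun a _ => cG.contDiffAt)
    (fun t ht => by
      filter_upwards [hr t ht, hv t ht i] with x hx hx'
      rw [abs_le] at hx'
      refine ⟨fun k => ?_, fun k => ?_⟩
      · fin_cases k; exacts [hx.1, hx'.1]
      · fin_cases k; exacts [hx.2, hx'.2])
  obtain ⟨k1, k2, k3⟩ := key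
  simp only [hG, Matrix.cons_val_zero, Matrix.cons_val_one] at k1 k2 k3
  refine ⟨k1, k2, ?_⟩
  filter_upwards [k3] with t hd S hS
  obtain ⟨e1, e2, e3, e4, -, -⟩ := hS
  refine hd.congr_deriv ?_
  rw [← S.integral_velocity i hF hF' hF'', e1, e2, e3, e4]
  congr 1; funext x
  refine fderiv_eq_of_hasDerivAt_line cG.contDiffAt ?_
  have d0 : HasDerivAt (fun r : ℝ => ρ t x + r * ρt t x) (ρt t x) 0 := by
    simpa using ((hasDerivAt_id (0:ℝ)).mul_const (ρt t x)).const_add (ρ t x)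
  have d1 : HasDerivAt (fun r : ℝ => v i t x + r * vt i t x) (vt i t x) 0 := by
    simpa using ((hasDerivAt_id (0:ℝ)).mul_const (vt i t x)).const_add (v i t x)
  have hF0 : HasDerivAt F (F' (v i t x)) (v i t x + 0 * vt i t x) := by
    simpa using hF (v i t x)
  have := d0.mul (hF0.comp (0:ℝ) d1)
  simp only [Pi.add_apply, Pi.smul_apply, smul_eq_mul, Matrix.cons_val_zero,
    Matrix.cons_val_one]
  refine this.congr_deriv ?_
  simp
  ring

/-- The functional `∫ G(ρ)` along a solution. -/
lemma density (h : Evolution γ T ρ ρt v vt) {G G' G'' : ℝ → ℝ}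
    (hG : ∀ x, 0 < x → HasDerivAt G (G' x) x) (hG' : ∀ x, 0 < x → HasDerivAt G' (G'' x) x)
    (hG'' : ContinuousOn G'' (Set.Ioi 0)) (mG : Measurable G) (mG'' : Measurable G'') :
    (∃ L, LipschitzOnWith L (fun t => ∫ x, G (ρ t x)) (Set.Icc 0 T)) ∧
    (∀ t ∈ Set.Icc 0 T, Integrable fun x => G (ρ t x)) ∧
    ∀ᵐ t ∂(volume.restrict (Set.Ioo 0 T)), ∀ S : Slice γ, S.IsAt ρ ρt v vt t →
      HasDerivAt (fun t => ∫ x, G (ρ t x))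
        (∫ x, (-(∑ j, G'' (S.ρ x) * S.dρ j x ^ 2)
          + ∑ j, G'' (S.ρ x) * S.ρ x * S.v j x * S.dρ j x)) t := by
  obtain ⟨c, C, hc, hr⟩ := h.range_ρ
  have cd : ContDiffOn ℝ 2 G (Set.Ioi 0) := contDiffOn_two_of_hasDerivAt isOpen_Ioi
    (fun x hx => hG x hx) (fun x hx => hG' x hx) hG''
  set H : (Fin 1 → ℝ) → ℝ := fun a => G (a 0) with hH
  have cH : ∀ a : Fin 1 → ℝ, 0 < a 0 → ContDiffAt ℝ 2 H a := fun a ha =>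
    (cd.contDiffAt (isOpen_Ioi.mem_nhds ha)).comp a (contDiff_apply ℝ ℝ 0).contDiffAt
  have key := chain_rule_curve h.pos (f := fun _ => ρ) (g := fun _ => ρt)
    (fun k => h.curve_ρ) (G := H) (mG.comp (measurable_pi_apply 0))
    (K := Set.Icc (fun _ => c) (fun _ => C)) isCompact_Icc (convex_Icc _ _)
    (fun a ha => cH a (hc.trans_le (ha.1 0)))
    (fun t ht => by
      filter_upwards [hr t ht] with x hx
      exact ⟨fun k => hx.1, fun k => hx.2⟩)
  obtain ⟨k1, k2, k3⟩ := key
  refine ⟨k1, k2, ?_⟩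
  filter_upwards [k3, ae_restrict_mem measurableSet_Ioo] with t hd ht S hS
  obtain ⟨e1, e2, e3, -, -, -⟩ := hS
  refine hd.congr_deriv ?_
  rw [← S.integral_density hG' hG'' mG'', e1, e2]
  refine integral_congr_ae ?_
  filter_upwards [hr t (Set.Ioo_subset_Icc_self ht)] with x hx
  have hx0 : 0 < ρ t x := hc.trans_le hx.1
  refine fderiv_eq_of_hasDerivAt_line (cH _ hx0) ?_
  have d0 : HasDerivAt (fun r : ℝ => ρ t x + r * ρt t x) (ρt t x) 0 := by
    simpa using ((hasDerivAt_id (0:ℝ)).mul_const (ρt t x)).const_add (ρ t x)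
  have hF0 : HasDerivAt G (G' (ρ t x)) (ρ t x + 0 * ρt t x) := by
    simpa using hG (ρ t x) hx0
  exact hF0.comp (0:ℝ) d0

end Evolution

/-! ### The energy estimate -/

/-- The density `ρ|u|²/2 + |∇ρ|²/(2ρ) + ρ^γ/(γ-1)` of the energy, with `u = v - ∇ρ/ρ` eliminated,
as a function of `ρ`, `v` and `d = ∇ρ`. -/
def energyDensity (γ r : ℝ) (v d : Fin 3 → ℝ) : ℝ :=
  1 / 2 * r * (∑ i, v i ^ 2) - (∑ i, v i * d i) + (∑ i, d i ^ 2) * r⁻¹ + 1 / (γ - 1) * r ^ γ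

lemma energyDensity_eq {γ r : ℝ} (hr : 0 < r) (v d : Fin 3 → ℝ) :
    energyDensity γ r v d = 1 / 2 * r * (∑ i, (v i - r⁻¹ * d i) ^ 2)
      + 1 / 2 * ((∑ i, d i ^ 2) * r⁻¹) + 1 / (γ - 1) * r ^ γ := by
  unfold energyDensity
  simp only [Fin.sum_univ_three]
  field_simp
  ring

lemma hasDerivAt_add_mul (a b : ℝ) : HasDerivAt (fun r : ℝ => a + r * b) b 0 := by
  simpa using ((hasDerivAt_id (0:ℝ)).mul_const b).const_add a

lemma hasDerivAt_energyDensity {γ r : ℝ} (hr : 0 < r) (s : ℝ) (v a d e : Fin 3 → ℝ) :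
    HasDerivAt (fun τ : ℝ => energyDensity γ (r + τ * s) (fun i => v i + τ * a i)
      (fun i => d i + τ * e i))
      (1 / 2 * s * (∑ i, v i ^ 2) + r * (∑ i, v i * a i) - (∑ i, (v i * e i + a i * d i))
        + (2 * (∑ i, d i * e i) * r⁻¹ - (∑ i, d i ^ 2) * (s * (r ^ 2)⁻¹))
        + 1 / (γ - 1) * (γ * r ^ (γ - 1) * s)) 0 := by
  have hρ := hasDerivAt_add_mul r s
  have hv := fun i => hasDerivAt_add_mul (v i) (a i)
  have hd := fun i => hasDerivAt_add_mul (d i) (e i)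
  have h1 := (hρ.const_mul (1 / 2)).mul (HasDerivAt.fun_sum fun i (_ : i ∈ Finset.univ) =>
    (hv i).pow 2)
  have h2 := HasDerivAt.fun_sum fun i (_ : i ∈ Finset.univ) => (hv i).mul (hd i)
  have h3 := (HasDerivAt.fun_sum fun i (_ : i ∈ Finset.univ) => (hd i).pow 2).mul
    (hρ.inv (by simpa using hr.ne'))
  have h4 := (hρ.rpow_const (p := γ) (Or.inl (by simpa using hr.ne'))).const_mul (1 / (γ - 1))
  refine (((h1.sub h2).add h3).add h4).congr_deriv ?_
  simp [Fin.sum_univ_three]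
  field_simp
  ring

namespace Evolution

variable {γ T : ℝ} {ρ ρt : ℝ → T3 → ℝ} {v vt : Fin 3 → ℝ → T3 → ℝ}

/-- The energy stays finite and does not exceed its initial value. -/
lemma antitone_energy (h : Evolution γ T ρ ρt v vt) (hγ : 1 < γ) :
    ∀ t ∈ Set.Icc 0 T,
      (Integrable fun x => energyDensity γ (ρ t x) (fun i => v i t x)
        fun i => weakPartial i (ρ t) x) ∧
      ∫ x, energyDensity γ (ρ t x) (fun i => v i t x) (fun i => weakPartial i (ρ t) x)
        ≤ ∫ x, energyDensity γ (ρ 0 x) (fun i => v i 0 x) (fun i => weakPartial i (ρ 0) x) := by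
  obtain ⟨c, C, hc, hr⟩ := h.range_ρ
  obtain ⟨B, hB, hv⟩ := h.range_v
  obtain ⟨B', hB', hd⟩ := h.range_dρ
  set G : (Unit ⊕ Fin 3 ⊕ Fin 3 → ℝ) → ℝ := fun a => energyDensity γ (a (Sum.inl ()))
    (fun i => a (Sum.inr (Sum.inl i))) (fun i => a (Sum.inr (Sum.inr i))) with hG
  have ca : ∀ k (a : Unit ⊕ Fin 3 ⊕ Fin 3 → ℝ),
      ContDiffAt ℝ 2 (fun a : Unit ⊕ Fin 3 ⊕ Fin 3 → ℝ => a k) a := fun k a =>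
    (contDiff_apply ℝ ℝ k).contDiffAt
  have cG : ∀ a : Unit ⊕ Fin 3 ⊕ Fin 3 → ℝ, 0 < a (Sum.inl ()) → ContDiffAt ℝ 2 G a := by
    intro a ha
    refine ContDiffAt.add (ContDiffAt.add (ContDiffAt.sub ?_ ?_) ?_) ?_
    · exact (contDiffAt_const.mul (ca _ a)).mul (ContDiffAt.sum fun i _ => (ca _ a).pow 2)
    · exact ContDiffAt.sum fun i _ => (ca _ a).mul (ca _ a)
    · exact (ContDiffAt.sum fun i _ => (ca _ a).pow 2).mul ((ca _ a).inv ha.ne')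
    · exact contDiffAt_const.mul ((ca _ a).rpow_const_of_ne ha.ne')
  have mG : Measurable G := by
    simp only [hG, energyDensity]
    fun_prop
  have key := chain_rule_curve h.pos
    (f := Sum.elim (fun _ => ρ) (Sum.elim v fun i t => weakPartial i (ρ t)))
    (g := Sum.elim (fun _ => ρt) (Sum.elim vt fun i t => weakPartial i (ρt t)))
    (fun k => by
      rcases k with _ | i | i
      exacts [h.curve_ρ, h.curve_v i, h.curve_dρ i]) (G := G) mG
    (K := Set.Icc (Sum.elim (fun _ => c) (Sum.elim (fun _ => -B) fun _ => -B'))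
      (Sum.elim (fun _ => C) (Sum.elim (fun _ => B) fun _ => B'))) isCompact_Icc (convex_Icc _ _)
    (fun a ha => cG a (hc.trans_le (ha.1 (Sum.inl ()))))
    (fun t ht => by
      filter_upwards [hr t ht, ae_all_iff.2 (hv t ht), ae_all_iff.2 (hd t ht)] with x h1 h2 h3
      refine ⟨fun k => ?_, fun k => ?_⟩
      · rcases k with _ | i | i
        exacts [h1.1, (abs_le.1 (h2 i)).1, (abs_le.1 (h3 i)).1]
      · rcases k with _ | i | i
        exacts [h1.2, (abs_le.1 (h2 i)).2, (abs_le.1 (h3 i)).2])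
  obtain ⟨⟨L, k1⟩, k2, k3⟩ := key
  simp only [hG, Sum.elim_inl, Sum.elim_inr] at k1 k2
  refine fun t ht => ⟨k2 t ht, ?_⟩
  refine le_of_ae_deriv_nonpos (T := T) (f := fun t => ∫ x, energyDensity γ (ρ t x)
    (fun i => v i t x) (fun i => weakPartial i (ρ t) x)) ?_ ?_ t ht
  · exact (by rwa [Set.uIcc_of_le h.pos.le] : LipschitzOnWith L _ (Set.uIcc 0 T)).absolutelyContinuousOnInterval
  filter_upwards [k3, h.slice, ae_restrict_mem measurableSet_Ioo] with t hd hS ht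
  obtain ⟨S, e1, e2, e3, e4, e5, e6⟩ := hS
  refine ⟨_, ?_, hd⟩
  refine le_trans (le_of_eq (integral_congr_ae ?_)) (S.integral_energy_nonpos hγ)
  filter_upwards [hr t (Set.Ioo_subset_Icc_self ht)] with x hx
  have hx0 : 0 < ρ t x := hc.trans_le hx.1
  have h5 := hasDerivAt_energyDensity (γ := γ) hx0 (ρt t x) (fun i => v i t x)
    (fun i => vt i t x) (fun i => weakPartial i (ρ t) x) (fun i => weakPartial i (ρt t) x)
  refine (fderiv_eq_of_hasDerivAt_line (cG _ hx0) h5).trans ?_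
  simp only [Slice.w, e1, e2, e3, e4, e5, e6, Fin.sum_univ_three]
  have : γ - 1 ≠ 0 := by linarith
  field_simp
  ring

end Evolution

/-- The energy of the data in terms of the effective velocity. -/
lemma energy_eq {γ Tstar : ℝ} {ρ ρt : ℝ → T3 → ℝ} {v vt u : ℝ → T3 → E3}
    (h : IsStrongSolutionWith γ Tstar ρ ρt v vt) (hTs : 0 < Tstar)
    (hu : IsEffectiveVelocity Tstar ρ u v) :
    energy γ (ρ 0) (u 0) = ∫ x, energyDensity γ (ρ 0 x) (fun i => v 0 x i)
      (fun i => weakPartial i (ρ 0) x) := by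
  have h0 : (0:ℝ) ∈ Set.Icc 0 (Tstar / 2) := ⟨le_rfl, by linarith⟩
  have h0' : (0:ℝ) ∈ Set.Ico 0 Tstar := ⟨le_rfl, hTs⟩
  obtain ⟨c, C, hc, hr⟩ := h.range_ρ (T := Tstar / 2) (by linarith) (by linarith)
  have gρ := (h.ρ_cont.memH h0').hasGrad
  obtain ⟨x0, hx0⟩ := (hr 0 h0).exists
  have hcC : c ≤ C := hx0.1.trans hx0.2
  have e2 : ∀ᵐ x, ∀ j, weakPartial j (fun y => Real.log (ρ 0 y)) x
      = (ρ 0 x)⁻¹ * weakPartial j (ρ 0) x :=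
    ae_all_iff.2 fun j => ((gρ j).comp_Icc (F := Real.log) (F' := fun x => x⁻¹) hcC (hr 0 h0)
      (fun x hx => Real.hasDerivAt_log (hc.trans_le hx.1).ne')
      (continuousOn_id.inv₀ fun x hx => (hc.trans_le hx.1).ne')).weak.weakPartial_eq
  have e3 : ∀ᵐ x, ∀ j, weakPartial j (fun y => Real.sqrt (ρ 0 y)) x
      = (1 / (2 * Real.sqrt (ρ 0 x))) * weakPartial j (ρ 0) x :=
    ae_all_iff.2 fun j => ((gρ j).comp_Icc (F := Real.sqrt)
      (F' := fun x => 1 / (2 * Real.sqrt x)) hcC (hr 0 h0)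
      (fun x hx => Real.hasDerivAt_sqrt (hc.trans_le hx.1).ne')
      (continuousOn_const.div (continuousOn_const.mul Real.continuous_sqrt.continuousOn)
        fun x hx => by
          have := Real.sqrt_pos.2 (hc.trans_le hx.1)
          positivity)).weak.weakPartial_eq
  refine integral_congr_ae ?_
  filter_upwards [e2, e3, hr 0 h0, hu 0 h0'] with x h2 h3 hx hux
  have hρ : 0 < ρ 0 x := hc.trans_le hx.1
  have hs := Real.sqrt_pos.2 hρ
  have hss : Real.sqrt (ρ 0 x) ^ 2 = ρ 0 x := Real.sq_sqrt hρ.le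
  have hui : ∀ i, u 0 x i = v 0 x i - (ρ 0 x)⁻¹ * weakPartial i (ρ 0) x := fun i => by
    have := congrArg (fun z : E3 => z i) hux
    simp only [PiLp.add_apply, weakGrad, h2] at this
    linarith
  rw [energyDensity_eq hρ, EuclideanSpace.norm_sq_eq, EuclideanSpace.norm_sq_eq]
  simp only [Real.norm_eq_abs, sq_abs, hui, weakGrad, h3, mul_pow, div_pow, hss, one_pow]
  rw [← Finset.mul_sum]
  field_simp
  ring

namespace Evolution

variable {γ T : ℝ} {ρ ρt : ℝ → T3 → ℝ} {v vt : Fin 3 → ℝ → T3 → ℝ}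

/-- Consequences of the energy estimate: bounds for `∫ ρ^γ` and, through the Sobolev inequality
for `√ρ`, for `∫ ρ³`. -/
lemma energy_bounds (h : Evolution γ T ρ ρt v vt) (hγ : 1 < γ) {E : ℝ}
    (hE : ∫ x, energyDensity γ (ρ 0 x) (fun i => v i 0 x) (fun i => weakPartial i (ρ 0) x) = E) :
    0 ≤ E ∧ ∀ t ∈ Set.Icc 0 T, ∫ x, ρ t x ^ γ ≤ (γ - 1) * E ∧ ∫ x, ρ t x ≤ 1 + (γ - 1) * E ∧
      ∫ x, ρ t x ^ (3:ℝ) ≤ (49 * (1 + γ * E)) ^ 3 := by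
  obtain ⟨c, C, hc, hr⟩ := h.range_ρ
  have pos1 : 0 < γ - 1 := by linarith
  have hpos : ∀ t ∈ Set.Icc 0 T, ∀ᵐ x, 0 < ρ t x := fun t ht =>
    (hr t ht).mono fun x hx => hc.trans_le hx.1
  have hE0 : 0 ≤ E := by
    rw [← hE]
    refine integral_nonneg_of_ae ?_
    filter_upwards [hpos 0 ⟨le_rfl, h.pos.le⟩] with x hx
    rw [energyDensity_eq hx]
    have := Finset.sum_nonneg fun i (_ : i ∈ Finset.univ) =>
      sq_nonneg (v i 0 x - (ρ 0 x)⁻¹ * weakPartial i (ρ 0) x)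
    have := Finset.sum_nonneg fun i (_ : i ∈ Finset.univ) =>
      sq_nonneg (weakPartial i (ρ 0) x)
    simp only [Pi.zero_apply]
    positivity
  refine ⟨hE0, fun t ht => ?_⟩
  obtain ⟨i0, hle⟩ := h.antitone_energy hγ t ht
  rw [hE] at hle
  obtain ⟨x0, hx0⟩ := (hr t ht).exists
  have hcC : c ≤ C := hx0.1.trans hx0.2
  have gρ := h.grad_ρ t ht
  have bρ : ∀ {F : ℝ → ℝ}, Measurable F → ContinuousOn F (Set.Ioi 0) →
      EssBdd fun x => F (ρ t x) := fun hm hF => essBdd_comp (gρ 0).memLp.1 (hr t ht) hm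
    (hF.mono fun x hx => hc.trans_le hx.1)
  have crpow : ∀ p : ℝ, ContinuousOn (fun x : ℝ => x ^ p) (Set.Ioi 0) := fun p =>
    continuousOn_id.rpow_const fun x hx => Or.inl (ne_of_gt hx)
  have bγ : EssBdd fun x => ρ t x ^ γ := bρ (F := fun x => x ^ γ) (by fun_prop) (crpow γ)
  have b1 : EssBdd fun x => ρ t x := bρ (F := fun x => x) measurable_id continuousOn_id
  have binv : EssBdd fun x => (ρ t x)⁻¹ := bρ (F := fun x => x⁻¹) measurable_inv
    (continuousOn_id.inv₀ fun x hx => ne_of_gt hx)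
  have iD : Integrable fun x => (∑ i, weakPartial i (ρ t) x ^ 2) * (ρ t x)⁻¹ := by
    have := binv.mul_integrable (integrable_finsetSum Finset.univ fun i _ =>
      (gρ i).memLp'.integrable_sq)
    simpa only [mul_comm] using this
  have hγE : ∫ x, ρ t x ^ γ ≤ (γ - 1) * E := by
    have h1 : ∫ x, 1 / (γ - 1) * ρ t x ^ γ ≤ E := by
      refine le_trans (integral_mono_ae (bγ.integrable.const_mul _) i0 ?_) hle
      filter_upwards [hpos t ht] with x hx
      rw [energyDensity_eq hx]
      have := Finset.sum_nonneg fun i (_ : i ∈ Finset.univ) =>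
        sq_nonneg (v i t x - (ρ t x)⁻¹ * weakPartial i (ρ t) x)
      have := Finset.sum_nonneg fun i (_ : i ∈ Finset.univ) =>
        sq_nonneg (weakPartial i (ρ t) x)
      refine le_add_of_nonneg_left ?_
      positivity
    rw [integral_const_mul, one_div, inv_mul_le_iff₀ pos1] at h1
    exact h1
  have hDE : ∫ x, (∑ i, weakPartial i (ρ t) x ^ 2) * (ρ t x)⁻¹ ≤ 2 * E := by
    have h1 : ∫ x, 1 / 2 * ((∑ i, weakPartial i (ρ t) x ^ 2) * (ρ t x)⁻¹) ≤ E := by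
      refine le_trans (integral_mono_ae (iD.const_mul _) i0 ?_) hle
      filter_upwards [hpos t ht] with x hx
      rw [energyDensity_eq hx]
      have := Finset.sum_nonneg fun i (_ : i ∈ Finset.univ) =>
        sq_nonneg (v i t x - (ρ t x)⁻¹ * weakPartial i (ρ t) x)
      have : 0 ≤ 1 / 2 * ρ t x * ∑ i, (v i t x - (ρ t x)⁻¹ * weakPartial i (ρ t) x) ^ 2 := by
        positivity
      have : 0 ≤ 1 / (γ - 1) * ρ t x ^ γ := by positivity
      linarith
    rw [integral_const_mul] at h1
    linarith
  have hmass : ∫ x, ρ t x ≤ 1 + (γ - 1) * E := by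
    have h1 : ∫ x, ρ t x ≤ ∫ x, (1 + ρ t x ^ γ) := by
      refine integral_mono_ae b1.integrable ((integrable_const 1).add bγ.integrable) ?_
      filter_upwards [hpos t ht] with x hx
      have h0 : 0 ≤ ρ t x ^ γ := by positivity
      rcases le_total (ρ t x) 1 with h1 | h1
      · linarith
      · have := Real.rpow_le_rpow_of_exponent_le h1 hγ.le
        rw [Real.rpow_one] at this
        linarith
    rw [integral_add (integrable_const 1) bγ.integrable] at h1
    simp at h1
    linarith
  refine ⟨hγE, hmass, ?_⟩
  -- the Sobolev inequality for `√ρ`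
  have gs : HasGrad (fun x => Real.sqrt (ρ t x))
      (fun j x => (1 / (2 * Real.sqrt (ρ t x))) * weakPartial j (ρ t) x) := fun j =>
    (gρ j).comp_Icc (F := Real.sqrt)
      (F' := fun x => 1 / (2 * Real.sqrt x)) hcC (hr t ht)
      (fun x hx => Real.hasDerivAt_sqrt (hc.trans_le hx.1).ne')
      (continuousOn_const.div (continuousOn_const.mul Real.continuous_sqrt.continuousOn)
        fun x hx => by
          have := Real.sqrt_pos.2 (hc.trans_le hx.1)
          positivity)
  have hsob := gs.integral_pow_six_le
  have e6 : ∫ x, Real.sqrt (ρ t x) ^ 6 = ∫ x, ρ t x ^ (3:ℝ) := by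
    refine integral_congr_ae ?_
    filter_upwards [hpos t ht] with x hx
    rw [show 6 = 2 * 3 by norm_num, pow_mul, Real.sq_sqrt hx.le]
    norm_cast
  have e2 : ∫ x, Real.sqrt (ρ t x) ^ 2 = ∫ x, ρ t x := by
    refine integral_congr_ae ?_
    filter_upwards [hpos t ht] with x hx
    exact Real.sq_sqrt hx.le
  have e1 : ∑ j, ∫ x, ((1 / (2 * Real.sqrt (ρ t x))) * weakPartial j (ρ t) x) ^ 2
      = 1 / 4 * ∫ x, (∑ i, weakPartial i (ρ t) x ^ 2) * (ρ t x)⁻¹ := by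
    rw [← integral_finsetSum _ fun j _ => (gs j).memLp'.integrable_sq, ← integral_const_mul]
    refine integral_congr_ae ?_
    filter_upwards [hpos t ht] with x hx
    simp only [mul_pow, div_pow, Real.sq_sqrt hx.le]
    rw [← Finset.mul_sum]
    field_simp
    ring
  rw [e6, e2, e1] at hsob
  have hI0 : 0 ≤ ∫ x, ρ t x ^ (3:ℝ) := integral_nonneg_of_ae (by
    filter_upwards [hpos t ht] with x hx
    simp only [Pi.zero_apply]
    positivity)
  have h7 : (∫ x, ρ t x ^ (3:ℝ)) ^ (1 / 3 : ℝ) ≤ 49 * (1 + γ * E) := by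
    refine hsob.trans ?_
    nlinarith
  calc ∫ x, ρ t x ^ (3:ℝ) = ((∫ x, ρ t x ^ (3:ℝ)) ^ (1 / 3 : ℝ)) ^ 3 := by
        rw [← Real.rpow_natCast, ← Real.rpow_mul hI0]; norm_num
    _ ≤ _ := by gcongr

end Evolution

/-! ### Integrability of the effective velocity -/

/-- Hölder's inequality in the form of an interpolation between two integrals. -/
lemma integral_rpow_mul_rpow_le {f g : T3 → ℝ} (hf : Integrable f) (hg : Integrable g)
    (hf0 : ∀ᵐ x, 0 ≤ f x) (hg0 : ∀ᵐ x, 0 ≤ g x) {a b : ℝ} (ha : 0 ≤ a) (hb : 0 ≤ b)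
    (hab : a + b = 1) : ∫ x, f x ^ a * g x ^ b ≤ (∫ x, f x) ^ a * (∫ x, g x) ^ b := by
  have h1 := ENNReal.lintegral_mul_norm_pow_le (μ := (volume : Measure T3))
    hf.1.aemeasurable.ennreal_ofReal hg.1.aemeasurable.ennreal_ofReal ha hb hab
  have hI : 0 ≤ ∫ x, f x := integral_nonneg_of_ae hf0
  have hJ : 0 ≤ ∫ x, g x := integral_nonneg_of_ae hg0
  rw [← ofReal_integral_eq_lintegral_ofReal hf hf0, ← ofReal_integral_eq_lintegral_ofReal hg hg0,
    ENNReal.ofReal_rpow_of_nonneg hI ha, ENNReal.ofReal_rpow_of_nonneg hJ hb,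
    ← ENNReal.ofReal_mul (by positivity)] at h1
  have m : AEStronglyMeasurable fun x => f x ^ a * g x ^ b :=
    ((hf.1.aemeasurable.pow_const a).mul (hg.1.aemeasurable.pow_const b)).aestronglyMeasurable
  rw [integral_eq_lintegral_of_nonneg_ae (by
    filter_upwards [hf0, hg0] with x h h'
    simp only [Pi.zero_apply]
    positivity) m]
  refine ENNReal.toReal_le_of_le_ofReal (by positivity) (le_trans (le_of_eq ?_) h1)
  refine lintegral_congr_ae ?_
  filter_upwards [hf0, hg0] with x h h'
  rw [ENNReal.ofReal_rpow_of_nonneg h ha, ENNReal.ofReal_rpow_of_nonneg h' hb,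
    ENNReal.ofReal_mul (by positivity)]

namespace Slice

variable {γ : ℝ} (S : Slice γ)

/-- For convex `F`, the pressure is absorbed into the dissipation at the cost of
`½ ∫ ρ^{2γ-1} F''(v_i)`. -/
lemma velocity_le (i : Fin 3) {F'' : ℝ → ℝ} (hF'' : Continuous F'') (h0 : ∀ x, 0 ≤ F'' x) :
    ∫ x, (-(∑ j, S.ρ x * F'' (S.v i x) * S.dv i j x ^ 2)
        + S.ρ x ^ γ * F'' (S.v i x) * S.dv i i x)
      ≤ -(1 / 2 * ∑ j, ∫ x, S.ρ x * F'' (S.v i x) * S.dv i j x ^ 2)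
        + 1 / 2 * ∫ x, S.ρ x ^ (2 * γ - 1) * F'' (S.v i x) := by
  have bF := S.essBdd_comp_v hF'' i
  have i1 := fun j => S.integrable_mul_dv_sq (S.essBdd_ρ.mul bF) i j
  have i2 := S.integrable_mul_dv ((S.essBdd_rpow γ).mul bF) i i
  have i3 := ((S.essBdd_rpow (2 * γ - 1)).mul bF).integrable
  have i4 : Integrable fun x => ∑ j, S.ρ x * F'' (S.v i x) * S.dv i j x ^ 2 :=
    integrable_finsetSum _ fun j _ => i1 j
  have i5 : Integrable fun x => -(1 / 2 * ∑ j, S.ρ x * F'' (S.v i x) * S.dv i j x ^ 2) :=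
    (i4.const_mul _).neg
  have i6 : Integrable fun x => 1 / 2 * (S.ρ x ^ (2 * γ - 1) * F'' (S.v i x)) := i3.const_mul _
  rw [← integral_finsetSum _ fun j _ => i1 j, ← integral_const_mul, ← integral_const_mul,
    ← integral_neg, ← integral_add i5 i6]
  refine integral_mono_ae (i4.neg.add i2) (i5.add i6) ?_
  filter_upwards [S.ρ_pos] with x hx
  have hle : S.dv i i x ^ 2 ≤ ∑ j, S.dv i j x ^ 2 :=
    Finset.single_le_sum (f := fun j => S.dv i j x ^ 2) (fun _ _ => sq_nonneg _)
      (Finset.mem_univ i)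
  rw [← Finset.mul_sum]
  have e1 : S.ρ x ^ γ = S.ρ x * S.ρ x ^ (γ - 1) := by
    have := Real.rpow_add hx 1 (γ - 1)
    rwa [Real.rpow_one, show 1 + (γ - 1) = γ by ring] at this
  have e2 : S.ρ x ^ (2 * γ - 1) = S.ρ x * (S.ρ x ^ (γ - 1) * S.ρ x ^ (γ - 1)) := by
    rw [show 2 * γ - 1 = 1 + ((γ - 1) + (γ - 1)) by ring, Real.rpow_add hx, Real.rpow_one,
      Real.rpow_add hx]
  rw [e1, e2]
  have hc : 0 ≤ S.ρ x * F'' (S.v i x) := mul_nonneg hx.le (h0 _)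
  -- Young's inequality for `ρ^{γ-1} ∂_i v_i`
  nlinarith [mul_nonneg hc (sq_nonneg (S.dv i i x - S.ρ x ^ (γ - 1))),
    mul_le_mul_of_nonneg_left hle hc]

/-- The dissipation of the density controls `ρ^γ` in `L³`. -/
lemma integral_rpow_three_mul_le :
    (∫ x, S.ρ x ^ (3 * γ)) ^ (1 / 3 : ℝ) ≤ 49 * ((∫ x, S.ρ x ^ γ)
      + γ ^ 2 / 4 * ∑ j, ∫ x, S.ρ x ^ (γ - 2) * S.dρ j x ^ 2) := by
  have g : HasGrad (fun x => S.ρ x ^ (γ / 2))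
      (fun j x => γ / 2 * S.ρ x ^ (γ / 2 - 1) * S.dρ j x) := fun j => S.rpow_ρ (γ / 2) j
  have h := g.integral_pow_six_le
  have e1 : ∫ x, (S.ρ x ^ (γ / 2)) ^ 6 = ∫ x, S.ρ x ^ (3 * γ) := by
    refine integral_congr_ae (S.ρ_pos.mono fun x hx => ?_)
    dsimp only
    rw [← Real.rpow_natCast, ← Real.rpow_mul hx.le]
    congr 1; push_cast; ring
  have e2 : ∫ x, (S.ρ x ^ (γ / 2)) ^ 2 = ∫ x, S.ρ x ^ γ := by
    refine integral_congr_ae (S.ρ_pos.mono fun x hx => ?_)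
    dsimp only
    rw [← Real.rpow_natCast, ← Real.rpow_mul hx.le]
    congr 1; push_cast; ring
  have e3 : ∀ j, ∫ x, (γ / 2 * S.ρ x ^ (γ / 2 - 1) * S.dρ j x) ^ 2
      = γ ^ 2 / 4 * ∫ x, S.ρ x ^ (γ - 2) * S.dρ j x ^ 2 := fun j => by
    rw [← integral_const_mul]
    refine integral_congr_ae (S.ρ_pos.mono fun x hx => ?_)
    have : (S.ρ x ^ (γ / 2 - 1)) ^ 2 = S.ρ x ^ (γ - 2) := by
      rw [← Real.rpow_natCast, ← Real.rpow_mul hx.le]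
      congr 1; push_cast; ring
    dsimp only
    rw [mul_pow, mul_pow, this]; ring
  rw [e1, e2] at h
  simp only [e3] at h
  rwa [← Finset.mul_sum] at h

end Slice

lemma lipschitz_ac {T : ℝ} (hT : 0 ≤ T) {f : ℝ → ℝ}
    (h : ∃ L, LipschitzOnWith L f (Set.Icc 0 T)) : AbsolutelyContinuousOnInterval f 0 T := by
  obtain ⟨L, hL⟩ := h
  exact (by rwa [Set.uIcc_of_le hT] : LipschitzOnWith L f (Set.uIcc 0 T)).absolutelyContinuousOnInterval

/-- The part `∫ (½ ρ |v|² + ρ^γ/(γ-1))` of the energy that involves the effective velocity. -/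
def effEnergy (γ : ℝ) (ρ : ℝ → T3 → ℝ) (v : Fin 3 → ℝ → T3 → ℝ) (t : ℝ) : ℝ :=
  (∑ i, ∫ x, ρ t x * (1 / 2 * v i t x ^ 2)) + ∫ x, 1 / (γ - 1) * ρ t x ^ γ

/-- Bounds for the data of a solution: `E` is the energy, `R` and `V` bound the initial density
and the initial effective velocity. -/
structure DataBound (γ E R V : ℝ) (ρ : ℝ → T3 → ℝ) (v : Fin 3 → ℝ → T3 → ℝ) : Prop where
  energy_eq : ∫ x, energyDensity γ (ρ 0 x) (fun i => v i 0 x) (fun i => weakPartial i (ρ 0) x) = E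
  ρ_le : ∀ᵐ x, ρ 0 x ≤ R
  v_le : ∀ i, ∀ᵐ x, |v i 0 x| ≤ V

namespace Evolution

variable {γ T : ℝ} {ρ ρt : ℝ → T3 → ℝ} {v vt : Fin 3 → ℝ → T3 → ℝ}

lemma ρ_pos (h : Evolution γ T ρ ρt v vt) {t : ℝ} (ht : t ∈ Set.Icc 0 T) : ∀ᵐ x, 0 < ρ t x := by
  obtain ⟨c, C, hc, hr⟩ := h.range_ρ
  exact (hr t ht).mono fun x hx => hc.trans_le hx.1

lemma essBdd_comp_ρ (h : Evolution γ T ρ ρt v vt) {t : ℝ} (ht : t ∈ Set.Icc 0 T) {F : ℝ → ℝ}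
    (hm : Measurable F) (hF : ContinuousOn F (Set.Ioi 0)) : EssBdd fun x => F (ρ t x) := by
  obtain ⟨c, C, hc, hr⟩ := h.range_ρ
  exact essBdd_comp (h.curve_ρ.memLp t ht).1 (hr t ht) hm
    (hF.mono fun x hx => hc.trans_le hx.1)

lemma essBdd_rpow (h : Evolution γ T ρ ρt v vt) {t : ℝ} (ht : t ∈ Set.Icc 0 T) (p : ℝ) :
    EssBdd fun x => ρ t x ^ p :=
  h.essBdd_comp_ρ ht (F := fun x => x ^ p) (by fun_prop)
    (continuousOn_id.rpow_const fun x hx => Or.inl (ne_of_gt hx))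

lemma essBdd_ρ (h : Evolution γ T ρ ρt v vt) {t : ℝ} (ht : t ∈ Set.Icc 0 T) : EssBdd (ρ t) :=
  h.essBdd_comp_ρ ht (F := fun x => x) measurable_id continuousOn_id

lemma essBdd_comp_v (h : Evolution γ T ρ ρt v vt) {t : ℝ} (ht : t ∈ Set.Icc 0 T) (i : Fin 3)
    {F : ℝ → ℝ} (hF : Continuous F) : EssBdd fun x => F (v i t x) := by
  obtain ⟨B, hB, hv⟩ := h.range_v
  exact essBdd_comp ((h.curve_v i).memLp t ht).1 (a := -B) (b := B)
    ((hv t ht i).mono fun x hx => abs_le.1 hx) hF.measurable hF.continuousOn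

lemma nonneg_R {E R V : ℝ} (h : Evolution γ T ρ ρt v vt) (hD : DataBound γ E R V ρ v) :
    0 ≤ R ∧ 0 ≤ V := by
  obtain ⟨x, h1, h2, h3⟩ := ((h.ρ_pos ⟨le_rfl, h.pos.le⟩).and (hD.ρ_le.and (hD.v_le 0))).exists
  exact ⟨h1.le.trans h2, (abs_nonneg _).trans h3⟩

lemma effEnergy_nonneg (h : Evolution γ T ρ ρt v vt) (hγ : 1 < γ) {t : ℝ}
    (ht : t ∈ Set.Icc 0 T) : 0 ≤ effEnergy γ ρ v t := by
  have : 0 < γ - 1 := by linarith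
  refine add_nonneg (Finset.sum_nonneg fun i _ => integral_nonneg_of_ae ?_)
    (integral_nonneg_of_ae ?_)
  · filter_upwards [h.ρ_pos ht] with x hx
    simp only [Pi.zero_apply]; positivity
  · filter_upwards [h.ρ_pos ht] with x hx
    simp only [Pi.zero_apply]; positivity

lemma effEnergy_zero_le (h : Evolution γ T ρ ρt v vt) (hγ : 1 < γ) {E R V : ℝ}
    (hD : DataBound γ E R V ρ v) :
    effEnergy γ ρ v 0 ≤ 3 * (R * (1 / 2 * V ^ 2)) + 1 / (γ - 1) * R ^ γ := by
  have hR := (h.nonneg_R hD).1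
  have h1 : 0 < γ - 1 := by linarith
  have h0 : (0:ℝ) ∈ Set.Icc 0 T := ⟨le_rfl, h.pos.le⟩
  have bd : ∀ {f : T3 → ℝ} {c : ℝ}, Integrable f → (∀ᵐ x, f x ≤ c) → ∫ x, f x ≤ c := fun hf hc => by
    have := integral_mono_ae hf (integrable_const _) hc
    simpa using this
  refine add_le_add ?_ (bd ((h.essBdd_rpow h0 γ).integrable.const_mul _) ?_)
  · have : ∀ i ∈ Finset.univ, ∫ x, ρ 0 x * (1 / 2 * v i 0 x ^ 2) ≤ R * (1 / 2 * V ^ 2) := by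
      intro i _
      refine bd ((h.essBdd_ρ h0).mul (h.essBdd_comp_v h0 i
        (F := fun x => 1 / 2 * x ^ 2) (by fun_prop))).integrable ?_
      filter_upwards [h.ρ_pos h0, hD.ρ_le, hD.v_le i] with x hx h2 h3
      have : v i 0 x ^ 2 ≤ V ^ 2 := sq_le_sq' (abs_le.1 h3).1 (abs_le.1 h3).2
      gcongr
    simpa using Finset.sum_le_sum this
  · filter_upwards [h.ρ_pos h0, hD.ρ_le] with x hx h2
    gcongr

/-- The effective energy decreases, and its dissipation controls `ρ^γ` in `L³`. -/
lemma effEnergy_deriv (h : Evolution γ T ρ ρt v vt) (hγ : 1 < γ) :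
    (∃ L, LipschitzOnWith L (effEnergy γ ρ v) (Set.Icc 0 T)) ∧
    ∀ᵐ t ∂(volume.restrict (Set.Ioo 0 T)), ∃ d ≤ 0, HasDerivAt (effEnergy γ ρ v) d t ∧
      (∫ x, ρ t x ^ (3 * γ)) ^ (1 / 3 : ℝ) ≤ 49 * ((∫ x, ρ t x ^ γ) + γ / 4 * (-d)) := by
  have h1 : γ - 1 ≠ 0 := by linarith
  have kv := fun i => h.velocity i (F := fun x => 1 / 2 * x ^ 2) (F' := fun x => x)
    (F'' := fun _ => 1) (fun x => ((hasDerivAt_pow 2 x).const_mul (1 / 2)).congr_deriv (by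
      simp)) (fun x => hasDerivAt_id x) continuous_const
  have kρ := h.density (G := fun x => 1 / (γ - 1) * x ^ γ)
    (G' := fun x => 1 / (γ - 1) * (γ * x ^ (γ - 1))) (G'' := fun x => γ * x ^ (γ - 2))
    (fun x hx => (Real.hasDerivAt_rpow_const (Or.inl hx.ne')).const_mul _)
    (fun x hx => (((Real.hasDerivAt_rpow_const (Or.inl hx.ne')).const_mul γ).const_mul
      (1 / (γ - 1))).congr_deriv (by
        rw [show γ - 1 - 1 = γ - 2 by ring]; field_simp))
    (continuousOn_const.mul (continuousOn_id.rpow_const fun x hx => Or.inl (ne_of_gt hx)))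
    (by fun_prop) (by fun_prop)
  refine ⟨?_, ?_⟩
  · choose L hL using fun i => (kv i).1
    obtain ⟨L', hL'⟩ := kρ.1
    refine ⟨L 0 + L 1 + L 2 + L', ?_⟩
    have := (((hL 0).add (hL 1)).add (hL 2)).add hL'
    have e : effEnergy γ ρ v = fun t => (∫ x, ρ t x * (1 / 2 * v 0 t x ^ 2))
        + (∫ x, ρ t x * (1 / 2 * v 1 t x ^ 2)) + (∫ x, ρ t x * (1 / 2 * v 2 t x ^ 2))
        + ∫ x, 1 / (γ - 1) * ρ t x ^ γ := by
      funext t; simp only [effEnergy, Fin.sum_univ_three]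
    rw [e]; exact this
  · filter_upwards [ae_all_iff.2 fun i => (kv i).2.2, kρ.2.2, h.slice] with t hv hρ ⟨S, hS⟩
    have hd := (HasDerivAt.fun_sum fun i (_ : i ∈ Finset.univ) => hv i S hS).add (hρ S hS)
    have i1 := fun i j => S.integrable_mul_dv_sq (S.essBdd_ρ) i j
    have i2 := fun j => S.integrable_mul_dv (S.essBdd_rpow γ) j j
    have i3 := fun j => S.integrable_mul_dρ_sq (S.essBdd_rpow (γ - 2)) j
    -- the two pressure terms cancel
    have n := NullInt.sum Finset.univ fun j _ => (S.rpow_ρ γ j).nullInt (S.grad_v j j)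
    have iR : Integrable fun x => -((∑ i, ∑ j, S.ρ x * S.dv i j x ^ 2)
        + γ * ∑ j, S.ρ x ^ (γ - 2) * S.dρ j x ^ 2) :=
      ((integrable_finsetSum _ fun i _ => integrable_finsetSum _ fun j _ => i1 i j).add
        ((integrable_finsetSum _ fun j _ => i3 j).const_mul γ)).neg
    have jv : ∀ i, Integrable fun x => (-(∑ j, S.ρ x * 1 * S.dv i j x ^ 2)
        + S.ρ x ^ γ * 1 * S.dv i i x) := fun i => by
      simp only [mul_one]
      exact (integrable_finsetSum _ fun j _ => i1 i j).neg.add (i2 i)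
    have jρ : Integrable fun x => (-(∑ j, (γ * S.ρ x ^ (γ - 2)) * S.dρ j x ^ 2)
        + ∑ j, (γ * S.ρ x ^ (γ - 2)) * S.ρ x * S.v j x * S.dρ j x) := by
      have b : EssBdd fun x => γ * S.ρ x ^ (γ - 2) := MemLp.const_mul (S.essBdd_rpow (γ - 2)) γ
      exact (integrable_finsetSum _ fun j _ => S.integrable_mul_dρ_sq b j).neg.add
        (integrable_finsetSum _ fun j _ => (((b.mul S.essBdd_ρ).mul (S.essBdd_v j)).mul
          (S.essBdd_dρ j)).integrable)
    have e : (∑ i, ∫ x, (-(∑ j, S.ρ x * 1 * S.dv i j x ^ 2) + S.ρ x ^ γ * 1 * S.dv i i x))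
        + (∫ x, (-(∑ j, (γ * S.ρ x ^ (γ - 2)) * S.dρ j x ^ 2)
        + ∑ j, (γ * S.ρ x ^ (γ - 2)) * S.ρ x * S.v j x * S.dρ j x))
        = ∫ x, -((∑ i, ∑ j, S.ρ x * S.dv i j x ^ 2)
          + γ * ∑ j, S.ρ x ^ (γ - 2) * S.dρ j x ^ 2) := by
      rw [← integral_finsetSum _ fun i _ => jv i,
        ← integral_add (integrable_finsetSum _ fun i _ => jv i) jρ]
      refine (integral_eq_of_nullInt iR n ?_).2
      filter_upwards [S.ρ_pos] with x hx
      have e1 : S.ρ x ^ (γ - 1) = S.ρ x ^ (γ - 2) * S.ρ x := by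
        rw [show γ - 1 = γ - 2 + 1 by ring, Real.rpow_add hx, Real.rpow_one]
      simp only [Fin.sum_univ_three, e1]
      ring
    have e' : ∫ x, -((∑ i, ∑ j, S.ρ x * S.dv i j x ^ 2)
          + γ * ∑ j, S.ρ x ^ (γ - 2) * S.dρ j x ^ 2)
        = -((∑ i, ∑ j, ∫ x, S.ρ x * S.dv i j x ^ 2)
          + γ * ∑ j, ∫ x, S.ρ x ^ (γ - 2) * S.dρ j x ^ 2) := by
      rw [integral_neg, integral_add (integrable_finsetSum _ fun i _ =>
        integrable_finsetSum _ fun j _ => i1 i j)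
        ((integrable_finsetSum _ fun j _ => i3 j).const_mul γ), integral_const_mul,
        integral_finsetSum _ fun j _ => i3 j,
        integral_finsetSum _ fun i _ => integrable_finsetSum _ fun j _ => i1 i j]
      simp only [integral_finsetSum _ fun j _ => i1 _ j]
    have p1 : 0 ≤ ∑ i, ∑ j, ∫ x, S.ρ x * S.dv i j x ^ 2 :=
      Finset.sum_nonneg fun i _ => Finset.sum_nonneg fun j _ => integral_nonneg_of_ae <| by
        filter_upwards [S.ρ_pos] with x hx
        simp only [Pi.zero_apply]; positivity
    have p2 : 0 ≤ ∑ j, ∫ x, S.ρ x ^ (γ - 2) * S.dρ j x ^ 2 :=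
      Finset.sum_nonneg fun j _ => integral_nonneg_of_ae <| by
        filter_upwards [S.ρ_pos] with x hx
        simp only [Pi.zero_apply]; positivity
    rw [e, e'] at hd
    refine ⟨_, ?_, hd, ?_⟩
    · have : 0 ≤ γ * ∑ j, ∫ x, S.ρ x ^ (γ - 2) * S.dρ j x ^ 2 := mul_nonneg (by linarith) p2
      linarith
    · have h5 := S.integral_rpow_three_mul_le
      rw [hS.ρ_eq] at h5
      rw [hS.ρ_eq] at p1 p2 ⊢
      refine h5.trans ?_
      have : 0 ≤ γ / 4 * ∑ i, ∑ j, ∫ x, ρ t x * S.dv i j x ^ 2 :=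
        mul_nonneg (by linarith) p1
      nlinarith

end Evolution

/-! ### Weighted `L^p` bounds for the effective velocity -/

lemma lipschitzOn_log : LipschitzOnWith 1 Real.log (Set.Ici 1) := by
  refine LipschitzOnWith.of_dist_le_mul fun x hx y hy => ?_
  have h := (convex_Ici (1:ℝ)).norm_image_sub_le_of_norm_hasDerivWithin_le (f := Real.log)
    (f' := fun x => x⁻¹) (C := 1) (fun x hx => (Real.hasDerivAt_log
      (zero_lt_one.trans_le hx).ne').hasDerivWithinAt) (fun x hx => by
        rw [Real.norm_eq_abs, abs_of_pos (inv_pos.2 (zero_lt_one.trans_le hx))]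
        exact inv_le_one_of_one_le₀ hx) hy hx
  simpa [dist_eq_norm] using h

/-- A Gronwall inequality with a weight that is the derivative of a given function. -/
lemma gronwall_of_ae_deriv {T K : ℝ} (hT : 0 ≤ T) {Φ Ψ : ℝ → ℝ}
    (hΦ : ∃ L, LipschitzOnWith L Φ (Set.Icc 0 T)) (hΨ : ∃ L, LipschitzOnWith L Ψ (Set.Icc 0 T))
    (h1 : ∀ t ∈ Set.Icc 0 T, 1 ≤ Φ t)
    (hd : ∀ᵐ t ∂(volume.restrict (Set.Ioo 0 T)), ∃ D d, HasDerivAt Φ D t ∧ HasDerivAt Ψ d t ∧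
      D ≤ K * (1 - d) * Φ t) :
    ∀ t ∈ Set.Icc 0 T, Φ t ≤ Φ 0 * Real.exp (K * (t - Ψ t + Ψ 0)) := by
  intro t ht
  obtain ⟨L, hL⟩ := hΦ
  have hlog : ∃ L, LipschitzOnWith L (fun t => Real.log (Φ t)) (Set.Icc 0 T) :=
    ⟨1 * L, lipschitzOn_log.comp hL h1⟩
  have hac : AbsolutelyContinuousOnInterval
      (fun t => Real.log (Φ t) - K * (t - Ψ t)) 0 T := by
    exact (lipschitz_ac hT hlog).sub (((lipschitz_ac hT
      ⟨1, LipschitzWith.id.lipschitzOnWith⟩).sub (lipschitz_ac hT hΨ)).const_mul K)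
  have h2 := le_of_ae_deriv_nonpos hac (by
    filter_upwards [hd, ae_restrict_mem measurableSet_Ioo] with s ⟨D, d, hD, hd', hle⟩ hs
    have hpos : 0 < Φ s := zero_lt_one.trans_le (h1 s (Set.Ioo_subset_Icc_self hs))
    refine ⟨D / Φ s - K * (1 - d), ?_,
      (hD.log hpos.ne').sub (((hasDerivAt_id s).sub hd').const_mul K)⟩
    rw [sub_nonpos, div_le_iff₀ hpos]
    exact hle) t ht
  have p0 : 0 < Φ 0 := zero_lt_one.trans_le (h1 0 ⟨le_rfl, hT⟩)
  have pt : 0 < Φ t := zero_lt_one.trans_le (h1 t ht)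
  rw [← Real.log_le_log_iff pt (by positivity), Real.log_mul p0.ne' (Real.exp_pos _).ne',
    Real.log_exp]
  linarith

/-- The smooth substitute `(1 + x²)^{p/2}` for `|x|^p`, with its first two derivatives. -/
lemma hasDerivAt_japanese (p x : ℝ) :
    HasDerivAt (fun x : ℝ => (1 + x ^ 2) ^ (p / 2)) (p * (x * (1 + x ^ 2) ^ (p / 2 - 1))) x := by
  have h : HasDerivAt (fun x : ℝ => 1 + x ^ 2) (2 * x) x := by
    simpa using (hasDerivAt_pow 2 x).const_add 1
  exact (h.rpow_const (p := p / 2) (Or.inl (by positivity))).congr_deriv (by ring)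

lemma hasDerivAt_japanese' (p x : ℝ) :
    HasDerivAt (fun x : ℝ => p * (x * (1 + x ^ 2) ^ (p / 2 - 1)))
      (p * ((1 + x ^ 2) ^ (p / 2 - 1) + (p - 2) * (x ^ 2 * (1 + x ^ 2) ^ (p / 2 - 2)))) x := by
  have h : HasDerivAt (fun x : ℝ => 1 + x ^ 2) (2 * x) x := by
    simpa using (hasDerivAt_pow 2 x).const_add 1
  refine (((hasDerivAt_id x).mul (h.rpow_const (p := p / 2 - 1)
    (Or.inl (by positivity)))).const_mul p).congr_deriv ?_
  rw [show p / 2 - 1 - 1 = p / 2 - 2 by ring]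
  simp only [id]
  ring

lemma japanese_second_bounds {p : ℝ} (hp : 2 ≤ p) (x : ℝ) :
    0 ≤ p * ((1 + x ^ 2) ^ (p / 2 - 1) + (p - 2) * (x ^ 2 * (1 + x ^ 2) ^ (p / 2 - 2))) ∧
    p * ((1 + x ^ 2) ^ (p / 2 - 1) + (p - 2) * (x ^ 2 * (1 + x ^ 2) ^ (p / 2 - 2)))
      ≤ p ^ 2 * (1 + x ^ 2) ^ (p / 2 - 1) := by
  have h1 : (0:ℝ) < 1 + x ^ 2 := by positivity
  have e : (1 + x ^ 2) ^ (p / 2 - 1) = (1 + x ^ 2) * (1 + x ^ 2) ^ (p / 2 - 2) := by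
    rw [show p / 2 - 1 = 1 + (p / 2 - 2) by ring, Real.rpow_add h1, Real.rpow_one]
  have h2 : 0 ≤ (1 + x ^ 2) ^ (p / 2 - 2) := by positivity
  have h3 : x ^ 2 * (1 + x ^ 2) ^ (p / 2 - 2) ≤ (1 + x ^ 2) ^ (p / 2 - 1) := by
    rw [e]; gcongr; linarith
  have h4 : 0 ≤ p - 2 := by linarith
  refine ⟨by positivity, ?_⟩
  have h5 := mul_le_mul_of_nonneg_left h3 h4
  have h6 : 0 ≤ (1 + x ^ 2) ^ (p / 2 - 1) := by positivity
  calc _ ≤ p * ((1 + x ^ 2) ^ (p / 2 - 1) + (p - 2) * (1 + x ^ 2) ^ (p / 2 - 1)) := by gcongr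
    _ ≤ _ := by nlinarith

namespace Evolution

variable {γ T : ℝ} {ρ ρt : ℝ → T3 → ℝ} {v vt : Fin 3 → ℝ → T3 → ℝ}

/-- The `L^p` estimate for the effective velocity, given control of `ρ` in `L^{(γ-1)p+1}` by the
dissipation of the effective energy. -/
lemma velocity_Lp (h : Evolution γ T ρ ρt v vt) (hγ : 1 < γ) {p C : ℝ} (hp : 2 < p)
    (hC : ∀ᵐ t ∂(volume.restrict (Set.Ioo 0 T)), ∃ d, HasDerivAt (effEnergy γ ρ v) d t ∧
      (∫ x, ρ t x ^ ((γ - 1) * p + 1)) ^ (2 / p) ≤ C * (1 - d)) (i : Fin 3) :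
    ∀ t ∈ Set.Icc 0 T, 1 + ∫ x, ρ t x * (1 + v i t x ^ 2) ^ (p / 2)
      ≤ (1 + ∫ x, ρ 0 x * (1 + v i 0 x ^ 2) ^ (p / 2))
        * Real.exp (p ^ 2 * C * (t - effEnergy γ ρ v t + effEnergy γ ρ v 0)) := by
  have cont : ∀ r : ℝ, Continuous fun x : ℝ => (1 + x ^ 2) ^ r := fun r =>
    (by fun_prop : Continuous fun x : ℝ => 1 + x ^ 2).rpow_const
      fun x => Or.inl (by positivity)
  have cont'' : Continuous fun x : ℝ => p * ((1 + x ^ 2) ^ (p / 2 - 1)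
      + (p - 2) * (x ^ 2 * (1 + x ^ 2) ^ (p / 2 - 2))) :=
    continuous_const.mul ((cont _).add (continuous_const.mul ((continuous_pow 2).mul (cont _))))
  obtain ⟨k1, k2, k3⟩ := h.velocity i (hasDerivAt_japanese p) (hasDerivAt_japanese' p) cont''
  obtain ⟨L, hL⟩ := k1
  have nn : ∀ t ∈ Set.Icc 0 T, 0 ≤ ∫ x, ρ t x * (1 + v i t x ^ 2) ^ (p / 2) := fun t ht =>
    integral_nonneg_of_ae <| by
      filter_upwards [h.ρ_pos ht] with x hx
      simp only [Pi.zero_apply]; positivity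
  refine gronwall_of_ae_deriv h.pos.le
    (Φ := fun t => 1 + ∫ x, ρ t x * (1 + v i t x ^ 2) ^ (p / 2))
    (Ψ := effEnergy γ ρ v) ⟨L, ?_⟩ (h.effEnergy_deriv hγ).1
    (fun t ht => by linarith [nn t ht]) ?_
  · refine LipschitzOnWith.of_dist_le_mul fun t ht s hs => ?_
    have := hL.dist_le_mul t ht s hs
    simpa [Real.dist_eq] using this
  · filter_upwards [k3, hC, h.slice, ae_restrict_mem measurableSet_Ioo]
      with t hv ⟨d, hd, hle⟩ ⟨S, hS⟩ ht
    have htI : t ∈ Set.Icc 0 T := Set.Ioo_subset_Icc_self ht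
    refine ⟨_, d, (hv S hS).const_add 1, hd, ?_⟩
    have h1 := S.velocity_le i cont'' fun x => (japanese_second_bounds hp.le x).1
    have b1 := fun r => (S.essBdd_rpow (2 * γ - 1)).mul (S.essBdd_comp_v (cont r) i)
    have b2 := (S.essBdd_rpow (2 * γ - 1)).mul (S.essBdd_comp_v cont'' i)
    have p1 : 0 ≤ 1 / 2 * ∑ j, ∫ x, S.ρ x * (p * ((1 + S.v i x ^ 2) ^ (p / 2 - 1)
        + (p - 2) * (S.v i x ^ 2 * (1 + S.v i x ^ 2) ^ (p / 2 - 2)))) * S.dv i j x ^ 2 := by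
      refine mul_nonneg (by norm_num) (Finset.sum_nonneg fun j _ => integral_nonneg_of_ae ?_)
      filter_upwards [S.ρ_pos] with x hx
      exact mul_nonneg (mul_nonneg hx.le (japanese_second_bounds hp.le _).1) (sq_nonneg _)
    have h2 : ∫ x, S.ρ x ^ (2 * γ - 1) * (p * ((1 + S.v i x ^ 2) ^ (p / 2 - 1)
        + (p - 2) * (S.v i x ^ 2 * (1 + S.v i x ^ 2) ^ (p / 2 - 2))))
        ≤ p ^ 2 * ∫ x, S.ρ x ^ (2 * γ - 1) * (1 + S.v i x ^ 2) ^ (p / 2 - 1) := by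
      rw [← integral_const_mul]
      refine integral_mono_ae b2.integrable ((b1 _).integrable.const_mul _) ?_
      filter_upwards [S.ρ_pos] with x hx
      have := mul_le_mul_of_nonneg_left (japanese_second_bounds hp.le (S.v i x)).2
        (Real.rpow_nonneg hx.le (2 * γ - 1))
      linarith
    have hp0 : 0 < p := by linarith
    have f0 : Integrable fun x => S.ρ x ^ ((γ - 1) * p + 1) := (S.essBdd_rpow _).integrable
    have g0 : Integrable fun x => S.ρ x * (1 + S.v i x ^ 2) ^ (p / 2) :=
      (S.essBdd_ρ.mul (S.essBdd_comp_v (cont _) i)).integrable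
    have h3 : ∫ x, S.ρ x ^ (2 * γ - 1) * (1 + S.v i x ^ 2) ^ (p / 2 - 1)
        ≤ (∫ x, S.ρ x ^ ((γ - 1) * p + 1)) ^ (2 / p)
          * (∫ x, S.ρ x * (1 + S.v i x ^ 2) ^ (p / 2)) ^ (1 - 2 / p) := by
      refine le_trans (le_of_eq ?_) (integral_rpow_mul_rpow_le f0 g0
        (S.ρ_pos.mono fun x hx => by positivity) (S.ρ_pos.mono fun x hx => by positivity)
        (by positivity) (by rw [sub_nonneg, div_le_one hp0]; exact hp.le) (by ring))
      refine integral_congr_ae (S.ρ_pos.mono fun x hx => ?_)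
      dsimp only
      rw [Real.mul_rpow hx.le (by positivity), ← Real.rpow_mul hx.le,
        ← Real.rpow_mul (by positivity), ← mul_assoc, ← Real.rpow_add hx]
      congr 2
      · field_simp; ring
      · field_simp
    rw [hS.ρ_eq, hS.v_eq] at h1 h2 h3 p1
    rw [hS.ρ_eq, hS.v_eq]
    set I := ∫ x, ρ t x * (1 + v i t x ^ 2) ^ (p / 2) with hI
    have hI0 : 0 ≤ I := nn t htI
    have h4 : I ^ (1 - 2 / p) ≤ 1 + I := by
      calc I ^ (1 - 2 / p) ≤ (1 + I) ^ (1 - 2 / p) := by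
            refine Real.rpow_le_rpow hI0 (by linarith) ?_
            rw [sub_nonneg, div_le_one hp0]; exact hp.le
        _ ≤ (1 + I) ^ (1:ℝ) := by
            refine Real.rpow_le_rpow_of_exponent_le (by linarith) ?_
            have : 0 < 2 / p := by positivity
            linarith
        _ = _ := Real.rpow_one _
    have hJ0 : 0 ≤ (∫ x, ρ t x ^ ((γ - 1) * p + 1)) ^ (2 / p) :=
      Real.rpow_nonneg (integral_nonneg_of_ae <| by
        filter_upwards [h.ρ_pos htI] with x hx
        simp only [Pi.zero_apply]; positivity) _
    have h5 : ∫ x, ρ t x ^ (2 * γ - 1) * (1 + v i t x ^ 2) ^ (p / 2 - 1)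
        ≤ C * (1 - d) * (1 + I) :=
      h3.trans (mul_le_mul hle h4 (by positivity) (hJ0.trans hle))
    have h6 : 0 ≤ C * (1 - d) * (1 + I) := mul_nonneg (hJ0.trans hle) (by linarith)
    calc _ ≤ _ := h1
      _ ≤ 1 / 2 * (p ^ 2 * (C * (1 - d) * (1 + I))) := by
          have := h2.trans (mul_le_mul_of_nonneg_left h5 (sq_nonneg p))
          linarith
      _ ≤ _ := by nlinarith [mul_nonneg (sq_nonneg p) h6]

end Evolution

/-- An exponent `p > 3` and a constant such that `∫ ρ |v_i|^p` is bounded by the constant. The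
exponent is `4/(γ-1)` or `2/(γ-1)`, so that `γ < 7/3` is what makes it exceed `3`. -/
lemma exists_velocity_Lp_bound {γ : ℝ} (hγ : 1 < γ) (hγ' : γ < 7 / 3) (Ts E R V : ℝ) :
    ∃ p B : ℝ, 3 < p ∧ 0 ≤ B ∧ ∀ (T : ℝ) (ρ ρt : ℝ → T3 → ℝ) (v vt : Fin 3 → ℝ → T3 → ℝ),
      Evolution γ T ρ ρt v vt → T ≤ Ts → DataBound γ E R V ρ v → ∀ t ∈ Set.Icc 0 T, ∀ i,
        ∫ x, ρ t x * (1 + v i t x ^ 2) ^ (p / 2) ≤ B := by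
  have hg : 0 < γ - 1 := by linarith
  -- control of the density by the dissipation
  obtain ⟨p, C, hp, hC0, hC⟩ : ∃ p C : ℝ, 3 < p ∧ 0 ≤ C ∧
      ∀ (T : ℝ) (ρ ρt : ℝ → T3 → ℝ) (v vt : Fin 3 → ℝ → T3 → ℝ),
      Evolution γ T ρ ρt v vt → DataBound γ E R V ρ v → ∀ t ∈ Set.Icc 0 T,
        (∫ x, ρ t x ^ ((γ - 1) * p + 1)) ^ (2 / p)
          ≤ C * (1 + (∫ x, ρ t x ^ (3 * γ)) ^ (1 / 3 : ℝ)) := by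
    set K := (49 * (1 + γ * E)) ^ 3 with hK
    have nonneg : ∀ (T : ℝ) (ρ ρt : ℝ → T3 → ℝ) (v vt : Fin 3 → ℝ → T3 → ℝ),
        Evolution γ T ρ ρt v vt → ∀ t ∈ Set.Icc 0 T, ∀ r : ℝ, 0 ≤ ∫ x, ρ t x ^ r := by
      intro T ρ ρt v vt h t ht r
      refine integral_nonneg_of_ae ?_
      filter_upwards [h.ρ_pos ht] with x hx
      simp only [Pi.zero_apply]; positivity
    rcases le_or_gt (5 / 3) γ with h53 | h53
    · -- `ρ⁵` lies between `ρ³` and `ρ^{3γ}`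
      set a := 2 / (3 * (γ - 1)) with ha
      have ha0 : 0 ≤ a := by positivity
      have ha1 : a ≤ 1 := by rw [ha, div_le_one (by positivity)]; linarith
      have ha' : a * (3 * (γ - 1)) = 2 := by rw [ha]; field_simp
      refine ⟨4 / (γ - 1), |K| ^ ((1 - a) * ((γ - 1) / 2)), ?_, by positivity,
        fun T ρ ρt v vt h hD t ht => ?_⟩
      · rw [lt_div_iff₀ hg]; linarith
      have hb := (h.energy_bounds hγ hD.energy_eq).2 t ht
      have n3 := nonneg T ρ ρt v vt h t ht 3
      have nγ := nonneg T ρ ρt v vt h t ht (3 * γ)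
      have n5 := nonneg T ρ ρt v vt h t ht ((γ - 1) * (4 / (γ - 1)) + 1)
      have h1 : ∫ x, ρ t x ^ ((γ - 1) * (4 / (γ - 1)) + 1)
          ≤ (∫ x, ρ t x ^ (3:ℝ)) ^ (1 - a) * (∫ x, ρ t x ^ (3 * γ)) ^ a := by
        refine le_trans (le_of_eq ?_) (integral_rpow_mul_rpow_le (h.essBdd_rpow ht 3).integrable
          (h.essBdd_rpow ht (3 * γ)).integrable ((h.ρ_pos ht).mono fun x hx => by positivity)
          ((h.ρ_pos ht).mono fun x hx => by positivity) (by linarith) ha0 (by ring))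
        refine integral_congr_ae ((h.ρ_pos ht).mono fun x hx => ?_)
        dsimp only
        rw [← Real.rpow_mul hx.le, ← Real.rpow_mul hx.le, ← Real.rpow_add hx]
        congr 1
        field_simp
        linarith
      calc _ ≤ ((∫ x, ρ t x ^ (3:ℝ)) ^ (1 - a) * (∫ x, ρ t x ^ (3 * γ)) ^ a)
            ^ (2 / (4 / (γ - 1))) := Real.rpow_le_rpow n5 h1 (by positivity)
        _ = (∫ x, ρ t x ^ (3:ℝ)) ^ ((1 - a) * ((γ - 1) / 2))
            * (∫ x, ρ t x ^ (3 * γ)) ^ (1 / 3 : ℝ) := by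
            rw [Real.mul_rpow (Real.rpow_nonneg n3 _) (Real.rpow_nonneg nγ _),
              ← Real.rpow_mul n3, ← Real.rpow_mul nγ]
            congr 2
            · field_simp; norm_num
            · field_simp; linarith
        _ ≤ |K| ^ ((1 - a) * ((γ - 1) / 2)) * (1 + (∫ x, ρ t x ^ (3 * γ)) ^ (1 / 3 : ℝ)) := by
            refine mul_le_mul (Real.rpow_le_rpow n3 (hb.2.2.trans (le_abs_self K)) ?_)
              (by linarith) (Real.rpow_nonneg nγ _) (by positivity)
            exact mul_nonneg (by linarith) (by linarith)
    · -- the exponent `(γ - 1) p + 1` equals `3`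
      refine ⟨2 / (γ - 1), |K| ^ (γ - 1), ?_, by positivity, fun T ρ ρt v vt h hD t ht => ?_⟩
      · rw [lt_div_iff₀ hg]; linarith
      have hb := (h.energy_bounds hγ hD.energy_eq).2 t ht
      have n3 := nonneg T ρ ρt v vt h t ht 3
      have nγ := nonneg T ρ ρt v vt h t ht (3 * γ)
      have e1 : (γ - 1) * (2 / (γ - 1)) + 1 = 3 := by field_simp; norm_num
      have e2 : 2 / (2 / (γ - 1)) = γ - 1 := by field_simp
      rw [e1, e2]
      calc _ ≤ |K| ^ (γ - 1) := Real.rpow_le_rpow n3 (hb.2.2.trans (le_abs_self K)) hg.le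
        _ ≤ _ := le_mul_of_one_le_right (by positivity)
            (by linarith [Real.rpow_nonneg nγ (1 / 3)])
  set E1 := 3 * (R * (1 / 2 * V ^ 2)) + 1 / (γ - 1) * R ^ γ with hE1
  set C' := C * (1 + 49 * ((γ - 1) * |E| + γ / 4)) with hC'
  have hC'0 : 0 ≤ C' := by positivity
  -- the term with `|R|` only keeps the constant nonnegative for every real `R`
  refine ⟨p, (1 + R * (1 + V ^ 2) ^ (p / 2)) * Real.exp (p ^ 2 * C' * (|Ts| + |E1|)) + |R|
    * (1 + V ^ 2) ^ (p / 2) * Real.exp (p ^ 2 * C' * (|Ts| + |E1|)), hp, ?_, ?_⟩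
  · have : 0 ≤ (1 + (R + |R|) * (1 + V ^ 2) ^ (p / 2)) := by
      have : 0 ≤ R + |R| := by linarith [neg_abs_le R]
      positivity
    have := mul_nonneg this (Real.exp_pos (p ^ 2 * C' * (|Ts| + |E1|))).le
    linarith
  intro T ρ ρt v vt h hT hD t ht i
  obtain ⟨hR, hV⟩ := h.nonneg_R hD
  obtain ⟨hE0, hb⟩ := h.energy_bounds hγ hD.energy_eq
  have h0 : (0:ℝ) ∈ Set.Icc 0 T := ⟨le_rfl, h.pos.le⟩
  have key := h.velocity_Lp hγ (p := p) (C := C') (by linarith) (by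
    filter_upwards [(h.effEnergy_deriv hγ).2, ae_restrict_mem measurableSet_Ioo]
      with s ⟨d, hd0, hd, hle⟩ hs
    have hsI : s ∈ Set.Icc 0 T := Set.Ioo_subset_Icc_self hs
    refine ⟨d, hd, (hC T ρ ρt v vt h hD s hsI).trans ?_⟩
    rw [hC', mul_assoc]
    refine mul_le_mul_of_nonneg_left ?_ hC0
    have h1 := (hb s hsI).1
    have h2 : (γ - 1) * E ≤ (γ - 1) * |E| := by gcongr; exact le_abs_self E
    have h3 : 0 ≤ (γ - 1) * |E| := by positivity
    nlinarith) i t ht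
  have ht1 : effEnergy γ ρ v 0 ≤ |E1| := (h.effEnergy_zero_le hγ hD).trans (le_abs_self _)
  have ht2 := h.effEnergy_nonneg hγ ht
  have ht3 : t ≤ |Ts| := ht.2.trans (hT.trans (le_abs_self _))
  have init : ∫ x, ρ 0 x * (1 + v i 0 x ^ 2) ^ (p / 2) ≤ R * (1 + V ^ 2) ^ (p / 2) := by
    have c : Continuous fun x : ℝ => (1 + x ^ 2) ^ (p / 2) :=
      (by fun_prop : Continuous fun x : ℝ => 1 + x ^ 2).rpow_const
        fun x => Or.inl (by positivity)
    have := integral_mono_ae ((h.essBdd_ρ h0).mul (h.essBdd_comp_v h0 i c)).integrable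
      (integrable_const (R * (1 + V ^ 2) ^ (p / 2))) (by
        filter_upwards [h.ρ_pos h0, hD.ρ_le, hD.v_le i] with x hx h2 h3
        have : v i 0 x ^ 2 ≤ V ^ 2 := sq_le_sq' (abs_le.1 h3).1 (abs_le.1 h3).2
        gcongr)
    simpa using this
  have hexp : Real.exp (p ^ 2 * C' * (t - effEnergy γ ρ v t + effEnergy γ ρ v 0))
      ≤ Real.exp (p ^ 2 * C' * (|Ts| + |E1|)) := by
    gcongr
    linarith
  have h5 : (1 + ∫ x, ρ 0 x * (1 + v i 0 x ^ 2) ^ (p / 2))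
      * Real.exp (p ^ 2 * C' * (t - effEnergy γ ρ v t + effEnergy γ ρ v 0))
      ≤ (1 + R * (1 + V ^ 2) ^ (p / 2)) * Real.exp (p ^ 2 * C' * (|Ts| + |E1|)) :=
    mul_le_mul (by linarith) hexp (Real.exp_pos _).le (by positivity)
  have h6 : 0 ≤ |R| * (1 + V ^ 2) ^ (p / 2) * Real.exp (p ^ 2 * C' * (|Ts| + |E1|)) := by
    positivity
  linarith

/-! ### De Giorgi iteration -/

/-- Superlinear recursions with geometric coefficients decay geometrically once the first term is
small. -/
lemma le_geometric_of_superlinear {a : ℕ → ℝ} {C b β : ℝ} (ha : ∀ n, 0 ≤ a n) (hC : 0 ≤ C)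
    (hb : 0 < b) (hβ : 0 < β) (h : ∀ n, a (n + 1) ≤ C * b ^ n * a n ^ (1 + β))
    (h0 : C * a 0 ^ β * b ^ (1 / β) ≤ 1) (n : ℕ) : a n ≤ a 0 * (b ^ (-(1 / β))) ^ n := by
  set r := b ^ (-(1 / β)) with hr
  have hr0 : 0 < r := Real.rpow_pos_of_pos hb _
  have hrb : r * b ^ (1 / β) = 1 := by rw [hr, ← Real.rpow_add hb]; simp
  have h1 : C * a 0 ^ β ≤ r := by
    have : 0 < b ^ (1 / β) := Real.rpow_pos_of_pos hb _
    exact le_of_mul_le_mul_right (h0.trans hrb.ge) this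
  have hrβ : r ^ β = b⁻¹ := by
    rw [hr, ← Real.rpow_mul hb.le, neg_mul, one_div, inv_mul_cancel₀ hβ.ne', Real.rpow_neg_one]
  induction n with
  | zero => simp
  | succ n ih =>
    have hrn : (r ^ n) ^ β = (b ^ n)⁻¹ := by
      rw [← Real.rpow_natCast, ← Real.rpow_mul hr0.le, mul_comm, Real.rpow_mul hr0.le, hrβ,
        Real.rpow_natCast, inv_pow]
    calc a (n + 1) ≤ C * b ^ n * a n ^ (1 + β) := h n
      _ ≤ C * b ^ n * (a 0 * r ^ n) ^ (1 + β) := by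
          gcongr
          exact ha n
      _ = (a 0 * r ^ n) * (C * a 0 ^ β) := by
          have e : (a 0 * r ^ n) ^ (1 + β) = (a 0 * r ^ n) * (a 0 ^ β * (b ^ n)⁻¹) := by
            rw [Real.rpow_add_of_nonneg (mul_nonneg (ha 0) (by positivity)) zero_le_one hβ.le,
              Real.rpow_one, Real.mul_rpow (ha 0) (by positivity), hrn]
          rw [e]
          field_simp
      _ ≤ (a 0 * r ^ n) * r := by
          gcongr
          exact mul_nonneg (ha 0) (by positivity)
      _ = _ := by ring

/-- An integrated differential inequality along a Lipschitz function. -/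
lemma sub_le_integral_of_ae_deriv {T : ℝ} (hT : 0 ≤ T) {y b : ℝ → ℝ}
    (hy : ∃ L, LipschitzOnWith L y (Set.Icc 0 T)) (hb : ContinuousOn b (Set.Icc 0 T))
    (h : ∀ᵐ t ∂(volume.restrict (Set.Ioo 0 T)), ∃ d, HasDerivAt y d t ∧ d ≤ b t) {t : ℝ}
    (ht : t ∈ Set.Icc 0 T) : y t - y 0 ≤ ∫ s in 0..t, b s := by
  have hsub : Set.uIcc 0 t ⊆ Set.uIcc 0 T := by
    rw [Set.uIcc_of_le ht.1, Set.uIcc_of_le hT]; exact Set.Icc_subset_Icc_right ht.2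
  have hac := (lipschitz_ac hT hy).mono hsub
  rw [← hac.integral_deriv_eq_sub, intervalIntegral.integral_of_le ht.1,
    intervalIntegral.integral_of_le ht.1, integral_Ioc_eq_integral_Ioo,
    integral_Ioc_eq_integral_Ioo]
  have i1 := (intervalIntegrable_iff_integrableOn_Ioo_of_le ht.1).1 hac.intervalIntegrable_deriv
  have i2 : IntegrableOn b (Set.Ioo 0 t) :=
    ((hb.mono (Set.Icc_subset_Icc_right ht.2)).integrableOn_Icc).mono_set Set.Ioo_subset_Icc_self
  refine integral_mono_ae i1 i2 ?_
  filter_upwards [ae_mono (Measure.restrict_mono (Set.Ioo_subset_Ioo_right ht.2) le_rfl) h]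
    with s ⟨d, hd, hle⟩
  rw [hd.deriv]; exact hle

/-- One step of the iteration: the functional `∫ b` at the higher level is superlinearly small. -/
lemma deGiorgi_step {T D K β : ℝ} (hT : 0 < T) (hD : 0 ≤ D) (hK : 0 ≤ K)
    (hβ : 0 < β) {y b b' : ℝ → ℝ} (hy : ∃ L, LipschitzOnWith L y (Set.Icc 0 T)) (hy0 : y 0 = 0)
    (hyn : ∀ t ∈ Set.Icc 0 T, 0 ≤ y t) (hb : ContinuousOn b (Set.Icc 0 T))
    (hbn : ∀ t ∈ Set.Icc 0 T, 0 ≤ b t) (hb' : ContinuousOn b' (Set.Icc 0 T))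
    (h1 : ∀ᵐ t ∂(volume.restrict (Set.Ioo 0 T)), ∃ d, HasDerivAt y d t ∧ d ≤ D * b t ∧
      b' t ≤ K * y t ^ β * (y t + D * b t - d)) :
    (∀ t ∈ Set.Icc 0 T, y t ≤ D * ∫ s in 0..T, b s) ∧
    ∫ s in 0..T, b' s ≤ K * (1 + T) * D ^ (1 + β) * (∫ s in 0..T, b s) ^ (1 + β) := by
  set a := ∫ s in 0..T, b s with ha
  have hle : ∀ t ∈ Set.Icc 0 T, y t ≤ D * a := by
    intro t ht
    have h2 := sub_le_integral_of_ae_deriv hT.le hy (b := fun t => D * b t)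
      (continuousOn_const.mul hb)
      (h1.mono fun t ⟨d, hd, hd', _⟩ => ⟨d, hd, hd'⟩) ht
    rw [hy0, sub_zero, intervalIntegral.integral_const_mul] at h2
    refine h2.trans (mul_le_mul_of_nonneg_left ?_ hD)
    refine intervalIntegral.integral_mono_interval le_rfl ht.1 ht.2 ?_ ?_
    · rw [EventuallyLE, ae_restrict_iff' measurableSet_Ioc]
      exact Eventually.of_forall fun s hs => hbn s (Set.Ioc_subset_Icc_self hs)
    · exact (hb.mono (by rw [Set.uIcc_of_le hT.le])).intervalIntegrable
  refine ⟨hle, ?_⟩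
  have ha0 : 0 ≤ a := intervalIntegral.integral_nonneg hT.le hbn
  have hTm : T ∈ Set.Icc 0 T := ⟨hT.le, le_rfl⟩
  have hac := lipschitz_ac hT.le hy
  have i1 := (intervalIntegrable_iff_integrableOn_Ioo_of_le hT.le).1 hac.intervalIntegrable_deriv
  have i2 : IntegrableOn b (Set.Ioo 0 T) := hb.integrableOn_Icc.mono_set Set.Ioo_subset_Icc_self
  have i3 : IntegrableOn b' (Set.Ioo 0 T) := hb'.integrableOn_Icc.mono_set Set.Ioo_subset_Icc_self
  set Q := K * (D * a) ^ β with hQ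
  have hQ0 : 0 ≤ Q := by positivity
  have i4 : IntegrableOn (fun t => Q * (D * a + D * b t - deriv y t)) (Set.Ioo 0 T) :=
    (((integrable_const (D * a)).add (i2.const_mul D)).sub i1).const_mul Q
  have h3 : ∫ t in Set.Ioo 0 T, b' t
      ≤ ∫ t in Set.Ioo 0 T, Q * (D * a + D * b t - deriv y t) := by
    refine integral_mono_ae i3 i4 ?_
    filter_upwards [h1, ae_restrict_mem measurableSet_Ioo] with t ⟨d, hd, hd', hd''⟩ ht
    have htI : t ∈ Set.Icc 0 T := Set.Ioo_subset_Icc_self ht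
    have e1 := hyn t htI
    have e2 := hle t htI
    rw [hd.deriv]
    refine hd''.trans (mul_le_mul ?_ (by linarith) (by linarith) hQ0)
    rw [hQ]
    gcongr
  have e : ∫ t in Set.Ioo 0 T, Q * (D * a + D * b t - deriv y t)
      = Q * (D * a * T + D * a - (y T - y 0)) := by
    have j1 : IntegrableOn (fun t => D * a + D * b t) (Set.Ioo 0 T) :=
      (integrable_const (D * a)).add (i2.const_mul D)
    have e2 : ∫ t in Set.Ioo 0 T, D * b t = D * ∫ t in Set.Ioo 0 T, b t :=
      integral_const_mul _ _
    rw [integral_const_mul, integral_sub j1 i1, integral_add (integrable_const _) (i2.const_mul D),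
      e2, ← integral_Ioc_eq_integral_Ioo, ← integral_Ioc_eq_integral_Ioo,
      ← integral_Ioc_eq_integral_Ioo, ← intervalIntegral.integral_of_le hT.le,
      ← intervalIntegral.integral_of_le hT.le, ← intervalIntegral.integral_of_le hT.le,
      hac.integral_deriv_eq_sub, intervalIntegral.integral_const]
    simp only [smul_eq_mul, sub_zero]
    ring
  rw [intervalIntegral.integral_of_le hT.le, integral_Ioc_eq_integral_Ioo]
  refine h3.trans (e.le.trans ?_)
  have hyT := hyn T hTm
  calc Q * (D * a * T + D * a - (y T - y 0)) ≤ Q * (D * a * (1 + T)) := by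
        rw [hy0]; gcongr; linarith
    _ = K * (1 + T) * ((D * a) ^ (1 + β)) := by
        rw [hQ, Real.rpow_add_of_nonneg (mul_nonneg hD ha0) zero_le_one hβ.le, Real.rpow_one]; ring
    _ = _ := by rw [Real.mul_rpow hD ha0]; ring

/-- De Giorgi's iteration between the levels `M` and `2M`. Here `y k` is an energy of the part of
the solution above the level `k`, and `b k` the source that drives it. If `y k` has derivative
`d ≤ D b k - (dissipation)`, then `y k + D b k - d` bounds the energy and the dissipation together, so
that the last inequality in `h` is an interpolation of the source between the two. -/
lemma deGiorgi {T D K m β M : ℝ} (hT : 0 < T) (hD : 0 ≤ D) (hK : 0 ≤ K) (hm : 0 < m)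
    (hβ : 0 < β) (hM : 0 < M) {y b : ℝ → ℝ → ℝ}
    (hy : ∀ k, M ≤ k → ∃ L, LipschitzOnWith L (y k) (Set.Icc 0 T))
    (hy0 : ∀ k, M ≤ k → y k 0 = 0) (hyn : ∀ k, M ≤ k → ∀ t ∈ Set.Icc 0 T, 0 ≤ y k t)
    (hb : ∀ k, M ≤ k → ContinuousOn (b k) (Set.Icc 0 T))
    (hbn : ∀ k, M ≤ k → ∀ t ∈ Set.Icc 0 T, 0 ≤ b k t)
    (h : ∀ k k', M ≤ k → k < k' → ∀ᵐ t ∂(volume.restrict (Set.Ioo 0 T)), ∃ d,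
      HasDerivAt (y k) d t ∧ d ≤ D * b k t ∧
      b k' t ≤ K * (k' - k) ^ (-m) * y k t ^ β * (y k t + D * b k t - d))
    (hs : K * (1 + T) * D ^ (1 + β) * (M / 2) ^ (-m) * (∫ t in 0..T, b M t) ^ β
      * (2 ^ m) ^ (1 / β) ≤ 1) :
    ∀ t ∈ Set.Icc 0 T, ∀ ε > 0, ∃ k, M ≤ k ∧ k ≤ 2 * M ∧ y k t ≤ ε := by
  set κ : ℕ → ℝ := fun n => M * (2 - (1 / 2) ^ n) with hκ
  have hpow : ∀ n : ℕ, (0:ℝ) < (1 / 2) ^ n ∧ ((1:ℝ) / 2) ^ n ≤ 1 := fun n =>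
    ⟨by positivity, pow_le_one₀ (by norm_num) (by norm_num)⟩
  have hκM : ∀ n, M ≤ κ n := fun n => by
    simp only [hκ]; nlinarith [hpow n]
  have hκ2 : ∀ n, κ n ≤ 2 * M := fun n => by
    simp only [hκ]; nlinarith [hpow n]
  have hδ : ∀ n, κ (n + 1) - κ n = M / 2 * (1 / 2) ^ n := fun n => by
    simp only [hκ, pow_succ]; ring
  have hlt : ∀ n, κ n < κ (n + 1) := fun n => by
    have : 0 < M / 2 * (1 / 2) ^ n := by positivity
    linarith [hδ n]
  have hδm : ∀ n, (κ (n + 1) - κ n) ^ (-m) = (M / 2) ^ (-m) * (2 ^ m) ^ n := fun n => by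
    have e : ((1:ℝ) / 2) ^ n = 2 ^ (-(n:ℝ)) := by
      rw [Real.rpow_neg (by norm_num), Real.rpow_natCast, one_div, inv_pow]
    rw [hδ, Real.mul_rpow (by positivity) (by positivity), e, ← Real.rpow_natCast,
      ← Real.rpow_mul (by norm_num), ← Real.rpow_mul (by norm_num)]
    congr 2; ring
  set a : ℕ → ℝ := fun n => ∫ t in 0..T, b (κ n) t with ha
  have ha0 : ∀ n, 0 ≤ a n := fun n =>
    intervalIntegral.integral_nonneg hT.le (hbn _ (hκM n))
  have step := fun n => deGiorgi_step (K := K * (κ (n + 1) - κ n) ^ (-m)) hT hD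
    (mul_nonneg hK (Real.rpow_nonneg (by linarith [hlt n]) _)) hβ (hy _ (hκM n)) (hy0 _ (hκM n))
    (hyn _ (hκM n)) (hb _ (hκM n)) (hbn _ (hκM n)) (hb _ (hκM (n + 1)))
    (h _ _ (hκM n) (hlt n))
  have hκ0 : κ 0 = M := by simp only [hκ]; norm_num
  have decay := le_geometric_of_superlinear (a := a)
    (C := K * (1 + T) * D ^ (1 + β) * (M / 2) ^ (-m)) (b := 2 ^ m) (β := β) ha0 (by positivity)
    (by positivity) hβ (fun n => by
      refine (step n).2.trans (le_of_eq ?_)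
      rw [hδm]
      simp only [ha]
      ring) (by
      simp only [ha, hκ0]; exact hs)
  intro t ht ε hε
  have hr1 : ((2:ℝ) ^ m) ^ (-(1 / β)) < 1 := by
    refine Real.rpow_lt_one_of_one_lt_of_neg (Real.one_lt_rpow (by norm_num) hm) ?_
    have : 0 < 1 / β := by positivity
    linarith
  have hlim : Tendsto (fun n : ℕ => D * (a 0 * (((2:ℝ) ^ m) ^ (-(1 / β))) ^ n)) atTop (𝓝 0) := by
    have := (tendsto_pow_atTop_nhds_zero_of_lt_one (by positivity) hr1).const_mul (D * a 0)
    simpa [mul_assoc] using this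
  obtain ⟨n, hn⟩ := (hlim.eventually (gt_mem_nhds hε)).exists
  exact ⟨κ n, hκM n, hκ2 n, ((step n).1 t ht).trans
    ((mul_le_mul_of_nonneg_left (decay n) hD).trans hn.le)⟩

/-! ### Truncations -/

/-- The excess of `x` over the level `k`. -/
def excess (k x : ℝ) : ℝ := max (x - k) 0

lemma excess_nonneg (k x : ℝ) : 0 ≤ excess k x := le_max_right _ _

lemma continuous_excess (k : ℝ) : Continuous (excess k) :=
  (continuous_id.sub continuous_const).max continuous_const

lemma hasDerivAt_excess_pow (k : ℝ) {n : ℕ} (hn : 1 ≤ n) (x : ℝ) :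
    HasDerivAt (fun x => excess k x ^ (n + 1)) ((n + 1) * excess k x ^ n) x := by
  have hlin : HasDerivAt (fun x => (x - k) ^ (n + 1)) ((n + 1) * (x - k) ^ n) x := by
    have := ((hasDerivAt_id x).sub_const k).pow (n + 1)
    refine HasDerivAt.congr_deriv this ?_
    simp
  rcases lt_trichotomy x k with hx | hx | hx
  · have e : excess k x = 0 := max_eq_right (by linarith)
    rw [e, zero_pow (by omega), mul_zero]
    refine (hasDerivAt_const x (0:ℝ)).congr_of_eventuallyEq ?_
    filter_upwards [gt_mem_nhds hx] with z hz
    rw [excess, max_eq_right (by linarith), zero_pow (by omega)]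
  · subst hx
    have e : excess x x = 0 := by simp [excess]
    rw [e, zero_pow (by omega), mul_zero, hasDerivAt_iff_isLittleO]
    have h0 : (n + 1 : ℝ) * (x - x) ^ n = 0 := by rw [sub_self, zero_pow (by omega), mul_zero]
    rw [h0, hasDerivAt_iff_isLittleO] at hlin
    refine Asymptotics.IsBigO.trans_isLittleO (Asymptotics.IsBigO.of_bound 1
      (Eventually.of_forall fun z => ?_)) hlin
    have h1 : |excess x z| ≤ |z - x| := by
      rw [abs_of_nonneg (excess_nonneg _ _)]
      exact max_le (le_abs_self _) (abs_nonneg _)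
    simp only [e, sub_self, smul_zero, sub_zero, ne_eq, Nat.add_eq_zero_iff, one_ne_zero,
      and_false, not_false_eq_true, zero_pow, one_mul, norm_pow, Real.norm_eq_abs]
    exact pow_le_pow_left₀ (abs_nonneg _) h1 _
  · have e : excess k x = x - k := max_eq_left (by linarith)
    rw [e]
    refine hlin.congr_of_eventuallyEq ?_
    filter_upwards [lt_mem_nhds hx] with z hz
    rw [excess, max_eq_left (by linarith)]

/-- Chebyshev's inequality between two levels. -/
lemma excess_rpow_le {k k' x r s : ℝ} (hk : k < k') (hr : 0 < r) (hs : 0 ≤ s) :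
    excess k' x ^ r ≤ (k' - k) ^ (-s) * excess k x ^ (r + s) := by
  have hd : 0 < k' - k := by linarith
  rcases le_or_gt x k' with h | h
  · have e : excess k' x = 0 := max_eq_right (by linarith)
    rw [e, Real.zero_rpow hr.ne']
    have := excess_nonneg k x
    positivity
  · have e' : excess k' x = x - k' := max_eq_left (by linarith)
    have e : excess k x = x - k := max_eq_left (by linarith)
    have hx : 0 < x - k := by linarith
    rw [e, e', Real.rpow_add hx, Real.rpow_neg hd.le, ← div_eq_inv_mul, le_div_iff₀ (by positivity)]
    gcongr

lemma hasDerivAt_excess_four (k x : ℝ) :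
    HasDerivAt (fun x => excess k x ^ 4) (4 * excess k x ^ 3) x :=
  (hasDerivAt_excess_pow k (n := 3) (by norm_num) x).congr_deriv (by norm_num)

lemma hasDerivAt_four_mul_excess_cube (k x : ℝ) :
    HasDerivAt (fun x => 4 * excess k x ^ 3) (12 * excess k x ^ 2) x :=
  ((hasDerivAt_excess_pow k (n := 2) (by norm_num) x).const_mul 4).congr_deriv
    (by norm_num; ring)

lemma hasDerivAt_excess_sq (k x : ℝ) :
    HasDerivAt (fun x => excess k x ^ 2) (2 * excess k x) x :=
  (hasDerivAt_excess_pow k (n := 1) (by norm_num) x).congr_deriv (by norm_num)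

lemma continuous_excess_rpow (k : ℝ) {r : ℝ} (hr : 0 ≤ r) :
    Continuous fun x => excess k x ^ r :=
  (continuous_excess k).rpow_const fun _ => Or.inr hr

lemma exists_lipschitz_excess_rpow (k B : ℝ) {r : ℝ} (hr : 1 ≤ r) :
    ∃ L, 0 ≤ L ∧ ∀ x ≤ B, ∀ y ≤ B, |excess k x ^ r - excess k y ^ r| ≤ L * |x - y| := by
  have hB : 0 ≤ max (B - k) 0 := le_max_right _ _
  refine ⟨r * max (B - k) 0 ^ (r - 1), by positivity, fun x hx y hy => ?_⟩
  have hmem : ∀ z ≤ B, excess k z ∈ Set.Icc 0 (max (B - k) 0) := fun z hz =>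
    ⟨excess_nonneg k z, max_le_max (by linarith) le_rfl⟩
  have h := (convex_Icc (0:ℝ) (max (B - k) 0)).norm_image_sub_le_of_norm_hasDerivWithin_le
    (f := fun x => x ^ r) (f' := fun x => r * x ^ (r - 1)) (C := r * max (B - k) 0 ^ (r - 1))
    (fun z _ => (Real.hasDerivAt_rpow_const (Or.inr hr)).hasDerivWithinAt) (fun z hz => by
      have := hz.1
      rw [Real.norm_eq_abs, abs_of_nonneg (by positivity)]
      gcongr
      exact hz.2) (hmem y hy) (hmem x hx)
  rw [Real.norm_eq_abs, Real.norm_eq_abs] at h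
  refine h.trans ?_
  refine mul_le_mul_of_nonneg_left ?_ (by positivity)
  have := abs_max_sub_max_le_abs (x - k) (y - k) 0
  rwa [sub_sub_sub_cancel_right] at this

/-- Integrals of Lipschitz functions are continuous along a curve. -/
lemma IsCurve.continuousOn_integral_comp {T : ℝ} {f g : ℝ → T3 → ℝ} (h : IsCurve T f g)
    {F : ℝ → ℝ} {L : ℝ} {s : Set ℝ} (hL0 : 0 ≤ L)
    (hF : ∀ x ∈ s, ∀ y ∈ s, |F x - F y| ≤ L * |x - y|)
    (hf : ∀ t ∈ Set.Icc 0 T, ∀ᵐ x, f t x ∈ s)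
    (hi : ∀ t ∈ Set.Icc 0 T, Integrable fun x => F (f t x)) :
    ContinuousOn (fun t => ∫ x, F (f t x)) (Set.Icc 0 T) := by
  obtain ⟨M, hM, hLip⟩ := h.lipschitz
  refine LipschitzOnWith.continuousOn (K := Real.toNNReal (L * M))
    (LipschitzOnWith.of_dist_le_mul fun t ht s hs => ?_)
  have md : MemLp (fun x => f t x - f s x) 2 volume := (h.memLp t ht).sub (h.memLp s hs)
  rw [Real.dist_eq, Real.dist_eq, Real.coe_toNNReal _ (by positivity), ← integral_sub (hi t ht)
    (hi s hs)]
  have i1 : Integrable fun x => L * |f t x - f s x| := (md.integrable (by norm_num)).abs.const_mul L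
  calc |∫ x, (F (f t x) - F (f s x))| ≤ ∫ x, L * |f t x - f s x| := by
        rw [← Real.norm_eq_abs]
        refine norm_integral_le_of_norm_le i1 ?_
        filter_upwards [hf t ht, hf s hs] with x h1 h2
        exact hF _ h1 _ h2
    _ = L * ∫ x, |f t x - f s x| := integral_const_mul _ _
    _ ≤ L * (M * |t - s|) := by
        gcongr
        exact (integral_abs_le_eLpNorm_two md).trans (hLip s hs t ht)
    _ = _ := by ring

/-- The interpolation step of De Giorgi's iteration, through the Sobolev inequality for the
square of the excess. -/
lemma excess_interpolation {f : T3 → ℝ} {g : Fin 3 → T3 → ℝ} (hf : HasGrad f g) {B : ℝ}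
    (hB : ∀ᵐ x, |f x| ≤ B) {σ k k' : ℝ} (hσ : 1 / 3 < σ) (hk : k < k') :
    (∫ x, excess k' (f x) ^ (2 / σ)) ^ σ ≤ (k' - k) ^ (-(4 * σ + 2 / 3))
      * (∫ x, excess k (f x) ^ 4) ^ (σ - 1 / 3)
      * (49 * ((∫ x, excess k (f x) ^ 4) + 4 * ∑ j, ∫ x, excess k (f x) ^ 2 * g j x ^ 2)) := by
  have hσ0 : 0 < σ := by linarith
  have hd : 0 < k' - k := by linarith
  have hB0 : 0 ≤ B := by
    obtain ⟨x, hx⟩ := hB.exists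
    exact (abs_nonneg _).trans hx
  have bdd : ∀ {F : ℝ → ℝ}, Continuous F → EssBdd fun x => F (f x) := fun hF =>
    essBdd_comp (hf 0).memLp.1 (hB.mono fun x hx => abs_le.1 hx) hF.measurable hF.continuousOn
  set s := 4 + 2 / (3 * σ) with hs
  set l := 1 / (3 * σ) with hl
  have hl0 : 0 ≤ l := by positivity
  have hl1 : l ≤ 1 := by rw [hl, div_le_one (by positivity)]; linarith
  have ex := fun k x => excess_nonneg k x
  have pw : Continuous fun x => excess k x ^ 4 := (continuous_excess k).pow 4
  have pw' : Continuous fun x => excess k x ^ 12 := (continuous_excess k).pow 12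
  have I4 : 0 ≤ ∫ x, excess k (f x) ^ 4 := integral_nonneg fun x => pow_nonneg (ex _ _) _
  have I12 : 0 ≤ ∫ x, excess k (f x) ^ 12 := integral_nonneg fun x => pow_nonneg (ex _ _) _
  have h1 : ∫ x, excess k' (f x) ^ (2 / σ)
      ≤ (k' - k) ^ (-s) * ∫ x, excess k (f x) ^ (2 / σ + s) := by
    rw [← integral_const_mul]
    refine integral_mono (bdd (continuous_excess_rpow k' (by positivity))).integrable
      ((bdd (continuous_excess_rpow k (by positivity))).integrable.const_mul _) fun x => ?_
    exact excess_rpow_le hk (by positivity) (by positivity)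
  have h2 : ∫ x, excess k (f x) ^ (2 / σ + s)
      ≤ (∫ x, excess k (f x) ^ 4) ^ (1 - l) * (∫ x, excess k (f x) ^ 12) ^ l := by
    refine le_trans (le_of_eq ?_) (integral_rpow_mul_rpow_le (bdd pw).integrable
      (bdd pw').integrable (Eventually.of_forall fun x => pow_nonneg (ex _ _) _)
      (Eventually.of_forall fun x => pow_nonneg (ex _ _) _) (by linarith) hl0 (by ring))
    congr 1; funext x
    rw [← Real.rpow_natCast, ← Real.rpow_natCast, ← Real.rpow_mul (ex _ _),
      ← Real.rpow_mul (ex _ _), ← Real.rpow_add_of_nonneg (ex _ _)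
        (mul_nonneg (by positivity) (by linarith)) (by positivity)]
    congr 1
    rw [hs, hl]; push_cast; field_simp; ring
  have gW : HasGrad (fun x => excess k (f x) ^ 2) (fun j x => 2 * excess k (f x) * g j x) :=
    fun j => (hf j).comp_Icc (a := -B) (b := B) (by linarith) (hB.mono fun x hx => abs_le.1 hx)
      (fun x _ => hasDerivAt_excess_sq k x)
      (continuous_const.mul (continuous_excess k)).continuousOn
  have h3 : (∫ x, excess k (f x) ^ 12) ^ (1 / 3 : ℝ)
      ≤ 49 * ((∫ x, excess k (f x) ^ 4) + 4 * ∑ j, ∫ x, excess k (f x) ^ 2 * g j x ^ 2) := by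
    have := gW.integral_pow_six_le
    simp only [← pow_mul, mul_pow] at this
    norm_num only at this
    refine this.trans (le_of_eq ?_)
    rw [Finset.mul_sum]
    congr 2
    refine Finset.sum_congr rfl fun j _ => ?_
    rw [← integral_const_mul]
    congr 1; funext x; ring
  have n0 : 0 ≤ ∫ x, excess k' (f x) ^ (2 / σ) :=
    integral_nonneg fun x => Real.rpow_nonneg (ex _ _) _
  have hds : 0 ≤ (k' - k) ^ (-s) := by positivity
  calc (∫ x, excess k' (f x) ^ (2 / σ)) ^ σ
      ≤ ((k' - k) ^ (-s) * ((∫ x, excess k (f x) ^ 4) ^ (1 - l)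
          * (∫ x, excess k (f x) ^ 12) ^ l)) ^ σ :=
        Real.rpow_le_rpow n0 (h1.trans (mul_le_mul_of_nonneg_left h2 hds)) hσ0.le
    _ = (k' - k) ^ (-(4 * σ + 2 / 3)) * (∫ x, excess k (f x) ^ 4) ^ (σ - 1 / 3)
          * (∫ x, excess k (f x) ^ 12) ^ (1 / 3 : ℝ) := by
        rw [Real.mul_rpow hds (by positivity), Real.mul_rpow (by positivity) (by positivity),
          ← Real.rpow_mul hd.le, ← Real.rpow_mul I4, ← Real.rpow_mul I12, mul_assoc,
          show -s * σ = -(4 * σ + 2 / 3) by rw [hs]; field_simp,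
          show (1 - l) * σ = σ - 1 / 3 by rw [hl]; field_simp,
          show l * σ = 1 / 3 by rw [hl]; field_simp]
    _ ≤ _ := by gcongr

/-- A function whose excess over `k` has vanishing fourth moment does not exceed `k`. -/
lemma ae_le_of_excess_eq_zero {f : T3 → ℝ} {k : ℝ} (hi : Integrable fun x => excess k (f x) ^ 4)
    (h : ∫ x, excess k (f x) ^ 4 ≤ 0) : ∀ᵐ x, f x ≤ k := by
  have h0 : 0 ≤ ∫ x, excess k (f x) ^ 4 :=
    integral_nonneg fun x => pow_nonneg (excess_nonneg _ _) _
  have h1 := (integral_eq_zero_iff_of_nonneg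
    (fun x => pow_nonneg (excess_nonneg k (f x)) 4) hi).1 (le_antisymm h h0)
  filter_upwards [h1] with x hx
  have : excess k (f x) = 0 := by simpa using hx
  have h2 : f x - k ≤ excess k (f x) := le_max_left _ _
  linarith

lemma excess_mono {k k' : ℝ} (h : k ≤ k') (x : ℝ) : excess k' x ≤ excess k x :=
  max_le_max (by linarith) le_rfl

lemma excess_eq_zero {k x : ℝ} (h : x ≤ k) : excess k x = 0 := max_eq_right (by linarith)

/-! ### The upper bound of the density -/

namespace Slice

variable {γ : ℝ} (S : Slice γ)

/-- The excess of the density over a level is driven by the effective velocity in `L^p`. -/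
lemma density_excess_le {p N B k : ℝ} (hp : 2 < p) (hN : ∀ᵐ x, S.ρ x ≤ N)
    (hB : ∀ i, ∫ x, S.ρ x * (1 + S.v i x ^ 2) ^ (p / 2) ≤ B) :
    ∫ x, (-(∑ j, 12 * excess k (S.ρ x) ^ 2 * S.dρ j x ^ 2)
        + ∑ j, 12 * excess k (S.ρ x) ^ 2 * S.ρ x * S.v j x * S.dρ j x)
      ≤ -(6 * ∑ j, ∫ x, excess k (S.ρ x) ^ 2 * S.dρ j x ^ 2)
        + 18 * N ^ (2 - 2 / p) * B ^ (2 / p)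
          * (∫ x, excess k (S.ρ x) ^ (2 / (1 - 2 / p))) ^ (1 - 2 / p) := by
  have hp0 : 0 < p := by linarith
  have h2p : 2 / p < 1 := by rw [div_lt_one hp0]; exact hp
  have bF : ∀ {F : ℝ → ℝ}, Continuous F → EssBdd fun x => F (S.ρ x) := fun hF =>
    S.essBdd_comp_ρ hF.measurable hF.continuousOn
  have cv : ∀ r : ℝ, Continuous fun x : ℝ => (1 + x ^ 2) ^ r := fun r =>
    (by fun_prop : Continuous fun x : ℝ => 1 + x ^ 2).rpow_const
      fun x => Or.inl (by positivity)
  have b2 : EssBdd fun x => excess k (S.ρ x) ^ 2 := bF ((continuous_excess k).pow 2)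
  have b12 : EssBdd fun x => 12 * excess k (S.ρ x) ^ 2 :=
    bF (continuous_const.mul ((continuous_excess k).pow 2))
  have bv : ∀ j, EssBdd fun x => 1 + S.v j x ^ 2 := fun j =>
    S.essBdd_comp_v (F := fun x => 1 + x ^ 2) (by fun_prop) j
  have bρ2 : EssBdd fun x => S.ρ x ^ 2 := bF (continuous_pow 2)
  have i1 := fun j => S.integrable_mul_dρ_sq b2 j
  have i2 := fun j => ((b2.mul bρ2).mul (bv j)).integrable
  have i3 : Integrable fun x => (-(∑ j, 12 * excess k (S.ρ x) ^ 2 * S.dρ j x ^ 2)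
        + ∑ j, 12 * excess k (S.ρ x) ^ 2 * S.ρ x * S.v j x * S.dρ j x) :=
    (integrable_finsetSum _ fun j _ => S.integrable_mul_dρ_sq b12 j).neg.add
      (integrable_finsetSum _ fun j _ => (((b12.mul S.essBdd_ρ).mul (S.essBdd_v j)).mul
        (S.essBdd_dρ j)).integrable)
  have i5 : ∀ j, Integrable fun x => (-(6 * (excess k (S.ρ x) ^ 2 * S.dρ j x ^ 2))
      + 6 * (excess k (S.ρ x) ^ 2 * S.ρ x ^ 2 * (1 + S.v j x ^ 2))) := fun j =>
    ((i1 j).const_mul 6).neg.add ((i2 j).const_mul 6)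
  have i4 : Integrable fun x => ∑ j, (-(6 * (excess k (S.ρ x) ^ 2 * S.dρ j x ^ 2))
      + 6 * (excess k (S.ρ x) ^ 2 * S.ρ x ^ 2 * (1 + S.v j x ^ 2))) :=
    integrable_finsetSum _ fun j _ => i5 j
  have h1 : ∫ x, (-(∑ j, 12 * excess k (S.ρ x) ^ 2 * S.dρ j x ^ 2)
        + ∑ j, 12 * excess k (S.ρ x) ^ 2 * S.ρ x * S.v j x * S.dρ j x)
      ≤ ∫ x, ∑ j, (-(6 * (excess k (S.ρ x) ^ 2 * S.dρ j x ^ 2))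
      + 6 * (excess k (S.ρ x) ^ 2 * S.ρ x ^ 2 * (1 + S.v j x ^ 2))) := by
    refine integral_mono i3 i4 fun x => ?_
    dsimp only
    rw [← Finset.sum_neg_distrib, ← Finset.sum_add_distrib]
    refine Finset.sum_le_sum fun j _ => ?_
    -- Young's inequality for `ρ v_j ∂_j ρ`
    nlinarith [mul_nonneg (sq_nonneg (excess k (S.ρ x))) (sq_nonneg (S.dρ j x - S.ρ x * S.v j x)),
      mul_nonneg (sq_nonneg (excess k (S.ρ x))) (sq_nonneg (S.ρ x))]
  have h2 : ∀ j, ∫ x, excess k (S.ρ x) ^ 2 * S.ρ x ^ 2 * (1 + S.v j x ^ 2)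
      ≤ N ^ (2 - 2 / p) * ((∫ x, excess k (S.ρ x) ^ (2 / (1 - 2 / p))) ^ (1 - 2 / p)
        * (∫ x, S.ρ x * (1 + S.v j x ^ 2) ^ (p / 2)) ^ (2 / p)) := by
    intro j
    have hσ : 0 < 1 - 2 / p := by linarith
    have c1 : EssBdd fun x => excess k (S.ρ x) ^ (2 / (1 - 2 / p)) :=
      bF (continuous_excess_rpow k (by positivity))
    have c2 : EssBdd fun x => S.ρ x * (1 + S.v j x ^ 2) ^ (p / 2) :=
      S.essBdd_ρ.mul (S.essBdd_comp_v (cv _) j)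
    have c3 : EssBdd fun x => excess k (S.ρ x) ^ 2 * (S.ρ x ^ (2 / p) * (1 + S.v j x ^ 2)) :=
      b2.mul ((S.essBdd_rpow _).mul (bv j))
    have h3 : ∫ x, excess k (S.ρ x) ^ 2 * (S.ρ x ^ (2 / p) * (1 + S.v j x ^ 2))
        ≤ (∫ x, excess k (S.ρ x) ^ (2 / (1 - 2 / p))) ^ (1 - 2 / p)
        * (∫ x, S.ρ x * (1 + S.v j x ^ 2) ^ (p / 2)) ^ (2 / p) := by
      refine le_trans (le_of_eq ?_) (integral_rpow_mul_rpow_le c1.integrable c2.integrable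
        (Eventually.of_forall fun x => Real.rpow_nonneg (excess_nonneg _ _) _)
        (S.ρ_pos.mono fun x hx => by positivity) hσ.le (by positivity) (by ring))
      refine integral_congr_ae (S.ρ_pos.mono fun x hx => ?_)
      dsimp only
      rw [← Real.rpow_mul (excess_nonneg _ _), div_mul_cancel₀ _ hσ.ne',
        Real.mul_rpow hx.le (by positivity), ← Real.rpow_mul (by positivity),
        show p / 2 * (2 / p) = 1 by field_simp, Real.rpow_one]
      norm_num
    have hN0 : 0 ≤ N := by
      obtain ⟨x, hx, hx'⟩ := (S.ρ_pos.and hN).exists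
      exact hx.le.trans hx'
    refine le_trans ?_ (mul_le_mul_of_nonneg_left h3 (by positivity))
    rw [← integral_const_mul]
    refine integral_mono_ae (i2 j) (c3.integrable.const_mul _) ?_
    filter_upwards [S.ρ_pos, hN] with x hx hxN
    have e : S.ρ x ^ 2 = S.ρ x ^ (2 - 2 / p) * S.ρ x ^ (2 / p) := by
      rw [← Real.rpow_add hx]; norm_num
    have h4 : S.ρ x ^ (2 - 2 / p) ≤ N ^ (2 - 2 / p) :=
      Real.rpow_le_rpow hx.le hxN (by linarith)
    rw [e]
    have : 0 ≤ excess k (S.ρ x) ^ 2 * (S.ρ x ^ (2 / p) * (1 + S.v j x ^ 2)) := by positivity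
    nlinarith [mul_le_mul_of_nonneg_right h4 this]
  have hN0 : 0 ≤ N := by
    obtain ⟨x, hx, hx'⟩ := (S.ρ_pos.and hN).exists
    exact hx.le.trans hx'
  set b := (∫ x, excess k (S.ρ x) ^ (2 / (1 - 2 / p))) ^ (1 - 2 / p) with hb
  have hb0 : 0 ≤ b := Real.rpow_nonneg
    (integral_nonneg fun x => Real.rpow_nonneg (excess_nonneg _ _) _) _
  have h5 : ∀ j, ∫ x, excess k (S.ρ x) ^ 2 * S.ρ x ^ 2 * (1 + S.v j x ^ 2)
      ≤ N ^ (2 - 2 / p) * B ^ (2 / p) * b := fun j => by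
    refine (h2 j).trans ?_
    have : (∫ x, S.ρ x * (1 + S.v j x ^ 2) ^ (p / 2)) ^ (2 / p) ≤ B ^ (2 / p) :=
      Real.rpow_le_rpow (integral_nonneg_of_ae (S.ρ_pos.mono fun x hx => by
        simp only [Pi.zero_apply]; positivity)) (hB j) (by positivity)
    calc _ ≤ N ^ (2 - 2 / p) * (b * B ^ (2 / p)) := by gcongr
      _ = _ := by ring
  refine h1.trans ?_
  rw [integral_finsetSum _ fun j _ => i5 j]
  have e : ∀ j, ∫ x, (-(6 * (excess k (S.ρ x) ^ 2 * S.dρ j x ^ 2))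
      + 6 * (excess k (S.ρ x) ^ 2 * S.ρ x ^ 2 * (1 + S.v j x ^ 2)))
      = -(6 * ∫ x, excess k (S.ρ x) ^ 2 * S.dρ j x ^ 2)
        + 6 * ∫ x, excess k (S.ρ x) ^ 2 * S.ρ x ^ 2 * (1 + S.v j x ^ 2) := fun j => by
    have k1 : Integrable fun x => -(6 * (excess k (S.ρ x) ^ 2 * S.dρ j x ^ 2)) :=
      ((i1 j).const_mul 6).neg
    rw [integral_add k1 ((i2 j).const_mul 6), integral_neg, integral_const_mul,
      integral_const_mul]
  simp only [e, Fin.sum_univ_three]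
  have := h5 0
  have := h5 1
  have := h5 2
  linarith

end Slice

/-- The excess of the density vanishes when the source of De Giorgi's iteration is small. The
smallness condition is scale invariant up to the factor `N^{-2/3}`. -/
lemma Evolution.density_half {γ T : ℝ} {ρ ρt : ℝ → T3 → ℝ} {v vt : Fin 3 → ℝ → T3 → ℝ}
    (h : Evolution γ T ρ ρt v vt) {p N B m₀ R Ts : ℝ} (hp : 3 < p) (hN : 0 < N) (hTs : T ≤ Ts)
    (hρN : ∀ t ∈ Set.Icc 0 T, ∀ᵐ x, ρ t x ≤ N)
    (hB : ∀ t ∈ Set.Icc 0 T, ∀ i, ∫ x, ρ t x * (1 + v i t x ^ 2) ^ (p / 2) ≤ B)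
    (hm : ∀ t ∈ Set.Icc 0 T, ∫ x, ρ t x ≤ m₀) (hR : ∀ᵐ x, ρ 0 x ≤ R) (hRN : R ≤ N / 4)
    (hs : 49 * (1 + Ts) * (18 * B ^ (2 / p)) ^ (1 + (1 - 2 / p - 1 / 3))
      * 8 ^ (4 * (1 - 2 / p) + 2 / 3) * (Ts * m₀ ^ (1 - 2 / p)) ^ (1 - 2 / p - 1 / 3)
      * (2 ^ (4 * (1 - 2 / p) + 2 / 3)) ^ (1 / (1 - 2 / p - 1 / 3)) * N ^ (-(2 / 3) : ℝ) ≤ 1) :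
    ∀ t ∈ Set.Icc 0 T, ∀ᵐ x, ρ t x ≤ N / 2 := by
  have hp0 : 0 < p := by linarith
  have h2p : 2 / p < 2 / 3 := by gcongr
  have h2p0 : 0 < 2 / p := by positivity
  set σ := 1 - 2 / p with hσ
  set β := σ - 1 / 3 with hβ
  set m := 4 * σ + 2 / 3 with hmd
  have hσ0 : 1 / 3 < σ := by linarith
  have hσ1 : σ ≤ 1 := by linarith
  have hβ0 : 0 < β := by linarith
  have h0 : (0:ℝ) ∈ Set.Icc 0 T := ⟨le_rfl, h.pos.le⟩
  have hB0 : 0 ≤ B := le_trans (integral_nonneg_of_ae (by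
    filter_upwards [h.ρ_pos h0] with x hx
    simp only [Pi.zero_apply]; positivity)) (hB 0 h0 0)
  have hm0 : 0 ≤ m₀ := le_trans (integral_nonneg_of_ae ((h.ρ_pos h0).mono fun x hx => hx.le))
    (hm 0 h0)
  have hT0 := h.pos
  have hTs0 : 0 ≤ Ts := hT0.le.trans hTs
  set D := 18 * N ^ (2 - 2 / p) * B ^ (2 / p) with hD
  have hD0 : 0 ≤ D := by positivity
  set y : ℝ → ℝ → ℝ := fun k t => ∫ x, excess k (ρ t x) ^ 4 with hy
  set b : ℝ → ℝ → ℝ := fun k t => (∫ x, excess k (ρ t x) ^ (2 / σ)) ^ σ with hb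
  have ev := fun k => h.density (G := fun x => excess k x ^ 4) (G' := fun x => 4 * excess k x ^ 3)
    (G'' := fun x => 12 * excess k x ^ 2) (fun x _ => hasDerivAt_excess_four k x)
    (fun x _ => hasDerivAt_four_mul_excess_cube k x)
    (continuous_const.mul ((continuous_excess k).pow 2)).continuousOn
    ((continuous_excess k).pow 4).measurable
    (continuous_const.mul ((continuous_excess k).pow 2)).measurable
  have hσr : 1 ≤ 2 / σ := by rw [le_div_iff₀ (by linarith)]; linarith
  have ib : ∀ k, ∀ t ∈ Set.Icc 0 T, Integrable fun x => excess k (ρ t x) ^ (2 / σ) :=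
    fun k t ht => (h.essBdd_comp_ρ ht (continuous_excess_rpow k (by linarith)).measurable
      (continuous_excess_rpow k (by linarith)).continuousOn).integrable
  have ibn : ∀ k t, 0 ≤ ∫ x, excess k (ρ t x) ^ (2 / σ) := fun k t =>
    integral_nonneg fun x => Real.rpow_nonneg (excess_nonneg _ _) _
  have hbc : ∀ k, ContinuousOn (b k) (Set.Icc 0 T) := fun k => by
    obtain ⟨L, hL0, hL⟩ := exists_lipschitz_excess_rpow k N hσr
    exact (h.curve_ρ.continuousOn_integral_comp (F := fun x => excess k x ^ (2 / σ))
      (s := Set.Iic N) hL0 hL hρN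
      (ib k)).rpow_const fun x _ => Or.inr (by linarith)
  have hM : 0 < N / 4 := by positivity
  -- the source at the first level
  have hbM : ∫ t in 0..T, b (N / 4) t ≤ Ts * (N ^ (2 - σ) * m₀ ^ σ) := by
    have h1 : ∀ t ∈ Set.Icc 0 T, b (N / 4) t ≤ N ^ (2 - σ) * m₀ ^ σ := by
      intro t ht
      have h2 : ∫ x, excess (N / 4) (ρ t x) ^ (2 / σ) ≤ N ^ (2 / σ - 1) * m₀ := by
        refine le_trans ?_ (mul_le_mul_of_nonneg_left (hm t ht) (by positivity))
        rw [← integral_const_mul]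
        refine integral_mono_ae (ib _ t ht) ((h.essBdd_ρ ht).integrable.const_mul _) ?_
        filter_upwards [h.ρ_pos ht, hρN t ht] with x hx hxN
        have e1 : excess (N / 4) (ρ t x) ≤ ρ t x := max_le (by linarith) hx.le
        calc excess (N / 4) (ρ t x) ^ (2 / σ) ≤ ρ t x ^ (2 / σ) :=
              Real.rpow_le_rpow (excess_nonneg _ _) e1 (by linarith)
          _ = ρ t x ^ (2 / σ - 1) * ρ t x := by
              conv_rhs => rw [← Real.rpow_one (ρ t x)]
              rw [Real.rpow_one, ← Real.rpow_add_one hx.ne']; ring_nf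
          _ ≤ _ := by
              gcongr
      calc b (N / 4) t ≤ (N ^ (2 / σ - 1) * m₀) ^ σ :=
            Real.rpow_le_rpow (ibn _ _) h2 (by linarith)
        _ = _ := by
            rw [Real.mul_rpow (by positivity) hm0, ← Real.rpow_mul hN.le,
              show (2 / σ - 1) * σ = 2 - σ by field_simp]
    have h3 : ∫ t in 0..T, b (N / 4) t ≤ ∫ t in 0..T, N ^ (2 - σ) * m₀ ^ σ :=
      intervalIntegral.integral_mono_on hT0.le
        ((hbc _).mono (by rw [Set.uIcc_of_le hT0.le])).intervalIntegrable (by simp) h1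
    rw [intervalIntegral.integral_const, sub_zero, smul_eq_mul] at h3
    exact h3.trans (by gcongr)
  have key := deGiorgi (T := T) (D := D) (K := 49) (m := m) (β := β) (M := N / 4) (y := y) (b := b)
    hT0 hD0 (by norm_num) (by linarith) hβ0 hM (fun k _ => (ev k).1) (fun k hk => by
      have : ∀ᵐ x, excess k (ρ 0 x) ^ 4 = 0 := by
        filter_upwards [hR] with x hx
        rw [excess_eq_zero (by linarith)]; norm_num
      simp only [hy]
      rw [integral_congr_ae this]; simp)
    (fun k _ t _ => integral_nonneg fun x => pow_nonneg (excess_nonneg _ _) _)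
    (fun k _ => hbc k) (fun k _ t _ => Real.rpow_nonneg (ibn k t) _) (fun k k' hk hkk' => by
      obtain ⟨c, C, hc, hr⟩ := h.range_ρ
      filter_upwards [(ev k).2.2, h.slice, ae_restrict_mem measurableSet_Ioo] with t hd ⟨S, hS⟩ ht
      have htI : t ∈ Set.Icc 0 T := Set.Ioo_subset_Icc_self ht
      have h1 := S.density_excess_le (k := k) (p := p) (N := N) (B := B) (by linarith)
        (by rw [hS.ρ_eq]; exact hρN t htI)
        (fun i => by rw [hS.ρ_eq, hS.v_eq]; exact hB t htI i)
      have h2 := excess_interpolation S.grad_ρ (B := C) (by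
        rw [hS.ρ_eq]
        filter_upwards [hr t htI] with x hx
        rw [abs_of_pos (hc.trans_le hx.1)]; exact hx.2) hσ0 hkk'
      have h3 : 0 ≤ ∑ j, ∫ x, excess k (S.ρ x) ^ 2 * S.dρ j x ^ 2 :=
        Finset.sum_nonneg fun j _ => integral_nonneg fun x => by positivity
      refine ⟨_, hd S hS, ?_, ?_⟩
      · rw [hS.ρ_eq] at h1 h3 ⊢
        refine h1.trans ?_
        simp only [hb, hD]
        linarith
      · refine le_trans (le_of_eq ?_) (h2.trans ?_)
        · simp only [hb, hS.ρ_eq]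
        · have h4 : 49 * ((∫ x, excess k (S.ρ x) ^ 4)
              + 4 * ∑ j, ∫ x, excess k (S.ρ x) ^ 2 * S.dρ j x ^ 2)
              ≤ 49 * (y k t + D * b k t
                - ∫ x, (-(∑ j, 12 * excess k (S.ρ x) ^ 2 * S.dρ j x ^ 2)
                  + ∑ j, 12 * excess k (S.ρ x) ^ 2 * S.ρ x * S.v j x * S.dρ j x)) := by
            rw [hS.ρ_eq] at h1 h3 ⊢
            simp only [hy, hb, hD]
            linarith
          have h5 : 0 ≤ (k' - k) ^ (-(4 * σ + 2 / 3))
              * (∫ x, excess k (S.ρ x) ^ 4) ^ (σ - 1 / 3) := by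
            have : 0 < k' - k := by linarith
            have : 0 ≤ ∫ x, excess k (S.ρ x) ^ 4 :=
              integral_nonneg fun x => pow_nonneg (excess_nonneg _ _) _
            positivity
          refine (mul_le_mul_of_nonneg_left h4 h5).trans (le_of_eq ?_)
          simp only [hy, hS.ρ_eq]
          ring) (by
    have ha0 : 0 ≤ ∫ t in 0..T, b (N / 4) t :=
      intervalIntegral.integral_nonneg hT0.le fun t _ => Real.rpow_nonneg (ibn _ t) _
    refine le_trans ?_ hs
    have e1 : (N / 4 / 2) ^ (-m) = N ^ (-m) * 8 ^ m := by
      rw [div_div, show (4:ℝ) * 2 = 8 by norm_num, Real.div_rpow hN.le (by norm_num),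
        Real.rpow_neg (by norm_num : (0:ℝ) ≤ 8), div_inv_eq_mul]
    have e2 : D ^ (1 + β) = (18 * B ^ (2 / p)) ^ (1 + β) * N ^ ((1 + σ) * (1 + β)) := by
      rw [Real.rpow_mul hN.le, ← Real.mul_rpow (by positivity) (by positivity)]
      congr 1
      rw [hD, show 2 - 2 / p = 1 + σ by rw [hσ]; ring]; ring
    have e3 : (∫ t in 0..T, b (N / 4) t) ^ β ≤ (Ts * m₀ ^ σ) ^ β * N ^ ((2 - σ) * β) := by
      rw [Real.rpow_mul hN.le, ← Real.mul_rpow (by positivity) (by positivity)]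
      refine Real.rpow_le_rpow ha0 (hbM.trans (le_of_eq (by ring))) hβ0.le
    have e4 : N ^ (-(2 / 3) : ℝ) = N ^ ((1 + σ) * (1 + β)) * N ^ (-m) * N ^ ((2 - σ) * β) := by
      rw [← Real.rpow_add hN, ← Real.rpow_add hN]
      congr 1
      rw [hmd, hβ]; ring
    rw [e1, e2, e4]
    have hw : 0 ≤ 49 * ((18 * B ^ (2 / p)) ^ (1 + β) * N ^ ((1 + σ) * (1 + β)))
        * (N ^ (-m) * 8 ^ m) * (2 ^ m) ^ (1 / β) := by positivity
    calc _ = (49 * ((18 * B ^ (2 / p)) ^ (1 + β) * N ^ ((1 + σ) * (1 + β)))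
        * (N ^ (-m) * 8 ^ m) * (2 ^ m) ^ (1 / β)) * ((1 + T)
          * (∫ t in 0..T, b (N / 4) t) ^ β) := by ring
      _ ≤ (49 * ((18 * B ^ (2 / p)) ^ (1 + β) * N ^ ((1 + σ) * (1 + β)))
        * (N ^ (-m) * 8 ^ m) * (2 ^ m) ^ (1 / β)) * ((1 + Ts)
          * ((Ts * m₀ ^ σ) ^ β * N ^ ((2 - σ) * β))) := by gcongr
      _ = _ := by ring)
  intro t ht
  refine ae_le_of_excess_eq_zero ((ev (N / 2)).2.1 t ht) (le_of_forall_pos_le_add fun ε hε => ?_)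
  obtain ⟨k, hk1, hk2, hk3⟩ := key t ht ε hε
  rw [zero_add]
  refine le_trans (integral_mono ((ev (N / 2)).2.1 t ht) ((ev k).2.1 t ht) fun x => ?_) hk3
  exact pow_le_pow_left₀ (excess_nonneg _ _) (excess_mono (by linarith) _) 4

/-- The density is bounded in terms of the data: the qualitative bound of a strong solution is halved
until it falls below a threshold that depends on the data only. -/
lemma exists_density_bound {γ : ℝ} (hγ : 1 < γ) (hγ' : γ < 7 / 3) (Ts E R V : ℝ) :
    ∃ N : ℝ, 0 < N ∧ ∀ (T : ℝ) (ρ ρt : ℝ → T3 → ℝ) (v vt : Fin 3 → ℝ → T3 → ℝ),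
      Evolution γ T ρ ρt v vt → T ≤ Ts → DataBound γ E R V ρ v →
        ∀ t ∈ Set.Icc 0 T, ∀ᵐ x, ρ t x ≤ N := by
  obtain ⟨p, B, hp, hB, hv⟩ := exists_velocity_Lp_bound hγ hγ' Ts E R V
  set m₀ := 1 + (γ - 1) * E with hm₀
  set C₀ := 49 * (1 + Ts) * (18 * B ^ (2 / p)) ^ (1 + (1 - 2 / p - 1 / 3))
      * 8 ^ (4 * (1 - 2 / p) + 2 / 3) * (Ts * m₀ ^ (1 - 2 / p)) ^ (1 - 2 / p - 1 / 3)
      * (2 ^ (4 * (1 - 2 / p) + 2 / 3)) ^ (1 / (1 - 2 / p - 1 / 3)) with hC₀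
  set N₀ := 1 + |C₀| ^ (3 / 2 : ℝ) + |4 * R| with hN₀
  have hN₀1 : 1 ≤ N₀ := by
    have : 0 ≤ |C₀| ^ (3 / 2 : ℝ) := by positivity
    have := abs_nonneg (4 * R)
    linarith
  refine ⟨N₀, by linarith, fun T ρ ρt v vt h hT hD => ?_⟩
  have half : ∀ N, N₀ ≤ N → (∀ t ∈ Set.Icc 0 T, ∀ᵐ x, ρ t x ≤ N) →
      ∀ t ∈ Set.Icc 0 T, ∀ᵐ x, ρ t x ≤ N / 2 := by
    intro N hN hρ
    have hNpos : 0 < N := by linarith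
    refine h.density_half hp hNpos hT hρ (fun t ht i => hv T ρ ρt v vt h hT hD t ht i)
      (fun t ht => ((h.energy_bounds hγ hD.energy_eq).2 t ht).2.1) hD.ρ_le ?_ ?_
    · have h1 : 0 ≤ |C₀| ^ (3 / 2 : ℝ) := by positivity
      have := le_abs_self (4 * R)
      linarith
    · have h1 : |C₀| ^ (3 / 2 : ℝ) ≤ N := by
        have := abs_nonneg (4 * R)
        linarith
      have h2 : |C₀| ≤ N ^ (2 / 3 : ℝ) := by
        have := Real.rpow_le_rpow (by positivity) h1 (by norm_num : (0:ℝ) ≤ 2 / 3)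
        rwa [← Real.rpow_mul (abs_nonneg _), show (3 / 2 : ℝ) * (2 / 3) = 1 by norm_num,
          Real.rpow_one] at this
      have h3 : 0 < N ^ (2 / 3 : ℝ) := by positivity
      rw [Real.rpow_neg hNpos.le, ← div_eq_mul_inv, div_le_one h3]
      exact (le_abs_self _).trans h2
  obtain ⟨c, C, hc, hr⟩ := h.range_ρ
  have iter : ∀ n : ℕ, ∀ t ∈ Set.Icc 0 T, ∀ᵐ x, ρ t x ≤ max (C / 2 ^ n) N₀ := by
    intro n
    induction n with
    | zero =>
      intro t ht
      filter_upwards [hr t ht] with x hx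
      exact hx.2.trans (by simp)
    | succ n ih =>
      intro t ht
      have h1 := half (max (C / 2 ^ n) N₀) (le_max_right _ _) ih t ht
      filter_upwards [h1] with x hx
      rcases le_total (C / 2 ^ n) N₀ with h2 | h2
      · rw [max_eq_right h2] at hx
        refine hx.trans (le_trans ?_ (le_max_right _ _))
        linarith
      · rw [max_eq_left h2] at hx
        refine hx.trans (le_trans (le_of_eq ?_) (le_max_left _ _))
        rw [pow_succ]; field_simp
  obtain ⟨n, hn⟩ := pow_unbounded_of_one_lt C (by norm_num : (1:ℝ) < 2)
  intro t ht
  filter_upwards [iter n t ht] with x hx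
  refine hx.trans (max_le ?_ le_rfl)
  rw [div_le_iff₀ (by positivity)]
  have : (0:ℝ) < 2 ^ n := by positivity
  nlinarith

/-! ### The bound of the effective velocity -/

namespace Evolution

variable {γ T : ℝ} {ρ ρt : ℝ → T3 → ℝ} {v vt : Fin 3 → ℝ → T3 → ℝ}

/-- Exponential moments of the effective velocity grow at most like those of a diffusion: the
factor `l ^ 2` in the rate is what makes the tails Gaussian. -/
lemma exp_moment_le (h : Evolution γ T ρ ρt v vt) (hγ : 1 < γ) {N E R V : ℝ} (hN : 0 < N)
    (hρN : ∀ t ∈ Set.Icc 0 T, ∀ᵐ x, ρ t x ≤ N) (hD : DataBound γ E R V ρ v) (i : Fin 3) {ε l : ℝ}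
    (hε : |ε| = 1) (hl : 0 ≤ l) :
    ∀ t ∈ Set.Icc 0 T, ∫ x, ρ t x * Real.exp (l * (ε * v i t x))
      ≤ (1 + R * Real.exp (l * V)) * Real.exp (1 / 2 * N ^ (2 * γ - 2) * l ^ 2 * t) := by
  have h0 : (0:ℝ) ∈ Set.Icc 0 T := ⟨le_rfl, h.pos.le⟩
  have hε2 : ε ^ 2 = 1 := by rw [← sq_abs, hε, one_pow]
  have d1 : ∀ c x : ℝ, HasDerivAt (fun x => c * Real.exp (l * (ε * x)))
      (c * (l * ε) * Real.exp (l * (ε * x))) x := fun c x => by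
    have := ((((hasDerivAt_id x).const_mul ε).const_mul l).exp).const_mul c
    exact this.congr_deriv (by simp only [id]; ring)
  have cE : ∀ c : ℝ, Continuous fun x : ℝ => c * Real.exp (l * (ε * x)) := fun c => by fun_prop
  obtain ⟨⟨L, hL⟩, k2, k3⟩ := h.velocity i (F := fun x => 1 * Real.exp (l * (ε * x)))
    (d1 1) (d1 _) (cE _)
  simp only [one_mul] at hL k2 k3
  have nn : ∀ t ∈ Set.Icc 0 T, 0 ≤ ∫ x, ρ t x * Real.exp (l * (ε * v i t x)) := fun t ht =>
    integral_nonneg_of_ae ((h.ρ_pos ht).mono fun x hx => mul_nonneg hx.le (Real.exp_pos _).le)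
  have init : ∫ x, ρ 0 x * Real.exp (l * (ε * v i 0 x)) ≤ R * Real.exp (l * V) := by
    have := integral_mono_ae (k2 0 h0) (integrable_const (R * Real.exp (l * V))) (by
      filter_upwards [h.ρ_pos h0, hD.ρ_le, hD.v_le i] with x hx h2 h3
      have : ε * v i 0 x ≤ V := by
        refine (le_abs_self _).trans ?_
        rw [abs_mul, hε, one_mul]; exact h3
      have := hx.le.trans h2
      gcongr)
    simpa using this
  intro t ht
  have key := gronwall_of_ae_deriv h.pos.le (K := 1 / 2 * N ^ (2 * γ - 2) * l ^ 2)
    (Φ := fun t => 1 + ∫ x, ρ t x * Real.exp (l * (ε * v i t x))) (Ψ := fun _ => 0) ⟨L, by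
      refine LipschitzOnWith.of_dist_le_mul fun t ht s hs => ?_
      have := hL.dist_le_mul t ht s hs
      simpa [Real.dist_eq] using this⟩ ⟨0, (LipschitzWith.const 0).lipschitzOnWith⟩
    (fun t ht => by linarith [nn t ht]) (by
      filter_upwards [k3, h.slice, ae_restrict_mem measurableSet_Ioo] with t hd ⟨S, hS⟩ ht
      have htI : t ∈ Set.Icc 0 T := Set.Ioo_subset_Icc_self ht
      refine ⟨_, 0, (hd S hS).const_add 1, hasDerivAt_const _ _, ?_⟩
      have hll : l * ε * (l * ε) = l ^ 2 := by linear_combination l ^ 2 * hε2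
      have h1 := S.velocity_le i (cE (l * ε * (l * ε))) fun x => by rw [hll]; positivity
      have p1 : 0 ≤ 1 / 2 * ∑ j, ∫ x, S.ρ x * (l * ε * (l * ε) * Real.exp (l * (ε * S.v i x)))
          * S.dv i j x ^ 2 := by
        refine mul_nonneg (by norm_num) (Finset.sum_nonneg fun j _ => integral_nonneg_of_ae ?_)
        filter_upwards [S.ρ_pos] with x hx
        rw [hll]
        simp only [Pi.zero_apply]; positivity
      have h2 : ∫ x, S.ρ x ^ (2 * γ - 1) * (l * ε * (l * ε) * Real.exp (l * (ε * S.v i x)))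
          ≤ N ^ (2 * γ - 2) * l ^ 2 * ∫ x, S.ρ x * Real.exp (l * (ε * S.v i x)) := by
        rw [← integral_const_mul]
        have b1 := (S.essBdd_rpow (2 * γ - 1)).mul (S.essBdd_comp_v (cE (l * ε * (l * ε))) i)
        have b2 := S.essBdd_ρ.mul (S.essBdd_comp_v
          (by fun_prop : Continuous fun x : ℝ => Real.exp (l * (ε * x))) i)
        refine integral_mono_ae b1.integrable (b2.integrable.const_mul _) ?_
        have hN' : ∀ᵐ x, S.ρ x ≤ N := by rw [hS.ρ_eq]; exact hρN t htI
        filter_upwards [S.ρ_pos, hN'] with x hx hxN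
        have e1 : S.ρ x ^ (2 * γ - 1) ≤ N ^ (2 * γ - 2) * S.ρ x := by
          rw [show 2 * γ - 1 = (2 * γ - 2) + 1 by ring, Real.rpow_add_one hx.ne']
          gcongr
          linarith
        rw [hll]
        calc S.ρ x ^ (2 * γ - 1) * (l ^ 2 * Real.exp (l * (ε * S.v i x)))
            ≤ (N ^ (2 * γ - 2) * S.ρ x) * (l ^ 2 * Real.exp (l * (ε * S.v i x))) := by gcongr
          _ = _ := by ring
      rw [hS.ρ_eq, hS.v_eq] at h1 h2 p1
      rw [hS.ρ_eq, hS.v_eq]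
      have p2 : 0 ≤ 1 / 2 * N ^ (2 * γ - 2) * l ^ 2 := by positivity
      dsimp only at h1 h2 p1 ⊢
      linarith) t ht
  simp only [sub_zero, add_zero] at key
  have := mul_le_mul_of_nonneg_right (add_le_add (le_refl (1:ℝ)) init)
    (Real.exp_pos (1 / 2 * N ^ (2 * γ - 2) * l ^ 2 * t)).le
  linarith

/-- De Giorgi's iteration for the effective velocity: smallness of the square of the excess over
`M`, weighed against a power of the lower bound `θ⁻¹` of the density, bounds the velocity by
`2M`. -/
lemma velocity_le_two_mul (h : Evolution γ T ρ ρt v vt) (hγ : 1 < γ) {N θ M A Ts : ℝ}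
    (hN : 0 < N) (hθ : 0 < θ) (hM : 0 < M) (hTs : T ≤ Ts)
    (hρN : ∀ t ∈ Set.Icc 0 T, ∀ᵐ x, ρ t x ≤ N) (hρθ : ∀ t ∈ Set.Icc 0 T, ∀ᵐ x, θ⁻¹ ≤ ρ t x)
    (i : Fin 3) {ε : ℝ} (hε : |ε| = 1) (h0 : ∀ᵐ x, |v i 0 x| ≤ M)
    (hA : ∀ t ∈ Set.Icc 0 T, ∫ x, excess M (ε * v i t x) ^ 2 ≤ A)
    (hs : 49 * θ ^ (5 / 3 : ℝ) * (1 + Ts) * (6 * N ^ (2 * γ - 1)) ^ (5 / 3 : ℝ)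
      * (M / 2) ^ (-(14 / 3) : ℝ) * (Ts * A) ^ (2 / 3 : ℝ) * 2 ^ 7 ≤ 1) :
    ∀ t ∈ Set.Icc 0 T, ∀ᵐ x, ε * v i t x ≤ 2 * M := by
  have hT0 := h.pos
  have hε2 : ε ^ 2 = 1 := by rw [← sq_abs, hε, one_pow]
  set D := 6 * N ^ (2 * γ - 1) with hD
  have hD0 : 0 ≤ D := by positivity
  set y : ℝ → ℝ → ℝ := fun k t => ∫ x, ρ t x * excess k (ε * v i t x) ^ 4 with hy
  set b : ℝ → ℝ → ℝ := fun k t => ∫ x, excess k (ε * v i t x) ^ 2 with hb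
  have cε : Continuous fun x : ℝ => ε * x := continuous_const.mul continuous_id
  have cx : ∀ (k : ℝ) (n : ℕ), Continuous fun x => excess k (ε * x) ^ n := fun k n =>
    ((continuous_excess k).comp cε).pow n
  have dε : ∀ x : ℝ, HasDerivAt (fun x => ε * x) ε x := fun x => by
    simpa using (hasDerivAt_id x).const_mul ε
  have ev := fun k => h.velocity i (F := fun x => excess k (ε * x) ^ 4)
    (F' := fun x => ε * (4 * excess k (ε * x) ^ 3)) (F'' := fun x => 12 * excess k (ε * x) ^ 2)
    (fun x => ((hasDerivAt_excess_four k (ε * x)).comp x (dε x)).congr_deriv (by ring))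
    (fun x => (((hasDerivAt_four_mul_excess_cube k (ε * x)).comp x (dε x)).const_mul ε).congr_deriv
      (by linear_combination (12 * excess k (ε * x) ^ 2) * hε2))
    (continuous_const.mul (cx k 2))
  have ib : ∀ k n, ∀ t ∈ Set.Icc 0 T, Integrable fun x => excess k (ε * v i t x) ^ n :=
    fun k n t ht => (h.essBdd_comp_v ht i (cx k n)).integrable
  have ynn : ∀ k, ∀ t ∈ Set.Icc 0 T, 0 ≤ y k t := fun k t ht =>
    integral_nonneg_of_ae ((h.ρ_pos ht).mono fun x hx =>
      mul_nonneg hx.le (pow_nonneg (excess_nonneg _ _) 4))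
  have bnn : ∀ k t, 0 ≤ b k t := fun k t => integral_nonneg fun x => sq_nonneg _
  have hbc : ∀ k, ContinuousOn (b k) (Set.Icc 0 T) := fun k => by
    obtain ⟨B, hB, hv⟩ := h.range_v
    obtain ⟨L, hL0, hL⟩ := exists_lipschitz_excess_rpow k B (one_le_two : (1:ℝ) ≤ 2)
    simp only [Real.rpow_two] at hL
    refine (h.curve_v i).continuousOn_integral_comp (F := fun x => excess k (ε * x) ^ 2)
      (s := {x | ε * x ≤ B}) hL0 (fun x hx z hz => ?_) (fun t ht => ?_) (ib k 2)
    · have := hL _ hx _ hz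
      rwa [← mul_sub, abs_mul, hε, one_mul] at this
    · filter_upwards [hv t ht i] with x hx
      refine (le_abs_self _).trans ?_
      rw [abs_mul, hε, one_mul]; exact hx
  -- the lower bound of the density absorbs the weight
  have weight : ∀ {r w : ℝ}, θ⁻¹ ≤ r → 0 ≤ w → w ≤ θ * (r * w) := fun {r w} hr hw => by
    have : 1 ≤ θ * r := by
      have := mul_le_mul_of_nonneg_left hr hθ.le
      rwa [mul_inv_cancel₀ hθ.ne'] at this
    nlinarith
  have h4 : ∀ k, ∀ t ∈ Set.Icc 0 T, ∫ x, excess k (ε * v i t x) ^ 4 ≤ θ * y k t := by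
    intro k t ht
    simp only [hy]
    rw [← integral_const_mul]
    refine integral_mono_ae (ib k 4 t ht) (((ev k).2.1 t ht).const_mul θ) ?_
    filter_upwards [hρθ t ht] with x hx
    exact weight hx (pow_nonneg (excess_nonneg _ _) 4)
  have step : ∀ k k', k < k' → ∀ᵐ t ∂(volume.restrict (Set.Ioo 0 T)), ∃ d,
      HasDerivAt (y k) d t ∧ d ≤ D * b k t ∧
      b k' t ≤ (49 * θ ^ (5 / 3 : ℝ)) * (k' - k) ^ (-(14 / 3) : ℝ) * y k t ^ (2 / 3 : ℝ)
        * (y k t + D * b k t - d) := by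
    intro k k' hkk'
    filter_upwards [(ev k).2.2, h.slice, ae_restrict_mem measurableSet_Ioo] with t hd ⟨S, hS⟩ ht
    have htI : t ∈ Set.Icc 0 T := Set.Ioo_subset_Icc_self ht
    have hv : ∀ j, S.v j = v j t := fun j => by rw [hS.v_eq]
    have c2 : Continuous fun x => 12 * excess k (ε * x) ^ 2 := continuous_const.mul (cx k 2)
    have h1 := S.velocity_le i c2 fun x => by positivity
    have i1 : ∀ j, Integrable fun x => S.ρ x * (excess k (ε * S.v i x) ^ 2 * S.dv i j x ^ 2) :=
      fun j => by
        have := S.integrable_mul_dv_sq (S.essBdd_ρ.mul (S.essBdd_comp_v (cx k 2) i)) i j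
        simpa only [mul_assoc] using this
    have i2 : ∀ j, Integrable fun x => excess k (ε * S.v i x) ^ 2 * S.dv i j x ^ 2 :=
      fun j => S.integrable_mul_dv_sq (S.essBdd_comp_v (cx k 2) i) i j
    set X := ∑ j, ∫ x, S.ρ x * (excess k (ε * S.v i x) ^ 2 * S.dv i j x ^ 2) with hX
    have hX0 : 0 ≤ X := Finset.sum_nonneg fun j _ => integral_nonneg_of_ae <| by
      filter_upwards [S.ρ_pos] with x hx
      simp only [Pi.zero_apply]; positivity
    have e1 : 1 / 2 * ∑ j, ∫ x, S.ρ x * (12 * excess k (ε * S.v i x) ^ 2) * S.dv i j x ^ 2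
        = 6 * X := by
      rw [hX, Finset.mul_sum, Finset.mul_sum]
      refine Finset.sum_congr rfl fun j _ => ?_
      rw [← integral_const_mul, ← integral_const_mul]
      congr 1; funext x; ring
    have h2 : 1 / 2 * ∫ x, S.ρ x ^ (2 * γ - 1) * (12 * excess k (ε * S.v i x) ^ 2)
        ≤ D * b k t := by
      simp only [hb, ← hv]
      rw [← integral_const_mul, ← integral_const_mul]
      refine integral_mono_ae (((S.essBdd_rpow _).mul (S.essBdd_comp_v c2 i)).integrable.const_mul _)
        ((S.essBdd_comp_v (cx k 2) i).integrable.const_mul _) ?_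
      have hN' : ∀ᵐ x, S.ρ x ≤ N := by rw [hS.ρ_eq]; exact hρN t htI
      filter_upwards [S.ρ_pos, hN'] with x hx hxN
      have : S.ρ x ^ (2 * γ - 1) ≤ N ^ (2 * γ - 1) :=
        Real.rpow_le_rpow hx.le hxN (by linarith)
      calc 1 / 2 * (S.ρ x ^ (2 * γ - 1) * (12 * excess k (ε * S.v i x) ^ 2))
          = 6 * S.ρ x ^ (2 * γ - 1) * excess k (ε * S.v i x) ^ 2 := by ring
        _ ≤ D * excess k (ε * S.v i x) ^ 2 := by rw [hD]; gcongr
    rw [e1] at h1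
    have h3 := excess_interpolation (f := fun x => ε * S.v i x) (g := fun j x => ε * S.dv i j x)
      (fun j => (S.grad_v i j).const_mul ε) (B := Classical.choose S.range_v) (by
        filter_upwards [(Classical.choose_spec S.range_v).2 i] with x hx
        rwa [abs_mul, hε, one_mul]) (σ := 1) (by norm_num) hkk'
    simp only [div_one, Real.rpow_two, Real.rpow_one, mul_pow, hε2, one_mul] at h3
    have h5 : ∑ j, ∫ x, excess k (ε * S.v i x) ^ 2 * S.dv i j x ^ 2 ≤ θ * X := by
      rw [hX, Finset.mul_sum]
      refine Finset.sum_le_sum fun j _ => ?_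
      rw [← integral_const_mul]
      refine integral_mono_ae (i2 j) ((i1 j).const_mul θ) ?_
      have hθ' : ∀ᵐ x, θ⁻¹ ≤ S.ρ x := by rw [hS.ρ_eq]; exact hρθ t htI
      filter_upwards [hθ'] with x hx
      exact weight hx (by positivity)
    have h6 := h4 k t htI
    have h6' : 0 ≤ ∫ x, excess k (ε * S.v i x) ^ 4 :=
      integral_nonneg fun x => pow_nonneg (excess_nonneg _ _) _
    have hy0 := ynn k t htI
    rw [← hv] at h6
    refine ⟨_, hd S hS, h1.trans (by linarith), ?_⟩
    set d := ∫ x, (-(∑ j, S.ρ x * (12 * excess k (ε * S.v i x) ^ 2) * S.dv i j x ^ 2)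
          + S.ρ x ^ γ * (12 * excess k (ε * S.v i x) ^ 2) * S.dv i i x) with hdd
    have hkd : 0 < k' - k := by linarith
    have e2 : θ ^ (5 / 3 : ℝ) = θ ^ (2 / 3 : ℝ) * θ := by
      rw [← Real.rpow_add_one hθ.ne']; norm_num
    calc b k' t = ∫ x, excess k' (ε * S.v i x) ^ 2 := by simp only [hb, hv]
      _ ≤ _ := h3
      _ ≤ (k' - k) ^ (-(14 / 3) : ℝ) * (θ * y k t) ^ (2 / 3 : ℝ)
          * (49 * (θ * (y k t + D * b k t - d))) := by
        have e3 : (∫ x, excess k (ε * S.v i x) ^ 4) ^ (1 - 1 / 3 : ℝ)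
            ≤ (θ * y k t) ^ (2 / 3 : ℝ) := by
          rw [show (1 - 1 / 3 : ℝ) = 2 / 3 by norm_num]
          exact Real.rpow_le_rpow h6' h6 (by norm_num)
        rw [show (-(4 * 1 + 2 / 3) : ℝ) = -(14 / 3) by norm_num]
        refine mul_le_mul (mul_le_mul_of_nonneg_left e3 (by positivity)) ?_ ?_ (by positivity)
        · have : θ * (4 * X) ≤ θ * (D * b k t - d) := by
            refine mul_le_mul_of_nonneg_left ?_ hθ.le
            linarith
          nlinarith
        · have : 0 ≤ ∑ j, ∫ x, excess k (ε * S.v i x) ^ 2 * S.dv i j x ^ 2 :=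
            Finset.sum_nonneg fun j _ => integral_nonneg fun x => by positivity
          positivity
      _ = _ := by rw [Real.mul_rpow hθ.le hy0, e2]; ring
  have key := deGiorgi (T := T) (D := D) (K := 49 * θ ^ (5 / 3 : ℝ)) (m := 14 / 3) (β := 2 / 3)
    (M := M) (y := y) (b := b) hT0 hD0 (by positivity) (by norm_num) (by norm_num) hM
    (fun k _ => (ev k).1) (fun k hk => by
      have : ∀ᵐ x, ρ 0 x * excess k (ε * v i 0 x) ^ 4 = 0 := by
        filter_upwards [h0] with x hx
        rw [excess_eq_zero]
        · norm_num
        · refine (le_abs_self _).trans ?_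
          rw [abs_mul, hε, one_mul]; linarith
      simp only [hy]
      rw [integral_congr_ae this]; simp)
    (fun k _ => ynn k) (fun k _ => hbc k) (fun k _ t _ => bnn k t)
    (fun k k' _ hkk' => step k k' hkk') (by
    have ha0 : 0 ≤ ∫ t in 0..T, b M t :=
      intervalIntegral.integral_nonneg hT0.le fun t _ => bnn _ t
    have hA0 : 0 ≤ A := (bnn M 0).trans (hA 0 ⟨le_rfl, hT0.le⟩)
    have ha : ∫ t in 0..T, b M t ≤ Ts * A := by
      have := intervalIntegral.integral_mono_on (μ := volume) (f := b M) (g := fun _ => A) hT0.le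
        ((hbc M).mono (by rw [Set.uIcc_of_le hT0.le])).intervalIntegrable
        intervalIntegrable_const hA
      rw [intervalIntegral.integral_const, sub_zero, smul_eq_mul] at this
      exact this.trans (by gcongr)
    have e : ((2:ℝ) ^ (14 / 3 : ℝ)) ^ (1 / (2 / 3) : ℝ) = 2 ^ 7 := by
      rw [← Real.rpow_mul (by norm_num), ← Real.rpow_natCast]
      norm_num
    refine le_trans ?_ hs
    rw [e, show (1 + 2 / 3 : ℝ) = 5 / 3 by norm_num]
    have hTs0 : 0 ≤ Ts := hT0.le.trans hTs
    gcongr)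
  intro t ht
  refine ae_le_of_excess_eq_zero (ib (2 * M) 4 t ht) ((h4 (2 * M) t ht).trans ?_)
  have : y (2 * M) t ≤ 0 := le_of_forall_pos_le_add fun δ hδ => by
    obtain ⟨k, hk1, hk2, hk3⟩ := key t ht δ hδ
    rw [zero_add]
    refine le_trans (integral_mono_ae ((ev (2 * M)).2.1 t ht) ((ev k).2.1 t ht) ?_) hk3
    filter_upwards [h.ρ_pos ht] with x hx
    exact mul_le_mul_of_nonneg_left
      (pow_le_pow_left₀ (excess_nonneg _ _) (excess_mono hk2 _) 4) hx.le
  exact mul_nonpos_of_nonneg_of_nonpos hθ.le this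

end Evolution

/-- An exponential tail of the excess. -/
lemma excess_sq_le_exp {l M x : ℝ} (hl : 1 ≤ l) :
    excess M x ^ 2 ≤ 2 * Real.exp (-(l * M)) * Real.exp (l * x) := by
  have e : 2 * Real.exp (-(l * M)) * Real.exp (l * x) = 2 * Real.exp (l * (x - M)) := by
    rw [mul_assoc, ← Real.exp_add]; congr 2; ring
  rw [e]
  rcases le_total x M with hx | hx
  · rw [excess_eq_zero hx, zero_pow two_ne_zero]; positivity
  · rw [excess, max_eq_left (by linarith)]
    have h0 : 0 ≤ x - M := by linarith
    have h1 := Real.quadratic_le_exp_of_nonneg h0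
    have h2 : Real.exp (x - M) ≤ Real.exp (l * (x - M)) := by
      gcongr; nlinarith
    nlinarith

/-- The effective velocity is bounded by the square root of the logarithm of the inverse of the
density. The exponential moments of order `l = √(log θ)` make the excess over the level `C l` smaller
than any fixed power of `θ⁻¹ = e^{-l²}`, hence small enough for De Giorgi's iteration. -/
lemma exists_velocity_bound {γ : ℝ} (hγ : 1 < γ) {N Ts R V : ℝ} (hN : 0 < N) (hTs : 0 ≤ Ts)
    (hR : 0 ≤ R) (hV : 0 ≤ V) :
    ∃ C : ℝ, 0 ≤ C ∧ ∀ (E T θ : ℝ) (ρ ρt : ℝ → T3 → ℝ) (v vt : Fin 3 → ℝ → T3 → ℝ),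
      Evolution γ T ρ ρt v vt → T ≤ Ts → DataBound γ E R V ρ v →
      (∀ t ∈ Set.Icc 0 T, ∀ᵐ x, ρ t x ≤ N) → (∀ t ∈ Set.Icc 0 T, ∀ᵐ x, θ⁻¹ ≤ ρ t x) →
      0 < θ → 1 ≤ Real.log θ →
        ∀ t ∈ Set.Icc 0 T, ∀ i, ∀ᵐ x, |v i t x| ≤ C * Real.sqrt (Real.log θ) := by
  set J := 1 / 2 * N ^ (2 * γ - 2) with hJ
  have hJ0 : 0 ≤ J := by positivity
  set Q := 49 * (1 + Ts) * (6 * N ^ (2 * γ - 1)) ^ (5 / 3 : ℝ) * 2 ^ (14 / 3 : ℝ)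
    * (Ts * (2 * (1 + R))) ^ (2 / 3 : ℝ) * 2 ^ 7 with hQ
  have hQ0 : 0 ≤ Q := by positivity
  -- the exponent of `θ` in the smallness condition becomes `-Q`
  set C := V + J * Ts + 1 + 5 / 2 + 3 / 2 * Q with hC
  have hJT : 0 ≤ J * Ts := by positivity
  have hC1 : 1 ≤ C := by linarith
  refine ⟨2 * C, by linarith, fun E T θ ρ ρt v vt h hT hD hρN hρθ hθ hlog t ht i => ?_⟩
  set L := Real.sqrt (Real.log θ) with hL
  have hL2 : L ^ 2 = Real.log θ := Real.sq_sqrt (by linarith)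
  have hL1 : 1 ≤ L := Real.one_le_sqrt.2 hlog
  have hLL : L ≤ L ^ 2 := by nlinarith
  have hθL : θ = Real.exp (L ^ 2) := by rw [hL2, Real.exp_log hθ]
  have side : ∀ ε : ℝ, |ε| = 1 → ∀ᵐ x, ε * v i t x ≤ 2 * (C * L) := by
    intro ε hε
    have hM : 1 ≤ C * L := one_le_mul_of_one_le_of_one_le hC1 hL1
    set X := Real.exp (L ^ 2 * (1 - C + V + J * Ts)) with hX
    refine h.velocity_le_two_mul hγ hN hθ (by linarith) hT hρN hρθ i hε (A := 2 * (1 + R) * X)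
      ?_ (fun s hs => ?_) ?_ t ht
    · filter_upwards [hD.v_le i] with x hx
      have : V ≤ C * 1 := by linarith
      exact hx.trans (this.trans (by gcongr))
    · have hm := h.exp_moment_le hγ hN hρN hD i hε (by linarith : 0 ≤ L) s hs
      have c2 : Continuous fun x => excess (C * L) (ε * x) ^ 2 :=
        ((continuous_excess _).comp (continuous_const.mul continuous_id)).pow 2
      have cE : Continuous fun x : ℝ => Real.exp (L * (ε * x)) := by fun_prop
      have h1 : ∫ x, excess (C * L) (ε * v i s x) ^ 2
          ≤ θ * (2 * Real.exp (-(L * (C * L)))) * ∫ x, ρ s x * Real.exp (L * (ε * v i s x)) := by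
        rw [← integral_const_mul]
        refine integral_mono_ae (h.essBdd_comp_v hs i c2).integrable
          (((h.essBdd_ρ hs).mul (h.essBdd_comp_v hs i cE)).integrable.const_mul _) ?_
        filter_upwards [hρθ s hs] with x hx
        have e1 := excess_sq_le_exp (M := C * L) (x := ε * v i s x) hL1
        have e2 : 1 ≤ θ * ρ s x := by
          have := mul_le_mul_of_nonneg_left hx hθ.le
          rwa [mul_inv_cancel₀ hθ.ne'] at this
        refine e1.trans ?_
        calc _ ≤ (2 * Real.exp (-(L * (C * L))) * Real.exp (L * (ε * v i s x)))
              * (θ * ρ s x) := le_mul_of_one_le_right (by positivity) e2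
          _ = _ := by ring
      refine h1.trans ?_
      have e3 : 1 + R * Real.exp (L * V) ≤ (1 + R) * Real.exp (L ^ 2 * V) := by
        have a1 : Real.exp (L * V) ≤ Real.exp (L ^ 2 * V) := by gcongr
        have a2 : 1 ≤ Real.exp (L ^ 2 * V) := Real.one_le_exp (by positivity)
        nlinarith
      have e4 : Real.exp (1 / 2 * N ^ (2 * γ - 2) * L ^ 2 * s) ≤ Real.exp (L ^ 2 * (J * Ts)) := by
        have : J * s ≤ J * Ts := mul_le_mul_of_nonneg_left (hs.2.trans hT) hJ0
        rw [← hJ, mul_comm J, mul_assoc]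
        gcongr
      calc _ ≤ θ * (2 * Real.exp (-(L * (C * L)))) * (((1 + R) * Real.exp (L ^ 2 * V))
            * Real.exp (L ^ 2 * (J * Ts))) := by
            refine mul_le_mul_of_nonneg_left (hm.trans ?_) (by positivity)
            exact mul_le_mul e3 e4 (Real.exp_pos _).le (by positivity)
        _ = 2 * (1 + R) * (Real.exp (L ^ 2) * Real.exp (-(L * (C * L))) * Real.exp (L ^ 2 * V)
            * Real.exp (L ^ 2 * (J * Ts))) := by rw [← hθL]; ring
        _ = _ := by
            rw [← Real.exp_add, ← Real.exp_add, ← Real.exp_add, hX]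
            congr 2; ring
    · have m1 : (C * L / 2) ^ (-(14 / 3) : ℝ) ≤ 2 ^ (14 / 3 : ℝ) := by
        rw [Real.rpow_neg (by positivity), ← Real.inv_rpow (by positivity), inv_div]
        refine Real.rpow_le_rpow (by positivity) ?_ (by norm_num)
        rw [div_le_iff₀ (by positivity)]; linarith
      have m2 : (Ts * (2 * (1 + R) * X)) ^ (2 / 3 : ℝ)
          = (Ts * (2 * (1 + R))) ^ (2 / 3 : ℝ)
            * Real.exp (L ^ 2 * (1 - C + V + J * Ts) * (2 / 3)) := by
        rw [← mul_assoc, Real.mul_rpow (by positivity) (Real.exp_pos _).le, ← Real.exp_mul]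
      have m3 : θ ^ (5 / 3 : ℝ) = Real.exp (L ^ 2 * (5 / 3)) := by rw [hθL, ← Real.exp_mul]
      rw [m2, m3]
      calc _ ≤ 49 * Real.exp (L ^ 2 * (5 / 3)) * (1 + Ts) * (6 * N ^ (2 * γ - 1)) ^ (5 / 3 : ℝ)
            * 2 ^ (14 / 3 : ℝ) * ((Ts * (2 * (1 + R))) ^ (2 / 3 : ℝ)
            * Real.exp (L ^ 2 * (1 - C + V + J * Ts) * (2 / 3))) * 2 ^ 7 := by gcongr
        _ = Q * (Real.exp (L ^ 2 * (5 / 3)) * Real.exp (L ^ 2 * (1 - C + V + J * Ts) * (2 / 3))) := by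
            rw [hQ]; ring
        _ = Q * Real.exp (-(L ^ 2 * Q)) := by
            rw [← Real.exp_add]; congr 2; rw [hC]; ring
        _ ≤ 1 := by
            rw [Real.exp_neg, ← div_eq_mul_inv, div_le_one (Real.exp_pos _)]
            have a1 := Real.add_one_le_exp (L ^ 2 * Q)
            nlinarith
  filter_upwards [side 1 (by norm_num), side (-1) (by norm_num)] with x h1 h2
  rw [abs_le]
  constructor <;> linarith

/-! ### Essential suprema -/

lemma ae_norm_le_toReal_eLpNorm_top {F : Type*} [NormedAddCommGroup F] {f : T3 → F} {B : ℝ}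
    (hf : ∀ᵐ x, ‖f x‖ ≤ B) : ∀ᵐ x, ‖f x‖ ≤ (eLpNorm f ⊤ volume).toReal := by
  have hfin : eLpNorm f ⊤ volume < ⊤ := by
    rw [eLpNorm_exponent_top]
    exact eLpNormEssSup_lt_top_of_ae_bound hf
  filter_upwards [ae_le_eLpNormEssSup (f := f) (μ := volume)] with x hx
  rw [← eLpNorm_exponent_top] at hx
  have := ENNReal.toReal_mono hfin.ne hx
  simpa using this

lemma one_le_log_Theta (ρ : ℝ → T3 → ℝ) (T : ℝ) : 1 ≤ Real.log (Theta ρ T) := by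
  have h1 : Real.exp (25 / 9) ≤ Theta ρ T := by
    rw [Theta]
    exact le_add_of_nonneg_left ENNReal.toReal_nonneg
  have h2 := Real.log_le_log (Real.exp_pos _) h1
  rw [Real.log_exp] at h2
  linarith

lemma Theta_pos (ρ : ℝ → T3 → ℝ) (T : ℝ) : 0 < Theta ρ T :=
  add_pos_of_nonneg_of_pos ENNReal.toReal_nonneg (Real.exp_pos _)

/-- The reciprocal of `Θ` is a lower bound of the density. -/
lemma Evolution.inv_Theta_le {γ T : ℝ} {ρ ρt : ℝ → T3 → ℝ} {v vt : Fin 3 → ℝ → T3 → ℝ}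
    (h : Evolution γ T ρ ρt v vt) : ∀ t ∈ Set.Icc 0 T, ∀ᵐ x, (Theta ρ T)⁻¹ ≤ ρ t x := by
  obtain ⟨c, C, hc, hr⟩ := h.range_ρ
  have hb : ∀ t ∈ Set.Icc 0 T, ∀ᵐ x, ‖(ρ t x)⁻¹‖ ≤ c⁻¹ := fun t ht => by
    filter_upwards [hr t ht] with x hx
    rw [Real.norm_eq_abs, abs_of_pos (inv_pos.2 (hc.trans_le hx.1))]
    exact inv_anti₀ hc hx.1
  -- the lower bound of the density makes the supremum finite
  have hfin : (⨆ t ∈ Set.Icc 0 T, eLpNorm (fun x => (ρ t x)⁻¹) ⊤ volume) ≠ ⊤ := by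
    refine ne_top_of_le_ne_top (ENNReal.ofReal_ne_top (r := c⁻¹)) (iSup₂_le fun t ht => ?_)
    rw [eLpNorm_exponent_top]
    exact eLpNormEssSup_le_of_ae_bound (hb t ht)
  intro t ht
  filter_upwards [ae_norm_le_toReal_eLpNorm_top (hb t ht), hr t ht] with x hx hx'
  have hpos : 0 < ρ t x := hc.trans_le hx'.1
  rw [Real.norm_eq_abs, abs_of_pos (inv_pos.2 hpos)] at hx
  have h1 := ENNReal.toReal_mono hfin
    (le_iSup₂ (f := fun t (_ : t ∈ Set.Icc 0 T) => eLpNorm (fun x => (ρ t x)⁻¹) ⊤ volume) t ht)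
  refine inv_le_of_inv_le₀ hpos (hx.trans (h1.trans ?_))
  rw [Theta]
  exact le_add_of_nonneg_right (Real.exp_pos _).le

lemma norm_le_sum_abs (w : E3) : ‖w‖ ≤ ∑ i, |w i| := by
  rw [EuclideanSpace.norm_eq]
  refine Real.sqrt_le_iff.2 ⟨Finset.sum_nonneg fun i _ => abs_nonneg _, ?_⟩
  exact Finset.sum_sq_le_sq_sum_of_nonneg fun i _ => abs_nonneg _

lemma eLpNorm_top_le_of_coord {f : T3 → E3} {B : ℝ} (hf : ∀ᵐ x, ∀ i, |f x i| ≤ B) :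
    eLpNorm f ⊤ volume ≤ ENNReal.ofReal (3 * B) := by
  rw [eLpNorm_exponent_top]
  refine eLpNormEssSup_le_of_ae_bound (hf.mono fun x hx => (norm_le_sum_abs _).trans ?_)
  rw [Fin.sum_univ_three]
  linarith [hx 0, hx 1, hx 2]

/-- The data of a strong solution, measured as in the statement of the velocity bound. -/
lemma IsStrongSolutionWith.dataBound {γ Tstar : ℝ} {ρ ρt : ℝ → T3 → ℝ} {v vt u : ℝ → T3 → E3}
    (h : IsStrongSolutionWith γ Tstar ρ ρt v vt) (hTs : 0 < Tstar)
    (hu : IsEffectiveVelocity Tstar ρ u v) :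
    DataBound γ (energy γ (ρ 0) (u 0)) (eLpNorm (ρ 0) ⊤ volume).toReal
      (eLpNorm (v 0) ⊤ volume).toReal ρ (fun i t x => v t x i) := by
  have h0 : (0:ℝ) ∈ Set.Icc 0 (Tstar / 2) := ⟨le_rfl, by linarith⟩
  refine ⟨(energy_eq h hTs hu).symm, ?_, fun i => ?_⟩
  · obtain ⟨c, C, hc, hr⟩ := h.range_ρ (T := Tstar / 2) (by linarith) (by linarith)
    have hb : ∀ᵐ x, ‖ρ 0 x‖ ≤ C := by
      filter_upwards [hr 0 h0] with x hx
      rw [Real.norm_eq_abs, abs_of_pos (hc.trans_le hx.1)]; exact hx.2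
    exact (ae_norm_le_toReal_eLpNorm_top hb).mono fun x hx => (le_abs_self _).trans hx
  · obtain ⟨B, hB, hv⟩ := h.range_v (T := Tstar / 2) (by linarith)
    have hb : ∀ᵐ x, ‖v 0 x‖ ≤ 3 * B := by
      filter_upwards [ae_all_iff.2 fun i => hv 0 h0 i] with x hx
      refine (norm_le_sum_abs _).trans ?_
      rw [Fin.sum_univ_three]
      linarith [hx 0, hx 1, hx 2]
    exact (ae_norm_le_toReal_eLpNorm_top hb).mono fun x hx =>
      (PiLp.norm_apply_le (v 0 x) i).trans hx

end NSK

end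

theorem mainTheorem2 (γ q : ℝ) (hγ : 1 < γ) (hγ' : γ < 7 / 3) (hq : 1 < q) (hq' : q < 4)
    (hγq : γ < 1 + 4 / (q + 2)) (Tstar : ℝ) (hTstar : 0 < Tstar) (E₀ A R V : ℝ) :
    ∃ Cv : ℝ, 1 ≤ Cv ∧
      ∀ (ρ : ℝ → NSK.T3 → ℝ) (u v : ℝ → NSK.T3 → NSK.E3),
        NSK.IsStrongSolution γ Tstar ρ v →
        NSK.IsEffectiveVelocity Tstar ρ u v →
        NSK.energy γ (ρ 0) (u 0) = E₀ →
        NSK.weightedNorm q (ρ 0) (v 0) = A →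
        (eLpNorm (ρ 0) ⊤ volume).toReal = R →
        (eLpNorm (v 0) ⊤ volume).toReal = V →
        ∀ T : ℝ, 0 < T → T < Tstar →
          (⨆ t ∈ Set.Icc 0 T, eLpNorm (v t) ⊤ volume) ≤
            ENNReal.ofReal (Cv * Real.sqrt (Real.log (NSK.Theta ρ T))) := by
  obtain ⟨N, hN, hdens⟩ := NSK.exists_density_bound hγ hγ' Tstar E₀ |R| |V|
  obtain ⟨C, hC, hvel⟩ := NSK.exists_velocity_bound hγ hN hTstar.le (abs_nonneg R) (abs_nonneg V)
  -- the three components add up to the factor `3`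
  refine ⟨3 * C + 1, by linarith, ?_⟩
  rintro ρ u v ⟨ρt, vt, h⟩ hu hE - hR hV T hT hT'
  have ev := h.evolution hT hT'
  have hD : NSK.DataBound γ E₀ |R| |V| ρ (fun i t x => v t x i) := by
    rw [← hE, ← hR, ← hV, abs_of_nonneg ENNReal.toReal_nonneg, abs_of_nonneg ENNReal.toReal_nonneg]
    exact h.dataBound hTstar hu
  have hN' := hdens T ρ ρt _ _ ev hT'.le hD
  have hlog := NSK.one_le_log_Theta ρ T
  have hb := hvel E₀ T (NSK.Theta ρ T) ρ ρt _ _ ev hT'.le hD hN' (ev.inv_Theta_le)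
    (NSK.Theta_pos ρ T) hlog
  refine iSup₂_le fun t ht => (NSK.eLpNorm_top_le_of_coord (ae_all_iff.2 (hb t ht))).trans
    (ENNReal.ofReal_le_ofReal ?_)
  have := Real.sqrt_nonneg (Real.log (NSK.Theta ρ T))
  linarith
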